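/- Let $n,m\in\mathbb{N}$, let $\Lambda\in\mathbb{R}^{n\times n}$ be diagonal and positive definite, and let $H,R,S\in\mathbb{R}^{n\times n}$, $B\in\mathbb{R}^{n\times m}$, $K\in\mathbb{R}^{m\times n}$ be arbitrary. Consider the closed loop $$X_t+\Lambda X_z=0,\quad X(0,t)=HX(1,t)+Bu(t),\quad y(t)=X(1,t)+d(t),\quad \dot\eta=R\eta+Sy,\quad u=K\eta,$$ for $z\in(0,1)$, with $X(\cdot,0)=X^0$, $\eta(0)=\eta^0$. On the Hilbert space $J=L^2((0,1);\mathbb{R}^n)\times\mathbb{R}^n$, with its standard inner product, put $$\mathrm{dom}(\mathcal A)=\{(\varphi,\eta)\in H^1((0,1);\mathbb{R}^n)\times\mathbb{R}^n:\ \varphi(0)=H\varphi(1)+BK\eta\},$$ $$\mathcal A(\varphi,\eta)=(-\Lambda\varphi_z,\,R\eta),\qquad \mathcal B(\varphi,\eta)=(0,\,S\varphi(1)),$$ so that with $x=(X,\eta)$ and $\tilde d=(0,Sd)$ the closed loop reads $\dot x=(\mathcal A+\mathcal B)x+\tilde d$, $x(0)=x^0$. **Theorem.** The operator $\mathcal A+\mathcal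 B$ with domain $\mathrm{dom}(\mathcal A)$ is the infinitesimal generator of a $C_0$-semigroup $\mathcal T$ on $J$. For every $T>0$, every $d\in L^\infty([0,T];\mathbb{R}^n)$ and every $x^0=(X^0,\eta^0)\in\mathrm{dom}(\mathcal A)$, i.e. $X^0\in H^1((0,1);\mathbb{R}^n)$, $\eta^0\in\mathbb{R}^n$ and $X^0(0)=HX^0(1)+BK\eta^0$, the closed loop has exactly one weak solution on $[0,T]$, that is, there is exactly one $x\in C^0([0,T];H^1((0,1);\mathbb{R}^n)\times\mathbb{R}^n)$ such that for every $g\in C^0([0,T];H^1((0,1);\mathbb{R}^n)\times\mathbb{R}^n)$ $$\int_0^T\langle x(s),g(s)\rangle_J\,ds+\int_0^T\langle\tilde d(s),h(s)\rangle_J\,ds+\langle x^0,h(0)\rangle_J=0,\qquad h(t)=-\int_t^T\mathcal T^*(s-t)\,g(s)\,ds,$$ where $\mathcal T^*(t)$ is the adjoint of $\mathcal T(t)$ in $J$. -/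

import Mathlib

open MeasureTheory Set Filter Topology
open scoped ContDiff ENNReal InnerProductSpace

noncomputable section

namespace HypLoop

/-- `ℝᵏ` with the Euclidean norm. -/
abbrev Vec (k : ℕ) : Type := EuclideanSpace ℝ (Fin k)

/-- A real matrix as a bounded operator between Euclidean spaces. -/
def matOp {k l : ℕ} (M : Matrix (Fin k) (Fin l) ℝ) : Vec l →L[ℝ] Vec k :=
  LinearMap.toContinuousLinearMap (Matrix.toEuclideanLin M)

/-- `L²((0,1);ℝⁿ)`. -/
abbrev L2 (n : ℕ) : Type := Lp (Vec n) 2 (volume.restrict (Ioo (0 : ℝ) 1))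

/-- `ψ` is the weak derivative of `φ` on `(0,1)`. -/
def IsWeakDeriv {n : ℕ} (φ ψ : ℝ → Vec n) : Prop :=
  ∀ θ : ℝ → ℝ, ContDiff ℝ ∞ θ → HasCompactSupport θ → tsupport θ ⊆ Ioo 0 1 →
    ∫ z in Ioo (0 : ℝ) 1, deriv θ z • φ z = -∫ z in Ioo (0 : ℝ) 1, θ z • ψ z

theorem L2.integrable {n : ℕ} (f : L2 n) :
    Integrable f (volume.restrict (Ioo (0 : ℝ) 1)) :=
  (Lp.memLp f).integrable (by norm_num)

theorem integrable_smul_of_test {n : ℕ} {θ : ℝ → ℝ} (h1 : Continuous θ)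
    (h2 : HasCompactSupport θ) {f : ℝ → Vec n} {μ : Measure ℝ} (hf : Integrable f μ) :
    Integrable (fun z => θ z • f z) μ := by
  obtain ⟨C, hC⟩ := h1.bounded_above_of_compact_support h2
  exact hf.bdd_smul C h1.aestronglyMeasurable (Eventually.of_forall hC)

/-- The Sobolev space `H¹((0,1);ℝⁿ)`: pairs `(φ, φ_z)` of `L²` functions, the second being the
weak derivative of the first, with the norm `(‖φ‖² + ‖φ_z‖²)^(1/2)` (`L²` norms). -/
def H1 (n : ℕ) : Submodule ℝ (WithLp 2 (L2 n × L2 n)) where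
  carrier := {p | IsWeakDeriv p.fst p.snd}
  zero_mem' := by
    intro θ h1 h2 h3
    have h0 := Lp.coeFn_zero (Vec n) 2 (volume.restrict (Ioo (0 : ℝ) 1))
    have e : ∀ f : ℝ → ℝ, ∫ z in Ioo (0 : ℝ) 1, f z • (0 : L2 n) z = 0 := by
      intro f
      refine integral_eq_zero_of_ae ?_
      filter_upwards [h0] with z hz
      simp only [hz, Pi.zero_apply, smul_zero]
    exact (e _).trans (by rw [WithLp.zero_snd, e, neg_zero])
  add_mem' := by
    intro p q hp hq θ h1 h2 h3
    have e1 := hp θ h1 h2 h3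
    have e2 := hq θ h1 h2 h3
    have d1 : Continuous (deriv θ) := h1.continuous_deriv (by simp)
    have d2 : HasCompactSupport (deriv θ) := h2.deriv
    have a1 : ∫ z in Ioo (0 : ℝ) 1, deriv θ z • (p + q).fst z =
        ∫ z in Ioo (0 : ℝ) 1, (deriv θ z • p.fst z + deriv θ z • q.fst z) := by
      refine integral_congr_ae ?_
      filter_upwards [Lp.coeFn_add p.fst q.fst] with z hz
      rw [WithLp.add_fst, hz, Pi.add_apply, smul_add]
    have a2 : ∫ z in Ioo (0 : ℝ) 1, θ z • (p + q).snd z =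
        ∫ z in Ioo (0 : ℝ) 1, (θ z • p.snd z + θ z • q.snd z) := by
      refine integral_congr_ae ?_
      filter_upwards [Lp.coeFn_add p.snd q.snd] with z hz
      rw [WithLp.add_snd, hz, Pi.add_apply, smul_add]
    rw [a1, a2, integral_add (integrable_smul_of_test d1 d2 (L2.integrable _))
      (integrable_smul_of_test d1 d2 (L2.integrable _)),
      integral_add (integrable_smul_of_test h1.continuous h2 (L2.integrable _))
      (integrable_smul_of_test h1.continuous h2 (L2.integrable _)), e1, e2]
    abel
  smul_mem' := by
    intro c p hp θ h1 h2 h3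
    have e1 := hp θ h1 h2 h3
    have a1 : ∫ z in Ioo (0 : ℝ) 1, deriv θ z • (c • p).fst z =
        ∫ z in Ioo (0 : ℝ) 1, c • (deriv θ z • p.fst z) := by
      refine integral_congr_ae ?_
      filter_upwards [Lp.coeFn_smul c p.fst] with z hz
      rw [WithLp.smul_fst, hz, Pi.smul_apply, smul_comm]
    have a2 : ∫ z in Ioo (0 : ℝ) 1, θ z • (c • p).snd z =
        ∫ z in Ioo (0 : ℝ) 1, c • (θ z • p.snd z) := by
      refine integral_congr_ae ?_
      filter_upwards [Lp.coeFn_smul c p.snd] with z hz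
      rw [WithLp.smul_snd, hz, Pi.smul_apply, smul_comm]
    rw [a1, a2, integral_smul, integral_smul, e1, smul_neg]

/-- The function of class `L²` underlying an element of `H¹`. -/
def H1.fn {n : ℕ} (φ : H1 n) : L2 n := (φ : WithLp 2 (L2 n × L2 n)).fst

/-- The weak derivative `φ_z` of an element of `H¹`. -/
def H1.dz {n : ℕ} (φ : H1 n) : L2 n := (φ : WithLp 2 (L2 n × L2 n)).snd

/-- Pointwise value `φ(z)`, `z ∈ [0,1]`, of an element of `H¹`: the value at `z` of its
continuous representative (see `H1.val_continuousOn` and `H1.val_ae_eq`). The formula is the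
primitive of `φ_z` that has the same mean as `φ`. -/
def H1.val {n : ℕ} (φ : H1 n) (z : ℝ) : Vec n :=
  (∫ s in (0 : ℝ)..1, (H1.fn φ s - ∫ r in (0 : ℝ)..s, H1.dz φ r)) +
    ∫ r in (0 : ℝ)..z, H1.dz φ r

theorem L2.intervalIntegrable {n : ℕ} (f : L2 n) :
    IntervalIntegrable (f : ℝ → Vec n) volume 0 1 := by
  rw [intervalIntegrable_iff_integrableOn_Ioo_of_le zero_le_one]
  exact L2.integrable f

theorem H1.val_continuousOn {n : ℕ} (φ : H1 n) : ContinuousOn (H1.val φ) (Icc 0 1) := by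
  have h := intervalIntegral.continuousOn_primitive_interval' (a := (0 : ℝ))
    (L2.intervalIntegrable (H1.dz φ)) (by simp)
  rw [uIcc_of_le zero_le_one] at h
  exact continuousOn_const.add h

/-- A scalar function with zero weak derivative on `(0,1)` is a.e. equal to its mean. -/
theorem ae_eq_mean_of_weakDeriv_zero {w : ℝ → ℝ} (hw : IntervalIntegrable w volume 0 1)
    (h : ∀ θ : ℝ → ℝ, ContDiff ℝ ∞ θ → HasCompactSupport θ → tsupport θ ⊆ Ioo 0 1 →
      ∫ z in (0 : ℝ)..1, deriv θ z * w z = 0) :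
    ∀ᵐ z ∂(volume.restrict (Ioo (0 : ℝ) 1)), w z = ∫ s in (0 : ℝ)..1, w s := by
  obtain ⟨ρ, hρs, hρc, hρd, hρ0, hρ1⟩ :=
    exists_contDiff_tsupport_subset (n := ⊤) (s := Ioo (0 : ℝ) 1) (x := 1 / 2)
      (Ioo_mem_nhds (by norm_num) (by norm_num))
  have hint : ∀ f : ℝ → ℝ, Continuous f → ∀ a b, IntervalIntegrable f volume a b :=
    fun f hf a b => hf.intervalIntegrable a b
  have hρpos : 0 < ∫ z in (0 : ℝ)..1, ρ z := by
    refine intervalIntegral.integral_pos zero_lt_one hρd.continuous.continuousOn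
      (fun x _ => (hρ0 ⟨x, rfl⟩).1) ⟨1 / 2, by norm_num, by rw [hρ1]; norm_num⟩
  set I := ∫ z in (0 : ℝ)..1, ρ z with hI
  set c := I⁻¹ * ∫ z in (0 : ℝ)..1, ρ z * w z with hc
  have key : ∀ᵐ z ∂(volume : Measure ℝ), z ∈ Ioo (0 : ℝ) 1 → w z - c = 0 := by
    refine isOpen_Ioo.ae_eq_zero_of_integral_contDiff_smul_eq_zero
      (f := fun z => w z - c) ?_ ?_
    · have : IntegrableOn w (Ioo 0 1) volume :=
        (intervalIntegrable_iff_integrableOn_Ioo_of_le zero_le_one).1 hw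
      exact (this.sub (integrableOn_const (by simp))).locallyIntegrableOn
    · intro θ h1 h2 h3
      set m := I⁻¹ * ∫ z in (0 : ℝ)..1, θ z with hm
      set τ : ℝ → ℝ := fun z => θ z - m * ρ z with hτ
      have hτd : ContDiff ℝ ∞ τ := h1.sub (contDiff_const.mul hρd)
      have hτc : HasCompactSupport τ := h2.sub hρc.mul_left
      have hτs : tsupport τ ⊆ Ioo 0 1 := by
        refine (tsupport_sub θ _).trans (union_subset h3 ?_)
        exact (tsupport_mul_subset_right).trans hρs
      set ψ : ℝ → ℝ := fun z => ∫ s in (0 : ℝ)..z, τ s with hψ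
      have hψd : ∀ z, HasDerivAt ψ (τ z) z := fun z =>
        intervalIntegral.integral_hasDerivAt_right (hint _ hτd.continuous _ _)
          hτd.continuous.stronglyMeasurable.stronglyMeasurableAtFilter hτd.continuous.continuousAt
      have hderiv : deriv ψ = τ := funext fun z => (hψd z).deriv
      have hψsm : ContDiff ℝ ∞ ψ := by
        rw [contDiff_infty_iff_deriv, hderiv]
        exact ⟨fun z => (hψd z).differentiableAt, hτd⟩
      have hτ01 : ∫ s in (0 : ℝ)..1, τ s = 0 := by
        have hρm : Continuous fun z => m * ρ z := continuous_const.mul hρd.continuous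
        simp only [hτ]
        rw [intervalIntegral.integral_sub (hint _ h1.continuous _ _) (hint _ hρm _ _),
          intervalIntegral.integral_const_mul, ← hI, hm]
        field_simp
        simp
      -- a compact interval that carries the support of `τ`
      obtain ⟨a, b, ha, hb, hab⟩ : ∃ a b : ℝ, 0 < a ∧ b < 1 ∧ tsupport τ ⊆ Icc a b := by
        rcases (tsupport τ).eq_empty_or_nonempty with he | hne
        · exact ⟨1 / 2, 1 / 2, by norm_num, by norm_num, by simp [he]⟩
        · have hk : IsCompact (tsupport τ) := hτc
          obtain ⟨a, haK, ha⟩ := hk.exists_isLeast hne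
          obtain ⟨b, hbK, hb⟩ := hk.exists_isGreatest hne
          exact ⟨a, b, (hτs haK).1, (hτs hbK).2, fun x hx => ⟨ha hx, hb hx⟩⟩
      have hz : ∀ x, x ∉ Icc a b → τ x = 0 := fun x hx =>
        image_eq_zero_of_notMem_tsupport fun h' => hx (hab h')
      have hψa : ∀ x, x < a → ψ x = 0 := by
        intro x hx
        refine intervalIntegral.integral_zero_ae (Eventually.of_forall fun s hs => hz s ?_)
        rintro ⟨h5, -⟩
        have := hs.2
        rcases le_total (0 : ℝ) x with h0 | h0
        · rw [max_eq_right h0] at this; linarith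
        · rw [max_eq_left h0] at this; linarith
      have hψb : ∀ x, b < x → ψ x = 0 := by
        intro x hx
        have e : ψ x = ψ 1 + ∫ s in (1 : ℝ)..x, τ s :=
          (intervalIntegral.integral_add_adjacent_intervals (hint _ hτd.continuous _ _)
            (hint _ hτd.continuous _ _)).symm
        rw [e, show ψ 1 = 0 from hτ01, zero_add]
        refine intervalIntegral.integral_zero_ae (Eventually.of_forall fun s hs => hz s ?_)
        rintro ⟨-, h5⟩
        have := hs.1
        rcases le_total (1 : ℝ) x with h0 | h0
        · rw [min_eq_left h0] at this; linarith
        · rw [min_eq_right h0] at this; linarith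
      have hψt : tsupport ψ ⊆ Icc a b := by
        refine closure_minimal (fun x hx => ?_) isClosed_Icc
        by_contra hn
        apply hx
        rcases not_and_or.1 hn with h5 | h5
        · exact hψa x (not_le.1 h5)
        · exact hψb x (not_le.1 h5)
      have hψc : HasCompactSupport ψ := isCompact_Icc.of_isClosed_subset (isClosed_tsupport _) hψt
      have h0 := h ψ hψsm hψc (hψt.trans fun x hx => ⟨lt_of_lt_of_le ha hx.1,
        lt_of_le_of_lt hx.2 hb⟩)
      rw [hderiv] at h0
      have hθw : IntervalIntegrable (fun z => θ z * w z) volume 0 1 :=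
        hw.continuousOn_mul h1.continuous.continuousOn
      have hρw : IntervalIntegrable (fun z => ρ z * w z) volume 0 1 :=
        hw.continuousOn_mul hρd.continuous.continuousOn
      have e1 : ∫ z in (0 : ℝ)..1, τ z * w z =
          (∫ z in (0 : ℝ)..1, θ z * w z) - m * ∫ z in (0 : ℝ)..1, ρ z * w z := by
        rw [← intervalIntegral.integral_const_mul, ← intervalIntegral.integral_sub hθw
          (hρw.const_mul m)]
        congr 1; funext z; simp only [hτ]; ring
      have e2 : ∫ z, θ z • (w z - c) = ∫ z in (0 : ℝ)..1, (θ z * w z - c * θ z) := by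
        rw [intervalIntegral.integral_of_le zero_le_one, integral_Ioc_eq_integral_Ioo,
          ← setIntegral_eq_integral_of_forall_compl_eq_zero (s := Ioo (0 : ℝ) 1)]
        · congr 1; funext z; simp only [smul_eq_mul]; ring
        · intro x hx
          rw [image_eq_zero_of_notMem_tsupport fun h' => hx (h3 h'), zero_smul]
      have hcθ : Continuous fun z => c * θ z := continuous_const.mul h1.continuous
      rw [e2, intervalIntegral.integral_sub hθw (hint _ hcθ _ _),
        intervalIntegral.integral_const_mul]
      rw [e1] at h0
      rw [hc]
      rw [hm] at h0
      linear_combination h0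
  have key' : ∀ᵐ z ∂(volume.restrict (Ioo (0 : ℝ) 1)), w z = c := by
    rw [ae_restrict_iff' measurableSet_Ioo]
    filter_upwards [key] with z hz h5
    linarith [hz h5]
  have hmean : ∫ s in (0 : ℝ)..1, w s = c := by
    rw [intervalIntegral.integral_of_le zero_le_one, integral_Ioc_eq_integral_Ioo,
      integral_congr_ae key']
    simp
  rw [hmean]
  exact key'

/-- `H1.val φ` is a representative of `φ`. -/
theorem H1.val_ae_eq {n : ℕ} (φ : H1 n) :
    ∀ᵐ z ∂(volume.restrict (Ioo (0 : ℝ) 1)), H1.fn φ z = H1.val φ z := by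
  have hu := L2.intervalIntegrable (H1.fn φ)
  have hv := L2.intervalIntegrable (H1.dz φ)
  have hF : IntervalIntegrable (fun s => ∫ r in (0 : ℝ)..s, H1.dz φ r) volume 0 1 :=
    (intervalIntegral.continuousOn_primitive_interval' hv (by simp)).intervalIntegrable
  have hvi : ∀ i, IntervalIntegrable (fun z => H1.dz φ z i) volume 0 1 := fun i =>
    ⟨(EuclideanSpace.proj i : Vec n →L[ℝ] ℝ).integrable_comp hv.1,
      (EuclideanSpace.proj i : Vec n →L[ℝ] ℝ).integrable_comp hv.2⟩
  have hui : ∀ i, IntervalIntegrable (fun z => H1.fn φ z i) volume 0 1 := fun i =>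
    ⟨(EuclideanSpace.proj i : Vec n →L[ℝ] ℝ).integrable_comp hu.1,
      (EuclideanSpace.proj i : Vec n →L[ℝ] ℝ).integrable_comp hu.2⟩
  have hFi : ∀ i, ∀ z ∈ Icc (0 : ℝ) 1, (∫ r in (0 : ℝ)..z, H1.dz φ r) i =
      ∫ r in (0 : ℝ)..z, H1.dz φ r i := fun i z hz =>
    ((EuclideanSpace.proj i : Vec n →L[ℝ] ℝ).intervalIntegral_comp_comm
      (hv.mono_set (by rw [uIcc_of_le hz.1, uIcc_of_le zero_le_one]
                       exact Icc_subset_Icc le_rfl hz.2))).symm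
  have main : ∀ i, ∀ᵐ z ∂(volume.restrict (Ioo (0 : ℝ) 1)),
      H1.fn φ z i - (∫ r in (0 : ℝ)..z, H1.dz φ r i) =
        ∫ s in (0 : ℝ)..1, (H1.fn φ s i - ∫ r in (0 : ℝ)..s, H1.dz φ r i) := by
    intro i
    have hac := (hvi i).absolutelyContinuousOnInterval_intervalIntegral (c := 0) (by simp)
    have hGi : IntervalIntegrable (fun s => ∫ r in (0 : ℝ)..s, H1.dz φ r i) volume 0 1 :=
      hac.continuousOn.intervalIntegrable
    refine ae_eq_mean_of_weakDeriv_zero ((hui i).sub hGi) ?_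
    intro θ h1 h2 h3
    have hd : Continuous (deriv θ) := h1.continuous_deriv (by simp)
    have hθac : AbsolutelyContinuousOnInterval θ 0 1 :=
      ((h1.of_le (by simp)).contDiffOn).absolutelyContinuousOnInterval
    have hθ0 : θ 0 = 0 := image_eq_zero_of_notMem_tsupport fun h' => by simpa using h3 h'
    have hθ1 : θ 1 = 0 := image_eq_zero_of_notMem_tsupport fun h' => by simpa using h3 h'
    have ibp := hac.integral_mul_deriv_eq_deriv_mul hθac
    have ed : ∫ x in (0 : ℝ)..1, deriv (fun x => ∫ r in (0 : ℝ)..x, H1.dz φ r i) x * θ x =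
        ∫ x in (0 : ℝ)..1, θ x * H1.dz φ x i := by
      refine intervalIntegral.integral_congr_ae ?_
      filter_upwards [(hvi i).ae_hasDerivAt_integral] with x hx hx'
      rw [(hx (uIoc_subset_uIcc hx') 0 (by simp)).deriv, mul_comm]
    rw [ed, hθ0, hθ1] at ibp
    have wd := φ.2 θ h1 h2 h3
    have w1 := (EuclideanSpace.proj i : Vec n →L[ℝ] ℝ).integral_comp_comm
      (integrable_smul_of_test hd h2.deriv (L2.integrable (H1.fn φ)))
    have w2 := (EuclideanSpace.proj i : Vec n →L[ℝ] ℝ).integral_comp_comm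
      (integrable_smul_of_test h1.continuous h2 (L2.integrable (H1.dz φ)))
    have wd' : ∫ z in Ioo (0 : ℝ) 1, deriv θ z * H1.fn φ z i =
        -∫ z in Ioo (0 : ℝ) 1, θ z * H1.dz φ z i := by
      have := congrArg (EuclideanSpace.proj i : Vec n →L[ℝ] ℝ) wd
      rw [map_neg] at this
      exact w1.trans (this.trans (congrArg Neg.neg w2.symm))
    rw [← integral_Ioc_eq_integral_Ioo, ← integral_Ioc_eq_integral_Ioo,
      ← intervalIntegral.integral_of_le zero_le_one,
      ← intervalIntegral.integral_of_le zero_le_one] at wd'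
    have hs : ∫ z in (0 : ℝ)..1, deriv θ z * (H1.fn φ z i - ∫ r in (0 : ℝ)..z, H1.dz φ r i) =
        (∫ z in (0 : ℝ)..1, deriv θ z * H1.fn φ z i) -
          ∫ z in (0 : ℝ)..1, (∫ r in (0 : ℝ)..z, H1.dz φ r i) * deriv θ z := by
      rw [← intervalIntegral.integral_sub ((hui i).continuousOn_mul hd.continuousOn)
        (hGi.mul_continuousOn hd.continuousOn)]
      congr 1; funext z; ring
    rw [hs, wd', ibp]
    ring
  have hall : ∀ᵐ z ∂(volume.restrict (Ioo (0 : ℝ) 1)), ∀ i,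
      H1.fn φ z i - (∫ r in (0 : ℝ)..z, H1.dz φ r i) =
        ∫ s in (0 : ℝ)..1, (H1.fn φ s i - ∫ r in (0 : ℝ)..s, H1.dz φ r i) :=
    ae_all_iff.2 main
  filter_upwards [hall, ae_restrict_mem measurableSet_Ioo] with z hz hz01
  ext i
  have e := (EuclideanSpace.proj i : Vec n →L[ℝ] ℝ).intervalIntegral_comp_comm (hu.sub hF)
  have e' : (∫ s in (0 : ℝ)..1, (H1.fn φ s - ∫ r in (0 : ℝ)..s, H1.dz φ r)) i =
      ∫ s in (0 : ℝ)..1, (H1.fn φ s i - ∫ r in (0 : ℝ)..s, H1.dz φ r i) := by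
    refine e.symm.trans (intervalIntegral.integral_congr fun s hs => ?_)
    rw [uIcc_of_le zero_le_one] at hs
    simp only [PiLp.proj_apply, PiLp.sub_apply]
    rw [hFi i s hs]
  simp only [H1.val, PiLp.add_apply]
  rw [e', hFi i z ⟨hz01.1.le, hz01.2.le⟩, ← hz i]
  ring

/-- The space `H¹((0,1);ℝⁿ) × ℝⁿ`. -/
abbrev Z (n : ℕ) : Type := H1 n × Vec n

/-- The Hilbert space `L²((0,1);ℝⁿ) × ℝⁿ`. -/
abbrev J (n : ℕ) : Type := WithLp 2 (L2 n × Vec n)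

/-- The inclusion of `H¹ × ℝⁿ` in `L² × ℝⁿ`. -/
def incl {n : ℕ} (w : Z n) : J n := WithLp.toLp 2 (H1.fn w.1, w.2)

section operators

variable {n m : ℕ}

/-- `dom(𝒜)`: the `(φ, η) ∈ H¹ × ℝⁿ` with `φ(0) = H φ(1) + B K η`. -/
def domA (H : Matrix (Fin n) (Fin n) ℝ) (B : Matrix (Fin n) (Fin m) ℝ)
    (K : Matrix (Fin m) (Fin n) ℝ) : Set (Z n) :=
  {w | H1.val w.1 0 = matOp H (H1.val w.1 1) + matOp (B * K) w.2}

/-- The formula of `𝒜`: `(φ, η) ↦ (-Λ φ_z, R η)`. -/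
def opA (Λ R : Matrix (Fin n) (Fin n) ℝ) (w : Z n) : J n :=
  WithLp.toLp 2 (-((matOp Λ).compLp (H1.dz w.1)), matOp R w.2)

/-- The operator `ℬ` on `H¹ × ℝⁿ`: `(φ, η) ↦ (0, S φ(1))`. -/
def opB (S : Matrix (Fin n) (Fin n) ℝ) (w : Z n) : Z n :=
  (0, matOp S (H1.val w.1 1))

/-- The graph, in `L² × ℝⁿ`, of `𝒜 + ℬ` with domain `dom(𝒜)`. -/
def graphAB (Λ H : Matrix (Fin n) (Fin n) ℝ) (B : Matrix (Fin n) (Fin m) ℝ)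
    (R S : Matrix (Fin n) (Fin n) ℝ) (K : Matrix (Fin m) (Fin n) ℝ) : Set (J n × J n) :=
  {p | ∃ w ∈ domA H B K, p = (incl w, opA Λ R w + incl (opB S w))}

end operators

section semigroups

variable {X : Type*} [NormedAddCommGroup X] [NormedSpace ℝ X]

/-- `(𝒯 t)_{t ≥ 0}` is a `C₀`-semigroup of bounded operators (`𝒯 t` is irrelevant for `t < 0`). -/
structure IsC0Semigroup (𝒯 : ℝ → X →L[ℝ] X) : Prop where
  zero : 𝒯 0 = ContinuousLinearMap.id ℝ X
  add : ∀ s t : ℝ, 0 ≤ s → 0 ≤ t → 𝒯 (s + t) = (𝒯 s).comp (𝒯 t)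
  tendsto : ∀ x : X, Tendsto (fun t => 𝒯 t x) (𝓝[>] 0) (𝓝 x)

/-- The operator with graph `G` is the infinitesimal generator of `𝒯`: `(x, y) ∈ G` exactly when
`(𝒯 t x - x) / t → y` as `t ↓ 0`. -/
def IsGenerator (𝒯 : ℝ → X →L[ℝ] X) (G : Set (X × X)) : Prop :=
  ∀ x y : X, (x, y) ∈ G ↔ Tendsto (fun t : ℝ => t⁻¹ • (𝒯 t x - x)) (𝓝[>] 0) (𝓝 y)

end semigroups

section solutions

variable {n : ℕ}

/-- The input `(0, S d(t))`. -/
def inputOf (S : Matrix (Fin n) (Fin n) ℝ) (d : ℝ → Vec n) (t : ℝ) : J n :=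
  WithLp.toLp 2 (0, matOp S (d t))

/-- `h(t) = -∫_t^T 𝒯(s-t)^* g(s) ds`. -/
def dualTest (𝒯 : ℝ → J n →L[ℝ] J n) (T : ℝ) (g : ℝ → Z n) (t : ℝ) : J n :=
  -∫ s in t..T, ContinuousLinearMap.adjoint (𝒯 (s - t)) (incl (g s))

/-- `x` is a weak solution on `[0,T]` of `ẋ = G x + (0, S d)`, `x(0) = x⁰`, where `𝒯` is the
semigroup generated by `G`. Only the values of `x` on `[0,T]` matter. -/
structure IsWeakSolution (𝒯 : ℝ → J n →L[ℝ] J n) (S : Matrix (Fin n) (Fin n) ℝ)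
    (T : ℝ) (d : ℝ → Vec n) (x0 : Z n) (x : ℝ → Z n) : Prop where
  continuousOn : ContinuousOn x (Icc 0 T)
  weak : ∀ g : ℝ → Z n, ContinuousOn g (Icc 0 T) →
    (∫ s in (0 : ℝ)..T, ⟪incl (x s), incl (g s)⟫_ℝ) +
      (∫ s in (0 : ℝ)..T, ⟪inputOf S d s, dualTest 𝒯 T g s⟫_ℝ) +
      ⟪incl x0, dualTest 𝒯 T g 0⟫_ℝ = 0

end solutions

end HypLoop

end

open HypLoop

/-! The homogeneous equation is solved explicitly along characteristics, and the semigroup is read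
off from these solutions; no resolvent is computed.

Existence (`exists_isSol_step`, `exists_isSol`). Each component is transported to the right with
speed Λ_ii. On a time step short enough that nothing entering at z = 0 reaches z = 1, the trace
X(1,t) depends only on the initial state. Then η solves a linear ODE with known forcing, the inflow
H X(1,t) + B K η(t) is known, and X is a translated profile: the initial function on z ≥ 0, the
inflow data on z < 0. The condition defining dom(𝒜) is exactly what makes the profile continuous at
0, so X remains in H¹; continuity in time with values in H¹ is continuity of translations in L². The
step length depends only on Λ, so steps can be concatenated up to any T. An L² input d causes no
difficulty, since it enters only the ODE.

A priori bound (`inner_energyL_genL_le`, `exists_norm_sol_le`). In the energy ∫ (1 + ν z) φ·Λ⁻¹φ +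
|η|², integration by parts leaves -(1 + ν)|φ(1)|² at the outflow end. For large ν this absorbs the
inflow term and the coupling S φ(1), and Grönwall's inequality applies. Solutions are therefore
unique, and bounded in L² × ℝⁿ by their initial values.

Generation (`exists_semigroup`, `exists_isC0Semigroup_isGenerator`). Since dom(𝒜) is dense, the
solution operators extend to a C₀-semigroup. Its generator contains 𝒜 + ℬ because solutions are
differentiable at 0. Conversely, (∫₀ᵗ 𝒯(s)v ds, 𝒯(t)v - v) lies in the graph for v in the domain,
hence for all v because the graph is closed (`isClosed_graphAB`); dividing by t and letting t ↓ 0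
shows that the generator is no larger.

Weak solutions. For any semigroup with this generator, a solution with bounded input satisfies the
variation of constants formula (`IsSol.inner_eq`): s ↦ ⟨𝒯(t-s)x(s), v⟩ is Lipschitz, and in its
derivative the generator terms cancel. Testing with g, integrating and exchanging the order of
integration gives the weak identity (`IsC0Semigroup.weak_of_mild`); strong continuity of the adjoint
semigroup makes the integrands continuous. Uniqueness (`IsWeakSolution.eqOn`) is immediate, because
the difference of two weak solutions is itself an admissible g. -/

noncomputable section

namespace HypLoop

/-! ### Primitives of L² functions and the structure of H¹ -/

section

variable {n : ℕ}

/-- The primitive `∫₀ᶻ u` of a function of class `L²`, as a bounded operator in `u`. -/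
def prim (n : ℕ) (z : ℝ) : L2 n →L[ℝ] Vec n :=
  LinearMap.mkContinuous
    { toFun := fun u => ∫ r in Iic z, u r ∂(volume.restrict (Ioo (0 : ℝ) 1))
      map_add' := fun u v => by
        rw [← integral_add (L2.integrable u).integrableOn (L2.integrable v).integrableOn]
        refine integral_congr_ae (ae_restrict_of_ae ?_)
        filter_upwards [Lp.coeFn_add u v] with r hr
        rw [hr, Pi.add_apply]
      map_smul' := fun c u => by
        rw [RingHom.id_apply, ← integral_smul]
        refine integral_congr_ae (ae_restrict_of_ae ?_)
        filter_upwards [Lp.coeFn_smul c u] with r hr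
        rw [hr, Pi.smul_apply] } 1 (fun u => by
    -- Cauchy–Schwarz by duality: pairing `u` with the function equal to `w` on `Iic z` gives ‖w‖²,
    -- and that function has norm at most ‖w‖ because (0,1) has mass 1.
    set w := ∫ r in Iic z, u r ∂(volume.restrict (Ioo (0 : ℝ) 1)) with hw
    have hs : (volume.restrict (Ioo (0 : ℝ) 1)) (Iic z) ≠ (⊤ : ℝ≥0∞) := measure_ne_top _ _
    have h1 := L2.inner_indicatorConstLp_eq_inner_setIntegral (𝕜 := ℝ) (E := Vec n)
      (measurableSet_Iic (a := z)) hs w u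
    have h2 : ‖indicatorConstLp 2 (measurableSet_Iic (a := z)) hs w‖ ≤ ‖w‖ := by
      rw [norm_indicatorConstLp (by norm_num) (by norm_num)]
      refine mul_le_of_le_one_right (norm_nonneg _) (Real.rpow_le_one measureReal_nonneg ?_ (by norm_num))
      refine (measureReal_mono (subset_univ _)).trans ?_
      simp
    have h3 := real_inner_le_norm (indicatorConstLp 2 (measurableSet_Iic (a := z)) hs w) u
    rw [h1, ← hw, real_inner_self_eq_norm_sq] at h3
    have h4 : ‖w‖ ^ 2 ≤ ‖w‖ * ‖u‖ := h3.trans (by gcongr)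
    rw [one_mul]
    change ‖w‖ ≤ ‖u‖
    rcases (norm_nonneg w).eq_or_lt with h5 | h5
    · rw [← h5]; positivity
    · nlinarith)

theorem prim_eq_setIntegral (z : ℝ) (u : L2 n) :
    prim n z u = ∫ r in Iic z, u r ∂(volume.restrict (Ioo (0 : ℝ) 1)) := rfl

theorem norm_prim_apply_le (z : ℝ) (u : L2 n) : ‖prim n z u‖ ≤ ‖u‖ := by
  simpa using LinearMap.mkContinuous_norm_le _ zero_le_one _ |> (prim n z).le_of_opNorm_le <| u

theorem prim_apply {z : ℝ} (hz : z ∈ Icc (0 : ℝ) 1) (u : L2 n) :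
    prim n z u = ∫ r in (0 : ℝ)..z, u r := by
  rw [prim_eq_setIntegral, Measure.restrict_restrict measurableSet_Iic,
    intervalIntegral.integral_of_le hz.1]
  refine setIntegral_congr_set ?_
  have h : (Ioc (0 : ℝ) z : Set ℝ) =ᵐ[volume] (Iic z ∩ Ioc 0 1 : Set ℝ) := by
    refine Eventually.of_forall fun x => propext ?_
    change x ∈ Ioc 0 z ↔ x ∈ Iic z ∩ Ioc 0 1
    simp only [mem_Ioc, mem_inter_iff, mem_Iic]
    constructor
    · rintro ⟨a, b⟩; exact ⟨b, a, b.trans hz.2⟩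
    · rintro ⟨a, b, c⟩; exact ⟨b, a⟩
  exact ((ae_eq_refl _).inter Ioo_ae_eq_Ioc).trans h.symm

theorem prim_zero (u : L2 n) : prim n 0 u = 0 := by
  rw [prim_apply (by simp), intervalIntegral.integral_same]

theorem continuousOn_prim (u : L2 n) : ContinuousOn (fun z => prim n z u) (Icc 0 1) := by
  have h := intervalIntegral.continuousOn_primitive_interval' (a := (0 : ℝ))
    (L2.intervalIntegrable u) (by simp)
  rw [uIcc_of_le zero_le_one] at h
  exact h.congr fun z hz => prim_apply hz u

/-- By Lebesgue differentiation, `w` is almost everywhere the derivative of its primitive. This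
reduces identities in L² to pointwise identities between continuous functions. -/
theorem L2.ext_prim {u v : L2 n} (h : ∀ z ∈ Icc (0 : ℝ) 1, prim n z u = prim n z v) : u = v := by
  rw [← sub_eq_zero]
  set w := u - v with hw
  have h0 : ∀ z ∈ Icc (0 : ℝ) 1, ∫ r in (0 : ℝ)..z, w r = 0 := fun z hz => by
    rw [← prim_apply hz, hw, map_sub, h z hz, sub_self]
  refine (Lp.eq_zero_iff_ae_eq_zero).2 ?_
  filter_upwards [ae_restrict_of_ae (L2.intervalIntegrable w).ae_hasDerivAt_integral,
    ae_restrict_mem measurableSet_Ioo] with z hz hz01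
  have hz' : z ∈ uIcc (0 : ℝ) 1 := by rw [uIcc_of_le zero_le_one]; exact Ioo_subset_Icc_self hz01
  have h1 := hz hz' 0 (by simp)
  have h2 : HasDerivAt (fun x => ∫ r in (0 : ℝ)..x, w r) 0 z := by
    refine (hasDerivAt_const z (0 : Vec n)).congr_of_eventuallyEq ?_
    filter_upwards [Ioo_mem_nhds hz01.1 hz01.2] with x hx
    exact h0 x (Ioo_subset_Icc_self hx)
  exact h1.unique h2

theorem memLp_affine_prim (c : Vec n) (ψ : L2 n) :
    MemLp (fun z => c + prim n z ψ) 2 (volume.restrict (Ioo (0 : ℝ) 1)) := by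
  have hc : ContinuousOn (fun z => c + prim n z ψ) (Icc 0 1) :=
    continuousOn_const.add (continuousOn_prim ψ)
  refine MemLp.of_bound ((hc.mono Ioo_subset_Icc_self).aestronglyMeasurable measurableSet_Ioo)
    (‖c‖ + ‖ψ‖) (Eventually.of_forall fun z => (norm_add_le _ _).trans ?_)
  gcongr
  exact norm_prim_apply_le z ψ

theorem intervalIntegrable_apply {u : ℝ → Vec n} {a b : ℝ} (hu : IntervalIntegrable u volume a b)
    (i : Fin n) : IntervalIntegrable (fun z => u z i) volume a b :=
  ⟨(EuclideanSpace.proj i : Vec n →L[ℝ] ℝ).integrable_comp hu.1,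
    (EuclideanSpace.proj i : Vec n →L[ℝ] ℝ).integrable_comp hu.2⟩

theorem intervalIntegral_apply {u : ℝ → Vec n} {a b : ℝ} (hu : IntervalIntegrable u volume a b)
    (i : Fin n) : (∫ z in a..b, u z) i = ∫ z in a..b, u z i :=
  ((EuclideanSpace.proj i : Vec n →L[ℝ] ℝ).intervalIntegral_comp_comm hu).symm

theorem L2.intervalIntegrable_left (u : L2 n) {z : ℝ} (hz : z ∈ Icc (0 : ℝ) 1) :
    IntervalIntegrable u volume 0 z :=
  (L2.intervalIntegrable u).mono_set (by
    rw [uIcc_of_le hz.1, uIcc_of_le zero_le_one]; exact Icc_subset_Icc le_rfl hz.2)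

theorem prim_apply_apply {z : ℝ} (hz : z ∈ Icc (0 : ℝ) 1) (u : L2 n) (i : Fin n) :
    prim n z u i = ∫ r in (0 : ℝ)..z, u r i := by
  rw [prim_apply hz, intervalIntegral_apply (L2.intervalIntegrable_left u hz)]

/-- Componentwise integration by parts for absolutely continuous functions. The boundary terms
vanish because θ(0) = θ(1) = 0, and for the same reason the constant contributes nothing. -/
theorem isWeakDeriv_affine_prim (c : Vec n) (ψ : L2 n) :
    IsWeakDeriv (fun z => c + prim n z ψ) ψ := by
  intro θ h1 h2 h3
  have hd : Continuous (deriv θ) := h1.continuous_deriv (by simp)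
  have hL : Integrable (fun z => c + prim n z ψ) (volume.restrict (Ioo (0 : ℝ) 1)) :=
    (memLp_affine_prim c ψ).integrable (by norm_num)
  have hθac : AbsolutelyContinuousOnInterval θ 0 1 :=
    ((h1.of_le (by simp)).contDiffOn).absolutelyContinuousOnInterval
  have hθ0 : θ 0 = 0 := image_eq_zero_of_notMem_tsupport fun h' => by simpa using h3 h'
  have hθ1 : θ 1 = 0 := image_eq_zero_of_notMem_tsupport fun h' => by simpa using h3 h'
  ext i
  have w1 := (EuclideanSpace.proj i : Vec n →L[ℝ] ℝ).integral_comp_comm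
    (integrable_smul_of_test hd h2.deriv hL)
  have w2 := (EuclideanSpace.proj i : Vec n →L[ℝ] ℝ).integral_comp_comm
    (integrable_smul_of_test h1.continuous h2 (L2.integrable ψ))
  simp only [PiLp.proj_apply, PiLp.smul_apply, PiLp.add_apply, smul_eq_mul] at w1 w2
  rw [PiLp.neg_apply, ← w1, ← w2]
  have hvi := intervalIntegrable_apply (L2.intervalIntegrable ψ) i
  have hac := hvi.absolutelyContinuousOnInterval_intervalIntegral (c := 0) (by simp)
  have hint : ∫ z in (0 : ℝ)..1, deriv θ z = 0 := by
    rw [hθac.integral_deriv_eq_sub, hθ0, hθ1, sub_zero]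
  have ibp := hac.integral_mul_deriv_eq_deriv_mul hθac
  have ed : ∫ x in (0 : ℝ)..1, deriv (fun x => ∫ r in (0 : ℝ)..x, ψ r i) x * θ x =
      ∫ x in (0 : ℝ)..1, θ x * ψ x i := by
    refine intervalIntegral.integral_congr_ae ?_
    filter_upwards [hvi.ae_hasDerivAt_integral] with x hx hx'
    rw [(hx (uIoc_subset_uIcc hx') 0 (by simp)).deriv, mul_comm]
  rw [ed, hθ0, hθ1] at ibp
  rw [← integral_Ioc_eq_integral_Ioo, ← integral_Ioc_eq_integral_Ioo,
    ← intervalIntegral.integral_of_le zero_le_one, ← intervalIntegral.integral_of_le zero_le_one]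
  have e3 : ∫ z in (0 : ℝ)..1, deriv θ z * (c i + prim n z ψ i) =
      ∫ z in (0 : ℝ)..1, (deriv θ z * c i + (∫ r in (0 : ℝ)..z, ψ r i) * deriv θ z) := by
    refine intervalIntegral.integral_congr fun z hz => ?_
    rw [uIcc_of_le zero_le_one] at hz
    simp only [prim_apply_apply hz]
    ring
  have i1 : IntervalIntegrable (fun z => deriv θ z * c i) volume 0 1 :=
    (hd.mul continuous_const).intervalIntegrable 0 1
  have i2 : IntervalIntegrable (fun z => (∫ r in (0 : ℝ)..z, ψ r i) * deriv θ z) volume 0 1 :=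
    (hac.continuousOn.mul hd.continuousOn).intervalIntegrable
  rw [e3, intervalIntegral.integral_add i1 i2,
    intervalIntegral.integral_mul_const, hint, ibp]
  ring

theorem IsWeakDeriv.congr {φ φ' ψ ψ' : ℝ → Vec n} (h : IsWeakDeriv φ ψ)
    (h1 : φ =ᵐ[volume.restrict (Ioo (0 : ℝ) 1)] φ') (h2 : ψ =ᵐ[volume.restrict (Ioo (0 : ℝ) 1)] ψ') :
    IsWeakDeriv φ' ψ' := by
  intro θ a b c
  have e1 : ∫ z in Ioo (0 : ℝ) 1, deriv θ z • φ z = ∫ z in Ioo (0 : ℝ) 1, deriv θ z • φ' z :=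
    integral_congr_ae (h1.mono fun z hz => by simp only [hz])
  have e2 : ∫ z in Ioo (0 : ℝ) 1, θ z • ψ z = ∫ z in Ioo (0 : ℝ) 1, θ z • ψ' z :=
    integral_congr_ae (h2.mono fun z hz => by simp only [hz])
  rw [← e1, h θ a b c, e2]

/-- The element `z ↦ c + ∫₀ᶻ ψ` of `H¹`. -/
def H1.mk (c : Vec n) (ψ : L2 n) : H1 n :=
  ⟨WithLp.toLp 2 ((memLp_affine_prim c ψ).toLp _, ψ),
    (isWeakDeriv_affine_prim c ψ).congr (MemLp.coeFn_toLp (memLp_affine_prim c ψ)).symm (ae_eq_refl _)⟩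

theorem H1.dz_mk (c : Vec n) (ψ : L2 n) : H1.dz (H1.mk c ψ) = ψ := rfl

theorem H1.fn_mk_ae (c : Vec n) (ψ : L2 n) :
    H1.fn (H1.mk c ψ) =ᵐ[volume.restrict (Ioo (0 : ℝ) 1)] fun z => c + prim n z ψ :=
  MemLp.coeFn_toLp (memLp_affine_prim c ψ)

theorem H1.val_eq {φ : H1 n} {z : ℝ} (hz : z ∈ Icc (0 : ℝ) 1) :
    H1.val φ z = prim n 1 (H1.fn φ) - (∫ s in (0 : ℝ)..1, prim n s (H1.dz φ)) +
      prim n z (H1.dz φ) := by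
  rw [H1.val, prim_apply hz, prim_apply (z := 1) (by simp),
    intervalIntegral.integral_sub (L2.intervalIntegrable _)]
  · congr 2
    refine intervalIntegral.integral_congr fun s hs => ?_
    rw [uIcc_of_le zero_le_one] at hs
    exact (prim_apply hs _).symm
  · exact (intervalIntegral.continuousOn_primitive_interval'
      (L2.intervalIntegrable (H1.dz φ)) (by simp)).intervalIntegrable

theorem intervalIntegrable_prim (ψ : L2 n) :
    IntervalIntegrable (fun s => prim n s ψ) volume 0 1 :=
  ContinuousOn.intervalIntegrable_of_Icc zero_le_one (continuousOn_prim ψ)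

theorem H1.val_mk (c : Vec n) (ψ : L2 n) {z : ℝ} (hz : z ∈ Icc (0 : ℝ) 1) :
    H1.val (H1.mk c ψ) z = c + prim n z ψ := by
  have h : prim n 1 (H1.fn (H1.mk c ψ)) = c + ∫ s in (0 : ℝ)..1, prim n s ψ := by
    rw [prim_apply (by simp), intervalIntegral.integral_of_le zero_le_one,
      integral_Ioc_eq_integral_Ioo, integral_congr_ae (H1.fn_mk_ae c ψ),
      ← integral_Ioc_eq_integral_Ioo, ← intervalIntegral.integral_of_le zero_le_one,
      intervalIntegral.integral_add (by simp) (intervalIntegrable_prim ψ)]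
    simp
  rw [H1.val_eq hz, h, H1.dz_mk, add_sub_cancel_right]

theorem H1.ext {φ φ' : H1 n} (h1 : H1.fn φ = H1.fn φ') (h2 : H1.dz φ = H1.dz φ') : φ = φ' :=
  Subtype.ext (by
    have : (φ : WithLp 2 (L2 n × L2 n)).ofLp = (φ' : WithLp 2 (L2 n × L2 n)).ofLp := Prod.ext h1 h2
    exact WithLp.ofLp_injective _ this)

theorem H1.val_eq_val_zero_add (φ : H1 n) {z : ℝ} (hz : z ∈ Icc (0 : ℝ) 1) :
    H1.val φ z = H1.val φ 0 + prim n z (H1.dz φ) := by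
  rw [H1.val_eq hz, H1.val_eq (z := 0) (by simp), prim_zero, add_zero]

/-- An element of H¹ is determined by its value at 0 and its derivative. Together with `H1.val_mk`
and `H1.dz_mk` this gives the coordinates ℝⁿ × L² on H¹ in which everything below is constructed. -/
theorem H1.mk_val_dz (φ : H1 n) : H1.mk (H1.val φ 0) (H1.dz φ) = φ := by
  refine H1.ext (Lp.ext ?_) rfl
  filter_upwards [H1.fn_mk_ae (H1.val φ 0) (H1.dz φ), H1.val_ae_eq φ,
    ae_restrict_mem measurableSet_Ioo] with z h1 h2 h3
  rw [h1, h2, H1.val_eq_val_zero_add φ (Ioo_subset_Icc_self h3)]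

/-- The inclusion of `H¹` in `L²`. -/
def H1.fnL (n : ℕ) : H1 n →L[ℝ] L2 n :=
  (WithLp.fstL 2 ℝ (L2 n) (L2 n)).comp (H1 n).subtypeL

/-- The derivative on `H¹`. -/
def H1.dzL (n : ℕ) : H1 n →L[ℝ] L2 n :=
  (WithLp.sndL 2 ℝ (L2 n) (L2 n)).comp (H1 n).subtypeL

theorem H1.norm_sq (φ : H1 n) : ‖φ‖ ^ 2 = ‖H1.fn φ‖ ^ 2 + ‖H1.dz φ‖ ^ 2 :=
  WithLp.prod_norm_sq_eq_of_L2 (φ : WithLp 2 (L2 n × L2 n))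

/-- The mean of the primitive of `ψ` that vanishes at `0`. -/
def primMean (n : ℕ) : L2 n →L[ℝ] Vec n :=
  LinearMap.mkContinuous
    { toFun := fun ψ => ∫ s in (0 : ℝ)..1, prim n s ψ
      map_add' := fun u v => by
        rw [← intervalIntegral.integral_add (intervalIntegrable_prim u) (intervalIntegrable_prim v)]
        simp only [map_add]
      map_smul' := fun c u => by
        rw [RingHom.id_apply, ← intervalIntegral.integral_smul]
        simp only [map_smul] } 1 (fun u => by
    have := intervalIntegral.norm_integral_le_of_norm_le_const (a := (0 : ℝ)) (b := 1)
      (f := fun s => prim n s u) (C := ‖u‖) fun s _ => norm_prim_apply_le s u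
    simpa using this)

/-- Evaluation at `z ∈ [0,1]` on `H¹`. -/
def H1.valL (n : ℕ) (z : ℝ) : H1 n →L[ℝ] Vec n :=
  (prim n 1).comp (H1.fnL n) - (primMean n).comp (H1.dzL n) + (prim n z).comp (H1.dzL n)

theorem H1.valL_apply {z : ℝ} (hz : z ∈ Icc (0 : ℝ) 1) (φ : H1 n) :
    H1.valL n z φ = H1.val φ z := (H1.val_eq hz).symm

theorem H1.valL_zero (φ : H1 n) : H1.valL n 0 φ = H1.val φ 0 := H1.valL_apply (by simp) φ
theorem H1.valL_one (φ : H1 n) : H1.valL n 1 φ = H1.val φ 1 := H1.valL_apply (by simp) φ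

/-- Both sides have the same derivative by definition, so only the values at 0 need to be compared.
-/
theorem H1.mk_add (c c' : Vec n) (ψ ψ' : L2 n) :
    H1.mk (c + c') (ψ + ψ') = H1.mk c ψ + H1.mk c' ψ' := by
  have h : H1.val (H1.mk c ψ + H1.mk c' ψ') 0 = c + c' := by
    rw [← H1.valL_zero, map_add, H1.valL_zero, H1.valL_zero, H1.val_mk c ψ (by simp),
      H1.val_mk c' ψ' (by simp), prim_zero, prim_zero, add_zero, add_zero]
  rw [← H1.mk_val_dz (H1.mk c ψ + H1.mk c' ψ'), h]
  rfl

theorem H1.mk_smul (a : ℝ) (c : Vec n) (ψ : L2 n) :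
    H1.mk (a • c) (a • ψ) = a • H1.mk c ψ := by
  have h : H1.val (a • H1.mk c ψ) 0 = a • c := by
    rw [← H1.valL_zero, map_smul, H1.valL_zero, H1.val_mk c ψ (by simp), prim_zero, add_zero]
  rw [← H1.mk_val_dz (a • H1.mk c ψ), h]
  rfl

theorem norm_le_of_ae_bound {u : L2 n} {C : ℝ} (hC : 0 ≤ C)
    (h : ∀ᵐ z ∂(volume.restrict (Ioo (0 : ℝ) 1)), ‖u z‖ ≤ C) : ‖u‖ ≤ C := by
  have := Lp.norm_le_of_ae_bound hC h
  simpa [measureUnivNNReal] using this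

/-- `(c, ψ) ↦ (z ↦ c + ∫₀ᶻ ψ)` as a bounded operator. -/
def H1.mkL (n : ℕ) : Vec n × L2 n →L[ℝ] H1 n :=
  LinearMap.mkContinuous
    { toFun := fun p => H1.mk p.1 p.2
      map_add' := fun p q => H1.mk_add _ _ _ _
      map_smul' := fun a p => H1.mk_smul _ _ _ } 3 (fun p => by
    have h1 : ‖H1.fn (H1.mk p.1 p.2)‖ ≤ ‖p.1‖ + ‖p.2‖ := by
      refine norm_le_of_ae_bound (by positivity) ?_
      filter_upwards [H1.fn_mk_ae p.1 p.2] with z hz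
      rw [hz]
      exact (norm_add_le _ _).trans (by gcongr; exact norm_prim_apply_le _ _)
    have h2 := H1.norm_sq (H1.mk p.1 p.2)
    rw [H1.dz_mk] at h2
    have h3 : ‖p.1‖ ≤ ‖p‖ := norm_fst_le p
    have h4 : ‖p.2‖ ≤ ‖p‖ := norm_snd_le p
    change ‖H1.mk p.1 p.2‖ ≤ 3 * ‖p‖
    refine le_of_sq_le_sq ?_ (by positivity)
    rw [h2]
    have h5 : ‖H1.fn (H1.mk p.1 p.2)‖ ^ 2 ≤ (2 * ‖p‖) ^ 2 := by
      gcongr; linarith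
    have h6 : ‖p.2‖ ^ 2 ≤ ‖p‖ ^ 2 := by gcongr
    nlinarith [sq_nonneg ‖p‖])

end

/-! ### The operator 𝒜 + ℬ: closed graph and dense domain -/

section

variable {n m : ℕ}

/-- Pairing as a bounded operator into `L² × ℝⁿ`. -/
def J.mkL (n : ℕ) : L2 n × Vec n →L[ℝ] J n :=
  (WithLp.prodContinuousLinearEquiv 2 ℝ (L2 n) (Vec n)).symm.toContinuousLinearMap

theorem J.ext {x y : J n} (h1 : x.fst = y.fst) (h2 : x.snd = y.snd) : x = y :=
  WithLp.ofLp_injective 2 (Prod.ext h1 h2)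

/-- The inclusion of `H¹ × ℝⁿ` in `L² × ℝⁿ` as a bounded operator. -/
def inclL (n : ℕ) : Z n →L[ℝ] J n :=
  (J.mkL n).comp ((H1.fnL n).prodMap (ContinuousLinearMap.id ℝ (Vec n)))

theorem inclL_apply (w : Z n) : inclL n w = incl w := rfl

/-- The function determines its weak derivative: if φ vanishes almost everywhere, its continuous
representative vanishes on [0,1], hence so does the primitive of φ_z, hence φ_z. -/
theorem H1.fn_injective : Function.Injective (H1.fn : H1 n → L2 n) := by
  suffices h : ∀ φ : H1 n, H1.fn φ = 0 → φ = 0 by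
    intro φ φ' hφ
    rw [← sub_eq_zero]
    exact h _ ((map_sub (H1.fnL n) φ φ').trans (sub_eq_zero.2 hφ))
  intro φ hφ
  have h0 : ∀ z ∈ Ioo (0 : ℝ) 1, H1.val φ z = 0 := by
    have h1 : ∀ᵐ z ∂(volume.restrict (Ioo (0 : ℝ) 1)), H1.val φ z = 0 := by
      filter_upwards [H1.val_ae_eq φ, Lp.coeFn_zero (Vec n) 2 (volume.restrict (Ioo (0 : ℝ) 1))]
        with z h1 h2
      rw [← h1, hφ, h2, Pi.zero_apply]
    exact Measure.eqOn_open_of_ae_eq h1 isOpen_Ioo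
      ((H1.val_continuousOn φ).mono Ioo_subset_Icc_self) continuousOn_const
  have h0' : ∀ z ∈ Icc (0 : ℝ) 1, H1.val φ z = 0 := by
    have h2 : closure (Ioo (0 : ℝ) 1) = Icc 0 1 := closure_Ioo zero_ne_one
    have h3 := EqOn.of_subset_closure (s := Ioo (0 : ℝ) 1) (t := Icc 0 1)
      (f := H1.val φ) (g := fun _ => 0) h0 (H1.val_continuousOn φ) continuousOn_const
      Ioo_subset_Icc_self h2.ge
    exact h3
  refine H1.ext hφ (L2.ext_prim fun z hz => ?_)
  have h4 := H1.val_eq_val_zero_add φ hz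
  rw [h0' z hz, h0' 0 (by simp), zero_add] at h4
  rw [← h4]
  exact (map_zero (prim n z)).symm

theorem incl_injective : Function.Injective (incl : Z n → J n) := by
  intro w w' h
  have h1 : H1.fn w.1 = H1.fn w'.1 := congrArg (fun x : J n => x.fst) h
  have h2 : (incl w).snd = (incl w').snd := by rw [h]
  exact Prod.ext (H1.fn_injective h1) h2

/-- The defect `φ(0) - H φ(1) - B K η` in the boundary condition. -/
def bdryL (H : Matrix (Fin n) (Fin n) ℝ) (B : Matrix (Fin n) (Fin m) ℝ)
    (K : Matrix (Fin m) (Fin n) ℝ) : Z n →L[ℝ] Vec n :=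
  (H1.valL n 0 - (matOp H).comp (H1.valL n 1)).comp (ContinuousLinearMap.fst ℝ (H1 n) (Vec n)) -
    (matOp (B * K)).comp (ContinuousLinearMap.snd ℝ (H1 n) (Vec n))

/-- The formula of `𝒜 + ℬ` as a bounded operator on `H¹ × ℝⁿ`. -/
def genL (Λ R S : Matrix (Fin n) (Fin n) ℝ) : Z n →L[ℝ] J n :=
  (J.mkL n).comp
    ((-(((matOp Λ).compLpL 2 (volume.restrict (Ioo (0 : ℝ) 1))).comp
      ((H1.dzL n).comp (ContinuousLinearMap.fst ℝ (H1 n) (Vec n))))).prod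
      ((matOp R).comp (ContinuousLinearMap.snd ℝ (H1 n) (Vec n)) +
        ((matOp S).comp (H1.valL n 1)).comp (ContinuousLinearMap.fst ℝ (H1 n) (Vec n))))

section

variable (Λ H : Matrix (Fin n) (Fin n) ℝ) (B : Matrix (Fin n) (Fin m) ℝ)
    (R S : Matrix (Fin n) (Fin n) ℝ) (K : Matrix (Fin m) (Fin n) ℝ)

theorem mem_domA_iff {w : Z n} : w ∈ domA H B K ↔ bdryL H B K w = 0 := by
  change H1.val w.1 0 = matOp H (H1.val w.1 1) + matOp (B * K) w.2 ↔
    H1.valL n 0 w.1 - matOp H (H1.valL n 1 w.1) - matOp (B * K) w.2 = 0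
  rw [H1.valL_zero, H1.valL_one, sub_sub, sub_eq_zero]

theorem genL_fst (w : Z n) : (genL Λ R S w).fst = -(matOp Λ).compLp (H1.dz w.1) := rfl

theorem genL_snd (w : Z n) :
    (genL Λ R S w).snd = matOp R w.2 + matOp S (H1.val w.1 1) := by
  rw [← H1.valL_one]; rfl

theorem genL_apply (w : Z n) : genL Λ R S w = opA Λ R w + incl (opB S w) := by
  refine J.ext ?_ (genL_snd Λ R S w)
  rw [genL_fst]
  exact (add_zero _).symm

/-- `dom(𝒜)` as a subspace of `H¹ × ℝⁿ`. -/
def domSub : Submodule ℝ (Z n) := LinearMap.ker (bdryL H B K).toLinearMap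

theorem mem_domSub {w : Z n} : w ∈ domSub H B K ↔ w ∈ domA H B K :=
  (mem_domA_iff H B K).symm

theorem isClosed_domA : IsClosed (domA H B K) := by
  have : domA H B K = bdryL H B K ⁻¹' {0} := by
    ext w; exact mem_domA_iff H B K
  rw [this]
  exact isClosed_singleton.preimage (bdryL H B K).continuous

theorem mem_graphAB {p : J n × J n} :
    p ∈ graphAB Λ H B R S K ↔ ∃ w ∈ domA H B K, p = (incl w, genL Λ R S w) := by
  simp only [genL_apply]; rfl

/-- The inverse of a diagonal matrix with nonzero diagonal, as an operator. -/
def diagInv : Vec n →L[ℝ] Vec n := matOp (Matrix.diagonal fun i => (Λ i i)⁻¹)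

theorem diagInv_apply (v : Vec n) (i : Fin n) : diagInv Λ v i = (Λ i i)⁻¹ * v i := by
  simp [diagInv, matOp, Matrix.toEuclideanLin, Matrix.mulVec_diagonal]

variable {Λ} in
theorem matOp_diag_apply (hΛ : Λ.IsDiag) (v : Vec n) (i : Fin n) :
    matOp Λ v i = Λ i i * v i := by
  conv_lhs => rw [← hΛ.diagonal_diag]
  simp [matOp, Matrix.toEuclideanLin, Matrix.mulVec_diagonal]

variable {Λ} in
theorem diagInv_matOp (hΛ : Λ.IsDiag) (hpos : ∀ i, 0 < Λ i i) (v : Vec n) :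
    diagInv Λ (matOp Λ v) = v := by
  ext i
  rw [diagInv_apply, matOp_diag_apply hΛ, inv_mul_cancel_left₀ (hpos i).ne']

/-- Recovers `w` from `w` as an element of `L² × ℝⁿ` and `(𝒜 + ℬ) w`. -/
def recoverL : J n × J n →L[ℝ] Z n :=
  let u : J n × J n →L[ℝ] L2 n :=
    (WithLp.fstL 2 ℝ (L2 n) (Vec n)).comp (ContinuousLinearMap.fst ℝ (J n) (J n))
  -- The derivative is -Λ⁻¹ times the L² component of (𝒜 + ℬ)w. The value at 0 then follows from the
  -- mean of φ.
  let ψ : J n × J n →L[ℝ] L2 n :=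
    -(((diagInv Λ).compLpL 2 (volume.restrict (Ioo (0 : ℝ) 1))).comp
      ((WithLp.fstL 2 ℝ (L2 n) (Vec n)).comp (ContinuousLinearMap.snd ℝ (J n) (J n))))
  ((H1.mkL n).comp (((prim n 1).comp u - (primMean n).comp ψ).prod ψ)).prod
    ((WithLp.sndL 2 ℝ (L2 n) (Vec n)).comp (ContinuousLinearMap.fst ℝ (J n) (J n)))

variable {Λ} in
theorem recoverL_apply (hΛ : Λ.IsDiag) (hpos : ∀ i, 0 < Λ i i) (w : Z n) :
    recoverL Λ (incl w, genL Λ R S w) = w := by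
  have h1 : -((diagInv Λ).compLp (-((matOp Λ).compLp (H1.dz w.1)))) = H1.dz w.1 := by
    refine Lp.ext ?_
    filter_upwards [Lp.coeFn_neg ((diagInv Λ).compLp (-((matOp Λ).compLp (H1.dz w.1)))),
      (diagInv Λ).coeFn_compLp (-((matOp Λ).compLp (H1.dz w.1))),
      Lp.coeFn_neg ((matOp Λ).compLp (H1.dz w.1)), (matOp Λ).coeFn_compLp (H1.dz w.1)]
      with z e1 e2 e3 e4
    rw [e1, Pi.neg_apply, e2, e3, Pi.neg_apply, e4, map_neg, diagInv_matOp hΛ hpos, neg_neg]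
  have h2 : prim n 1 (H1.fn w.1) - primMean n (H1.dz w.1) = H1.val w.1 0 := by
    rw [H1.val_eq (by simp), prim_zero, add_zero]; rfl
  have h3 : H1.mk (prim n 1 (H1.fn w.1) - primMean n (-((diagInv Λ).compLp (-((matOp Λ).compLp (H1.dz w.1))))))
    (-((diagInv Λ).compLp (-((matOp Λ).compLp (H1.dz w.1))))) = w.1 := by
    rw [h1, h2, H1.mk_val_dz]
  exact Prod.ext h3 rfl

-- The H¹ norm is controlled by the graph norm, since Λ is invertible. So a pair lies in the graph
-- exactly when reconstruction by `recoverL` returns the pair and satisfies the boundary condition,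
-- and both conditions are closed.
variable {Λ} in
theorem isClosed_graphAB (hΛ : Λ.IsDiag) (hpos : ∀ i, 0 < Λ i i) :
    IsClosed (graphAB Λ H B R S K) := by
  have h : graphAB Λ H B R S K =
      {p | (inclL n (recoverL Λ p), genL Λ R S (recoverL Λ p)) = p} ∩
        recoverL Λ ⁻¹' domA H B K := by
    ext p
    rw [mem_graphAB]
    constructor
    · rintro ⟨w, hw, rfl⟩
      simp only [mem_inter_iff, mem_ofPred_eq, mem_preimage, recoverL_apply R S hΛ hpos, hw,
        inclL_apply, and_self]
    · rintro ⟨h1, h2⟩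
      exact ⟨_, h2, h1.symm⟩
  rw [h]
  exact (isClosed_eq (by fun_prop) continuous_id).inter
    ((isClosed_domA H B K).preimage (recoverL Λ).continuous)

/-- The element `z ↦ θ(z) v` of `H¹`. -/
theorem exists_H1_of_contDiff {θ : ℝ → ℝ} (hθ : ContDiff ℝ 1 θ) (v : Vec n) :
    ∃ φ : H1 n, (H1.fn φ =ᵐ[volume.restrict (Ioo (0 : ℝ) 1)] fun z => θ z • v) ∧
      H1.val φ 0 = θ 0 • v ∧ H1.val φ 1 = θ 1 • v := by
  have hd : Continuous (deriv θ) := hθ.continuous_deriv le_rfl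
  have hm : MemLp (fun z => deriv θ z • v) 2 (volume.restrict (Ioo (0 : ℝ) 1)) := by
    obtain ⟨C, hC⟩ := isCompact_Icc.exists_bound_of_continuousOn
      (hd.smul (continuous_const (y := v))).continuousOn (s := Icc (0 : ℝ) 1)
    refine MemLp.of_bound (hd.smul continuous_const).aestronglyMeasurable C ?_
    filter_upwards [ae_restrict_mem measurableSet_Ioo] with z hz
    exact hC z (Ioo_subset_Icc_self hz)
  have hv : ∀ z ∈ Icc (0 : ℝ) 1, θ 0 • v + prim n z (hm.toLp _) = θ z • v := by
    intro z hz
    have e1 : ∫ r in (0 : ℝ)..z, (hm.toLp _ : L2 n) r = ∫ r in (0 : ℝ)..z, deriv θ r • v := by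
      rw [intervalIntegral.integral_of_le hz.1, intervalIntegral.integral_of_le hz.1,
        integral_Ioc_eq_integral_Ioo, integral_Ioc_eq_integral_Ioo]
      exact integral_congr_ae (ae_restrict_of_ae_restrict_of_subset
        (Ioo_subset_Ioo le_rfl hz.2) hm.coeFn_toLp)
    rw [prim_apply hz, e1, intervalIntegral.integral_smul_const,
      intervalIntegral.integral_deriv_eq_sub (fun x _ => (hθ.differentiable one_ne_zero) x)
        (hd.intervalIntegrable 0 z), ← add_smul]
    congr 1; ring
  refine ⟨H1.mk (θ 0 • v) (hm.toLp _), ?_, ?_, ?_⟩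
  · filter_upwards [H1.fn_mk_ae (θ 0 • v) (hm.toLp _), ae_restrict_mem measurableSet_Ioo]
      with z h1 h2
    rw [h1, hv z (Ioo_subset_Icc_self h2)]
  · rw [H1.val_mk _ _ (by simp), hv 0 (by simp)]
  · rw [H1.val_mk _ _ (by simp), hv 1 (by simp)]

/-- Bump functions supported inside (0,1), paired with η = 0, lie in dom(𝒜) and annihilate the L²
component; one further test vector annihilates the component in ℝⁿ. -/
theorem eq_zero_of_inner_domA {x : J n} (h : ∀ w ∈ domA H B K, ⟪incl w, x⟫_ℝ = 0) : x = 0 := by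
  have hin : ∀ w : Z n, ⟪incl w, x⟫_ℝ = ⟪H1.fn w.1, x.fst⟫_ℝ + ⟪w.2, x.snd⟫_ℝ := fun w =>
    WithLp.prod_inner_apply _ _
  have h1 : x.fst = 0 := by
    have key : ∀ i, ∀ᵐ z ∂(volume : Measure ℝ), z ∈ Ioo (0 : ℝ) 1 → x.fst z i = 0 := by
      intro i
      have hxi : IntegrableOn (fun z => x.fst z i) (Ioo (0 : ℝ) 1) :=
        (EuclideanSpace.proj i : Vec n →L[ℝ] ℝ).integrable_comp (L2.integrable x.fst)
      refine isOpen_Ioo.ae_eq_zero_of_integral_contDiff_smul_eq_zero hxi.locallyIntegrableOn ?_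
      intro θ h1 h2 h3
      obtain ⟨φ, e1, e2, e3⟩ := exists_H1_of_contDiff (n := n) (h1.of_le (by simp))
        (EuclideanSpace.single i (1 : ℝ))
      have hθ0 : θ 0 = 0 := image_eq_zero_of_notMem_tsupport fun h' => by simpa using h3 h'
      have hθ1 : θ 1 = 0 := image_eq_zero_of_notMem_tsupport fun h' => by simpa using h3 h'
      have hw : ((φ, 0) : Z n) ∈ domA H B K := by
        change H1.val φ 0 = matOp H (H1.val φ 1) + matOp (B * K) 0
        rw [e2, e3, hθ0, hθ1, zero_smul, map_zero, map_zero, add_zero]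
      have := h _ hw
      rw [hin, inner_zero_left, add_zero, L2.inner_def] at this
      rw [← setIntegral_eq_integral_of_forall_compl_eq_zero (s := Ioo (0 : ℝ) 1)]
      · refine Eq.trans ?_ this
        refine integral_congr_ae ?_
        filter_upwards [e1] with z hz
        simp only [hz, inner_smul_left, EuclideanSpace.inner_single_left]
        simp
      · intro z hz
        rw [image_eq_zero_of_notMem_tsupport fun h' => hz (h3 h'), zero_smul]
    refine Lp.eq_zero_iff_ae_eq_zero.2 ?_
    rw [EventuallyEq, ae_restrict_iff' measurableSet_Ioo]
    filter_upwards [ae_all_iff.2 key] with z hz hz'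
    ext i
    exact hz i hz'
  have h2 : x.snd = 0 := by
    -- The function (1 - z) B K η vanishes at z = 1 and equals B K η at z = 0, so it satisfies the
    -- boundary condition for every H. Here η is the component to be annihilated.
    obtain ⟨φ, -, e2, e3⟩ := exists_H1_of_contDiff (n := n) (θ := fun z => 1 - z)
      (contDiff_const.sub contDiff_id) (matOp (B * K) x.snd)
    have hw : ((φ, x.snd) : Z n) ∈ domA H B K := by
      change H1.val φ 0 = matOp H (H1.val φ 1) + matOp (B * K) x.snd
      rw [e2, e3]; simp
    have := h _ hw
    rw [hin, h1, inner_zero_right, zero_add] at this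
    exact inner_self_eq_zero.1 this
  exact J.ext h1 h2

theorem denseRange_incl_domSub :
    DenseRange ((inclL n).toLinearMap.comp (domSub H B K).subtype) := by
  change Dense (range ((inclL n).toLinearMap.comp (domSub H B K).subtype))
  rw [← LinearMap.coe_range, Submodule.dense_iff_topologicalClosure_eq_top,
    Submodule.topologicalClosure_eq_top_iff, Submodule.eq_bot_iff]
  intro x hx
  refine eq_zero_of_inner_domA H B K fun w hw => ?_
  exact hx _ ⟨⟨w, (mem_domSub H B K).2 hw⟩, rfl⟩

end

end

/-! ### The weighted energy and quasi-dissipativity -/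

section

variable {n m : ℕ}

section

variable (Λ H : Matrix (Fin n) (Fin n) ℝ) (B : Matrix (Fin n) (Fin m) ℝ)
    (R S : Matrix (Fin n) (Fin n) ℝ) (K : Matrix (Fin m) (Fin n) ℝ)

theorem memLp_weight (ν : ℝ) :
    MemLp (fun z : ℝ => (1 + ν * z) • diagInv Λ) ∞ (volume.restrict (Ioo (0 : ℝ) 1)) := by
  refine memLp_top_of_bound (by fun_prop) ((1 + |ν|) * ‖diagInv Λ‖) ?_
  filter_upwards [ae_restrict_mem measurableSet_Ioo] with z hz
  rw [norm_smul]
  gcongr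
  refine (norm_add_le _ _).trans ?_
  rw [norm_one, norm_mul, Real.norm_eq_abs, Real.norm_eq_abs, abs_of_pos hz.1]
  gcongr
  exact mul_le_of_le_one_right (abs_nonneg _) hz.2.le

/-- Multiplication by `(1 + ν z) Λ⁻¹` on `L²`. -/
def weightL (ν : ℝ) : L2 n →L[ℝ] L2 n :=
  (ContinuousLinearMap.id ℝ (Vec n →L[ℝ] Vec n)).holderL (volume.restrict (Ioo (0 : ℝ) 1)) ∞ 2 2
    ((memLp_weight Λ ν).toLp _)

theorem weightL_ae (ν : ℝ) (u : L2 n) :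
    weightL Λ ν u =ᵐ[volume.restrict (Ioo (0 : ℝ) 1)] fun z => (1 + ν * z) • diagInv Λ (u z) := by
  have h := (ContinuousLinearMap.id ℝ (Vec n →L[ℝ] Vec n)).coeFn_holder (r := 2)
    ((memLp_weight Λ ν).toLp _) u
  filter_upwards [h, (memLp_weight Λ ν).coeFn_toLp] with z h1 h2
  change (ContinuousLinearMap.holder _ _ _ _ : L2 n) z = _
  rw [h1, h2]
  rfl

theorem diagInv_symm (v w : Vec n) : ⟪diagInv Λ v, w⟫_ℝ = ⟪v, diagInv Λ w⟫_ℝ := by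
  simp only [PiLp.inner_apply, diagInv_apply, RCLike.inner_apply, conj_trivial]
  exact Finset.sum_congr rfl fun i _ => by ring

theorem weightL_symm (ν : ℝ) (u v : L2 n) : ⟪weightL Λ ν u, v⟫_ℝ = ⟪u, weightL Λ ν v⟫_ℝ := by
  rw [L2.inner_def, L2.inner_def]
  refine integral_congr_ae ?_
  filter_upwards [weightL_ae Λ ν u, weightL_ae Λ ν v] with z h1 h2
  rw [h1, h2, inner_smul_left, inner_smul_right, diagInv_symm]
  rfl

/-- The weight on `L² × ℝⁿ` that defines the energy. -/
def energyL (ν : ℝ) : J n →L[ℝ] J n :=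
  (J.mkL n).comp (((weightL Λ ν).comp (WithLp.fstL 2 ℝ (L2 n) (Vec n))).prod
    (WithLp.sndL 2 ℝ (L2 n) (Vec n)))

theorem J.inner_def (x y : J n) : ⟪x, y⟫_ℝ = ⟪x.fst, y.fst⟫_ℝ + ⟪x.snd, y.snd⟫_ℝ :=
  WithLp.prod_inner_apply _ _

theorem J.norm_sq (x : J n) : ‖x‖ ^ 2 = ‖x.fst‖ ^ 2 + ‖x.snd‖ ^ 2 :=
  WithLp.prod_norm_sq_eq_of_L2 x

theorem inner_energyL (ν : ℝ) (x y : J n) :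
    ⟪energyL Λ ν x, y⟫_ℝ = ⟪weightL Λ ν x.fst, y.fst⟫_ℝ + ⟪x.snd, y.snd⟫_ℝ :=
  J.inner_def _ _

theorem energyL_symm (ν : ℝ) (x y : J n) :
    ⟪energyL Λ ν x, y⟫_ℝ = ⟪x, energyL Λ ν y⟫_ℝ := by
  rw [inner_energyL, real_inner_comm _ x, inner_energyL, weightL_symm, real_inner_comm,
    real_inner_comm x.snd]

theorem L2.integrable_inner (u v : L2 n) :
    Integrable (fun z => ⟪u z, v z⟫_ℝ) (volume.restrict (Ioo (0 : ℝ) 1)) :=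
  MeasureTheory.L2.integrable_inner u v

theorem L2.norm_sq_eq (u : L2 n) : ‖u‖ ^ 2 = ∫ z in Ioo (0 : ℝ) 1, ‖u z‖ ^ 2 := by
  rw [← real_inner_self_eq_norm_sq, MeasureTheory.L2.inner_def]
  simp only [real_inner_self_eq_norm_sq]

variable {Λ} in
theorem norm_sq_le_energy (hpos : ∀ i, 0 < Λ i i) {ν : ℝ} (hν : 0 ≤ ν) :
    ∃ κ : ℝ, 0 < κ ∧ ∀ x : J n, ‖x‖ ^ 2 ≤ κ * ⟪energyL Λ ν x, x⟫_ℝ := by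
  -- `1 + tr Λ` dominates every Λ_ii, so κ Λ⁻¹ ≥ 1, and it is at least 1, as the η-component
  -- requires.
  set κ := 1 + ∑ i, Λ i i with hκ
  have hs : 0 ≤ ∑ i, Λ i i := Finset.sum_nonneg fun i _ => (hpos i).le
  have hκ1 : 1 ≤ κ := by linarith
  refine ⟨κ, by linarith, fun x => ?_⟩
  have h1 : ∀ v : Vec n, ‖v‖ ^ 2 ≤ κ * ⟪diagInv Λ v, v⟫_ℝ := by
    intro v
    simp only [EuclideanSpace.norm_sq_eq, PiLp.inner_apply, diagInv_apply, RCLike.inner_apply,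
      conj_trivial, Finset.mul_sum, Real.norm_eq_abs, sq_abs]
    refine Finset.sum_le_sum fun i _ => ?_
    have h2 : Λ i i ≤ κ := by
      have := Finset.single_le_sum (f := fun i => Λ i i) (fun i _ => (hpos i).le)
        (Finset.mem_univ i)
      linarith
    have h3 : 1 ≤ κ * (Λ i i)⁻¹ := by
      rw [← div_eq_mul_inv, le_div_iff₀ (hpos i)]; linarith
    nlinarith [sq_nonneg (v i)]
  have h2 : ‖x.fst‖ ^ 2 ≤ κ * ⟪weightL Λ ν x.fst, x.fst⟫_ℝ := by
    rw [L2.norm_sq_eq, MeasureTheory.L2.inner_def, ← integral_const_mul]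
    have hi : Integrable (fun z => ‖x.fst z‖ ^ 2) (volume.restrict (Ioo (0 : ℝ) 1)) := by
      simpa only [real_inner_self_eq_norm_sq] using L2.integrable_inner x.fst x.fst
    refine integral_mono_ae hi ((L2.integrable_inner _ _).const_mul κ) ?_
    filter_upwards [weightL_ae Λ ν x.fst, ae_restrict_mem measurableSet_Ioo] with z h3 h4
    rw [h3, inner_smul_left, conj_trivial]
    have h5 := h1 (x.fst z)
    have h6 : 0 ≤ ν * z := mul_nonneg hν h4.1.le
    nlinarith [sq_nonneg ‖x.fst z‖]
  rw [J.norm_sq, inner_energyL, mul_add, real_inner_self_eq_norm_sq]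
  nlinarith [sq_nonneg ‖x.snd‖]

/-- Integration by parts for `∫ (1 + ν z) φ ∂_z φ`. -/
theorem integral_weight_mul_self_deriv (φ : H1 n) (ν : ℝ) :
    2 * ∫ z in Ioo (0 : ℝ) 1, (1 + ν * z) * ⟪H1.fn φ z, H1.dz φ z⟫_ℝ =
      (1 + ν) * ‖H1.val φ 1‖ ^ 2 - ‖H1.val φ 0‖ ^ 2 - ν * ‖H1.fn φ‖ ^ 2 := by
  have hv := fun i => intervalIntegrable_apply (L2.intervalIntegrable (H1.dz φ)) i
  have hval : ∀ z ∈ Icc (0 : ℝ) 1, ∀ i,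
      H1.val φ z i = H1.val φ 0 i + ∫ r in (0 : ℝ)..z, H1.dz φ r i := by
    intro z hz i
    rw [H1.val_eq_val_zero_add φ hz, PiLp.add_apply, prim_apply_apply hz]
  set F : Fin n → ℝ → ℝ := fun i z => H1.val φ 0 i + ∫ r in (0 : ℝ)..z, H1.dz φ r i with hF
  have hconst : ∀ c : ℝ, AbsolutelyContinuousOnInterval (fun _ : ℝ => c) 0 1 := fun c =>
    (contDiff_const (n := 1)).contDiffOn.absolutelyContinuousOnInterval
  have hFac : ∀ i, AbsolutelyContinuousOnInterval (F i) 0 1 := fun i =>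
    (hconst _).add ((hv i).absolutelyContinuousOnInterval_intervalIntegral (c := 0) (by simp))
  have hFd : ∀ i, ∀ᵐ z ∂(volume : Measure ℝ), z ∈ uIcc (0 : ℝ) 1 →
      HasDerivAt (F i) (H1.dz φ z i) z := by
    intro i
    filter_upwards [(hv i).ae_hasDerivAt_integral] with z hz hz'
    exact (hz hz' 0 (by simp)).const_add _
  have hwac : AbsolutelyContinuousOnInterval (fun z : ℝ => 1 + ν * z) 0 1 :=
    ContDiffOn.absolutelyContinuousOnInterval (by fun_prop)
  have hcomp : ∀ i, 2 * ∫ z in (0 : ℝ)..1, (1 + ν * z) * (F i z * H1.dz φ z i) =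
      (1 + ν) * F i 1 ^ 2 - F i 0 ^ 2 - ν * ∫ z in (0 : ℝ)..1, F i z ^ 2 := by
    intro i
    -- The identity is the fundamental theorem of calculus for the absolutely continuous function (1
    -- + ν z) F_i².
    have hG := (hwac.mul (hFac i)).mul (hFac i)
    have h1 := hG.integral_deriv_eq_sub
    have h2 : ∫ z in (0 : ℝ)..1, deriv (((fun z : ℝ => 1 + ν * z) * F i) * F i) z =
        ∫ z in (0 : ℝ)..1, (2 * ((1 + ν * z) * (F i z * H1.dz φ z i)) + ν * F i z ^ 2) := by
      refine intervalIntegral.integral_congr_ae ?_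
      filter_upwards [hFd i] with z hz hz'
      have hz1 := hz (uIoc_subset_uIcc hz')
      have hw : HasDerivAt (fun z : ℝ => 1 + ν * z) ν z := by
        simpa using ((hasDerivAt_id z).const_mul ν).const_add 1
      rw [((hw.mul hz1).mul hz1).deriv]
      simp only [Pi.mul_apply]
      ring
    have hFc := (hFac i).continuousOn
    have i1 : IntervalIntegrable (fun z => 2 * ((1 + ν * z) * (F i z * H1.dz φ z i)))
        volume 0 1 :=
      (((hv i).continuousOn_mul hFc).continuousOn_mul hwac.continuousOn).const_mul 2
    have i2 : IntervalIntegrable (fun z => ν * F i z ^ 2) volume 0 1 :=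
      (continuousOn_const.mul (hFc.pow 2)).intervalIntegrable
    rw [h2, intervalIntegral.integral_add i1 i2, intervalIntegral.integral_const_mul,
      intervalIntegral.integral_const_mul] at h1
    simp only [Pi.mul_apply] at h1
    linear_combination h1
  have hae : ∀ᵐ z ∂(volume.restrict (Ioo (0 : ℝ) 1)), ∀ i, H1.fn φ z i = F i z := by
    filter_upwards [H1.val_ae_eq φ, ae_restrict_mem measurableSet_Ioo] with z h1 h2 i
    rw [h1, hval z (Ioo_subset_Icc_self h2)]
  have e1 : ∫ z in Ioo (0 : ℝ) 1, (1 + ν * z) * ⟪H1.fn φ z, H1.dz φ z⟫_ℝ =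
      ∑ i, ∫ z in (0 : ℝ)..1, (1 + ν * z) * (F i z * H1.dz φ z i) := by
    rw [← intervalIntegral.integral_finsetSum fun i _ =>
      ((hv i).continuousOn_mul (hFac i).continuousOn).continuousOn_mul hwac.continuousOn,
      intervalIntegral.integral_of_le zero_le_one, integral_Ioc_eq_integral_Ioo]
    refine integral_congr_ae ?_
    filter_upwards [hae] with z hz
    simp only [PiLp.inner_apply, RCLike.inner_apply, conj_trivial, Finset.mul_sum, hz]
    exact Finset.sum_congr rfl fun i _ => by ring
  have e2 : ‖H1.fn φ‖ ^ 2 = ∑ i, ∫ z in (0 : ℝ)..1, F i z ^ 2 := by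
    rw [← intervalIntegral.integral_finsetSum (f := fun i z => F i z ^ 2) fun i _ =>
      ((hFac i).continuousOn.pow 2).intervalIntegrable, L2.norm_sq_eq,
      intervalIntegral.integral_of_le zero_le_one, integral_Ioc_eq_integral_Ioo]
    refine integral_congr_ae ?_
    filter_upwards [hae] with z hz
    simp only [EuclideanSpace.norm_sq_eq, Real.norm_eq_abs, sq_abs, hz]
  have e3 : ∀ z ∈ Icc (0 : ℝ) 1, ‖H1.val φ z‖ ^ 2 = ∑ i, F i z ^ 2 := by
    intro z hz
    simp only [EuclideanSpace.norm_sq_eq, Real.norm_eq_abs, sq_abs, hval z hz, hF]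
  rw [e1, e2, e3 1 (by simp), e3 0 (by simp), Finset.mul_sum, Finset.mul_sum, Finset.mul_sum,
    ← Finset.sum_sub_distrib, ← Finset.sum_sub_distrib]
  exact Finset.sum_congr rfl fun i _ => hcomp i

variable {Λ} in
/-- Quasi-dissipativity of `𝒜 + ℬ` in the energy inner product. -/
theorem inner_energyL_genL_le (hΛ : Λ.IsDiag) (hpos : ∀ i, 0 < Λ i i) :
    ∃ ν c : ℝ, 0 ≤ ν ∧ 0 ≤ c ∧ ∀ w ∈ domA H B K,
      2 * ⟪energyL Λ ν (incl w), genL Λ R S w⟫_ℝ ≤ c * ‖incl w‖ ^ 2 := by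
  -- The outflow term -(1 + ν)|φ(1)|² must absorb 2‖H‖²|φ(1)|² from |φ(0)|² and ‖S‖²|φ(1)|² from
  -- 2⟨η, Sφ(1)⟩ after Young's inequality; this fixes ν. The second constant collects the remaining
  -- terms: ν from the derivative of the weight, the others from B K, R and Young's inequality.
  refine ⟨2 * ‖matOp H‖ ^ 2 + ‖matOp S‖ ^ 2,
    (2 * ‖matOp H‖ ^ 2 + ‖matOp S‖ ^ 2) + 2 * ‖matOp (B * K)‖ ^ 2 + 2 * ‖matOp R‖ + 1,
    by positivity, by positivity, ?_⟩
  intro w hw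
  set ν := 2 * ‖matOp H‖ ^ 2 + ‖matOp S‖ ^ 2 with hν
  have h1 : ⟪weightL Λ ν (H1.fn w.1), -(matOp Λ).compLp (H1.dz w.1)⟫_ℝ =
      -∫ z in Ioo (0 : ℝ) 1, (1 + ν * z) * ⟪H1.fn w.1 z, H1.dz w.1 z⟫_ℝ := by
    rw [inner_neg_right, L2.inner_def]
    congr 1
    refine integral_congr_ae ?_
    filter_upwards [weightL_ae Λ ν (H1.fn w.1), (matOp Λ).coeFn_compLp (H1.dz w.1)] with z e1 e2
    rw [e1, e2, inner_smul_left, conj_trivial, diagInv_symm, diagInv_matOp hΛ hpos]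
  rw [inner_energyL, genL_snd, genL_fst]
  change 2 * (⟪weightL Λ ν (H1.fn w.1), _⟫_ℝ + ⟪w.2, _⟫_ℝ) ≤ _
  rw [h1]
  have h2 := integral_weight_mul_self_deriv w.1 ν
  have h3 : ‖H1.val w.1 0‖ ≤ ‖matOp H‖ * ‖H1.val w.1 1‖ + ‖matOp (B * K)‖ * ‖w.2‖ := by
    have : H1.val w.1 0 = matOp H (H1.val w.1 1) + matOp (B * K) w.2 := hw
    rw [this]
    exact (norm_add_le _ _).trans (add_le_add (ContinuousLinearMap.le_opNorm _ _)
      (ContinuousLinearMap.le_opNorm _ _))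
  have h4 : ⟪w.2, matOp R w.2 + matOp S (H1.val w.1 1)⟫_ℝ ≤
      ‖w.2‖ * (‖matOp R‖ * ‖w.2‖ + ‖matOp S‖ * ‖H1.val w.1 1‖) := by
    refine (real_inner_le_norm _ _).trans ?_
    gcongr
    exact (norm_add_le _ _).trans (add_le_add (ContinuousLinearMap.le_opNorm _ _)
      (ContinuousLinearMap.le_opNorm _ _))
  have h5 : ‖incl w‖ ^ 2 = ‖H1.fn w.1‖ ^ 2 + ‖w.2‖ ^ 2 := J.norm_sq _
  rw [h5]
  generalize (∫ z in Ioo (0 : ℝ) 1, (1 + ν * z) * ⟪H1.fn w.1 z, H1.dz w.1 z⟫_ℝ) = I at h2 ⊢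
  have h0 : ‖H1.val w.1 0‖ ^ 2 ≤
      (‖matOp H‖ * ‖H1.val w.1 1‖ + ‖matOp (B * K)‖ * ‖w.2‖) ^ 2 := by gcongr
  have h0' : 0 ≤ ν := by positivity
  generalize ‖H1.val w.1 0‖ = a at *
  generalize ‖H1.val w.1 1‖ = b at *
  generalize ‖w.2‖ = e at *
  generalize ‖H1.fn w.1‖ = f at *
  generalize ‖matOp H‖ = h at *
  generalize ‖matOp S‖ = s at *
  generalize ‖matOp (B * K)‖ = k at *
  have h6 : a ^ 2 ≤ 2 * h ^ 2 * b ^ 2 + 2 * k ^ 2 * e ^ 2 := by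
    nlinarith [sq_nonneg (h * b - k * e)]
  have h7 : 2 * (e * (s * b)) ≤ e ^ 2 + s ^ 2 * b ^ 2 := by nlinarith [sq_nonneg (e - s * b)]
  have h8 : (1 + ν) * b ^ 2 = 2 * h ^ 2 * b ^ 2 + s ^ 2 * b ^ 2 + b ^ 2 := by rw [hν]; ring
  have hr : 0 ≤ ‖matOp R‖ := norm_nonneg _
  have h9 : 0 ≤ (2 * k ^ 2 + 2 * ‖matOp R‖ + 1) * f ^ 2 := by positivity
  have h10 : 0 ≤ ν * e ^ 2 := by positivity
  linarith [sq_nonneg b]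

end

end

/-! ### Solutions in integrated form: algebra, a priori bound, uniqueness -/

section

variable {n m : ℕ}

/-- The input operator `v ↦ (0, S v)`. -/
def inputL (S : Matrix (Fin n) (Fin n) ℝ) : Vec n →L[ℝ] J n :=
  (J.mkL n).comp ((0 : Vec n →L[ℝ] L2 n).prod (matOp S))

/-- `x` is a solution of `ẋ = (𝒜 + ℬ) x + (0, S d)` on `[0,T]`, in integrated form. -/
structure IsSol (Λ H : Matrix (Fin n) (Fin n) ℝ) (B : Matrix (Fin n) (Fin m) ℝ)
    (R S : Matrix (Fin n) (Fin n) ℝ) (K : Matrix (Fin m) (Fin n) ℝ)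
    (d : ℝ → Vec n) (T : ℝ) (x : ℝ → Z n) : Prop where
  continuousOn : ContinuousOn x (Icc 0 T)
  mem_domA : ∀ t ∈ Icc 0 T, x t ∈ domA H B K
  eq : ∀ t ∈ Icc 0 T,
    incl (x t) = incl (x 0) + ∫ s in (0 : ℝ)..t, (genL Λ R S (x s) + inputL S (d s))

theorem intervalIntegrable_of_continuousOn_Icc {E F : Type*} [TopologicalSpace E]
    [NormedAddCommGroup F] {x : ℝ → E} {T a b : ℝ}
    (hx : ContinuousOn x (Icc 0 T)) {L : E → F} (hL : Continuous L)
    (ha : a ∈ Icc 0 T) (hb : b ∈ Icc 0 T) :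
    IntervalIntegrable (fun s => L (x s)) volume a b :=
  (hL.comp_continuousOn (hx.mono ((convex_Icc 0 T).ordConnected.uIcc_subset ha hb))).intervalIntegrable

theorem intervalIntegrable_inputL (S : Matrix (Fin n) (Fin n) ℝ) {d : ℝ → Vec n}
    (hd : LocallyIntegrable d volume) (a b : ℝ) :
    IntervalIntegrable (fun s => inputL S (d s)) volume a b := by
  have h := (hd.integrableOn_isCompact (k := uIcc a b) isCompact_uIcc)
  rw [intervalIntegrable_iff]
  exact (inputL S).integrable_comp (h.mono_set uIoc_subset_uIcc)

section

variable {Λ H : Matrix (Fin n) (Fin n) ℝ} {B : Matrix (Fin n) (Fin m) ℝ}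
    {R S : Matrix (Fin n) (Fin n) ℝ} {K : Matrix (Fin m) (Fin n) ℝ}

theorem IsSol.mono {d : ℝ → Vec n} {T T' : ℝ} {x : ℝ → Z n} (hx : IsSol Λ H B R S K d T x)
    (h : T' ≤ T) : IsSol Λ H B R S K d T' x where
  continuousOn := hx.continuousOn.mono (Icc_subset_Icc le_rfl h)
  mem_domA t ht := hx.mem_domA t ⟨ht.1, ht.2.trans h⟩
  eq t ht := hx.eq t ⟨ht.1, ht.2.trans h⟩

theorem IsSol.congr {d : ℝ → Vec n} {T : ℝ} {x y : ℝ → Z n} (hx : IsSol Λ H B R S K d T x)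
    (h : EqOn y x (Icc 0 T)) : IsSol Λ H B R S K d T y where
  continuousOn := hx.continuousOn.congr h
  mem_domA t ht := by rw [h ht]; exact hx.mem_domA t ht
  eq t ht := by
    rw [h ht, h (left_mem_Icc.2 (ht.1.trans ht.2)), hx.eq t ht]
    congr 1
    refine intervalIntegral.integral_congr fun s hs => ?_
    rw [uIcc_of_le ht.1] at hs
    simp only [h ⟨hs.1, hs.2.trans ht.2⟩]

theorem IsSol.eq_of_input_zero {T : ℝ} {x : ℝ → Z n}
    (hx : IsSol Λ H B R S K (fun _ => 0) T x) {t : ℝ} (ht : t ∈ Icc 0 T) :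
    incl (x t) = incl (x 0) + ∫ s in (0 : ℝ)..t, genL Λ R S (x s) := by
  simpa only [map_zero, add_zero] using hx.eq t ht

theorem isSol_zero_input_iff {T : ℝ} {x : ℝ → Z n} :
    IsSol Λ H B R S K (fun _ => 0) T x ↔ ContinuousOn x (Icc 0 T) ∧
      (∀ t ∈ Icc 0 T, x t ∈ domA H B K) ∧ ∀ t ∈ Icc 0 T,
        incl (x t) = incl (x 0) + ∫ s in (0 : ℝ)..t, genL Λ R S (x s) :=
  ⟨fun h => ⟨h.1, h.2, fun _ ht => h.eq_of_input_zero ht⟩, fun h => ⟨h.1, h.2.1, fun t ht => by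
    simpa only [map_zero, add_zero] using h.2.2 t ht⟩⟩

theorem IsSol.add {T : ℝ} {x y : ℝ → Z n} (hx : IsSol Λ H B R S K (fun _ => 0) T x)
    (hy : IsSol Λ H B R S K (fun _ => 0) T y) :
    IsSol Λ H B R S K (fun _ => 0) T (fun t => x t + y t) := by
  refine isSol_zero_input_iff.2 ⟨hx.1.add hy.1, fun t ht => ?_, fun t ht => ?_⟩
  · exact (mem_domSub H B K).1 (Submodule.add_mem _ ((mem_domSub H B K).2 (hx.2 t ht))
      ((mem_domSub H B K).2 (hy.2 t ht)))
  · have h0 : (0 : ℝ) ∈ Icc 0 T := left_mem_Icc.2 (ht.1.trans ht.2)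
    simp only [← inclL_apply, map_add]
    rw [intervalIntegral.integral_add
      (intervalIntegrable_of_continuousOn_Icc hx.1 (genL Λ R S).continuous h0 ht)
      (intervalIntegrable_of_continuousOn_Icc hy.1 (genL Λ R S).continuous h0 ht),
      inclL_apply, inclL_apply, hx.eq_of_input_zero ht, hy.eq_of_input_zero ht]
    simp only [inclL_apply]
    abel

theorem IsSol.smul {T : ℝ} {x : ℝ → Z n} (c : ℝ) (hx : IsSol Λ H B R S K (fun _ => 0) T x) :
    IsSol Λ H B R S K (fun _ => 0) T (fun t => c • x t) := by
  refine isSol_zero_input_iff.2 ⟨hx.1.const_smul c, fun t ht => ?_, fun t ht => ?_⟩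
  · exact (mem_domSub H B K).1 (Submodule.smul_mem _ c ((mem_domSub H B K).2 (hx.2 t ht)))
  · simp only [← inclL_apply, map_smul]
    rw [intervalIntegral.integral_smul, ← smul_add, inclL_apply, hx.eq_of_input_zero ht]
    rfl

/-- A solution can be restarted at a later time. -/
theorem IsSol.shift {T a : ℝ} {x : ℝ → Z n} (hx : IsSol Λ H B R S K (fun _ => 0) T x)
    (ha : 0 ≤ a) : IsSol Λ H B R S K (fun _ => 0) (T - a) (fun t => x (a + t)) := by
  refine isSol_zero_input_iff.2 ⟨hx.1.comp (by fun_prop) fun t ht => ?_, fun t ht => ?_,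
    fun t ht => ?_⟩
  · exact ⟨add_nonneg ha ht.1, by linarith [ht.2]⟩
  · exact hx.2 _ ⟨add_nonneg ha ht.1, by linarith [ht.2]⟩
  · have h1 : a + t ∈ Icc 0 T := ⟨add_nonneg ha ht.1, by linarith [ht.2]⟩
    have h2 : a ∈ Icc 0 T := ⟨ha, by linarith [ht.1, ht.2]⟩
    have h0 : (0 : ℝ) ∈ Icc 0 T := ⟨le_rfl, ha.trans h2.2⟩
    simp only [add_zero]
    rw [hx.eq_of_input_zero h1, hx.eq_of_input_zero h2,
      intervalIntegral.integral_comp_add_left (fun s => genL Λ R S (x s)) a, add_assoc, add_zero,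
      intervalIntegral.integral_add_adjacent_intervals
      (intervalIntegrable_of_continuousOn_Icc hx.1 (genL Λ R S).continuous h0 h2)
      (intervalIntegrable_of_continuousOn_Icc hx.1 (genL Λ R S).continuous h2 h1)]

/-- Concatenation of solutions. -/
theorem IsSol.concat {d : ℝ → Vec n} (hd : LocallyIntegrable d volume) {a b : ℝ} (ha : 0 ≤ a)
    (hb : 0 ≤ b) {x y : ℝ → Z n} (hx : IsSol Λ H B R S K d a x)
    (hy : IsSol Λ H B R S K (fun s => d (a + s)) b y) (hxy : y 0 = x a) :
    IsSol Λ H B R S K d (a + b) (fun t => if t ≤ a then x t else y (t - a)) := by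
  have h1 : EqOn (fun t => if t ≤ a then x t else y (t - a)) x (Icc 0 a) := fun t ht =>
    if_pos ht.2
  -- The matching condition `y 0 = x a` lets the second formula hold also at `t = a`, so continuity
  -- can be glued from two closed intervals.
  have h2 : EqOn (fun t => if t ≤ a then x t else y (t - a)) (fun t => y (t - a))
      (Icc a (a + b)) := by
    intro t ht
    rcases ht.1.eq_or_lt with rfl | h
    · simp [hxy]
    · exact if_neg h.not_ge
  have hyc : ContinuousOn (fun t => y (t - a)) (Icc a (a + b)) :=
    hy.continuousOn.comp (by fun_prop) fun t ht => ⟨by linarith [ht.1], by linarith [ht.2]⟩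
  have hc : ContinuousOn (fun t => if t ≤ a then x t else y (t - a)) (Icc 0 (a + b)) := by
    rw [← Icc_union_Icc_eq_Icc ha (by linarith : a ≤ a + b)]
    exact (hx.continuousOn.congr h1).union_of_isClosed (hyc.congr h2) isClosed_Icc isClosed_Icc
  set w := fun t => if t ≤ a then x t else y (t - a) with hw
  refine ⟨hc, fun t ht => ?_, fun t ht => ?_⟩
  · rcases le_total t a with h | h
    · rw [h1 ⟨ht.1, h⟩]; exact hx.mem_domA t ⟨ht.1, h⟩
    · rw [h2 ⟨h, ht.2⟩]; exact hy.mem_domA _ ⟨by linarith, by linarith [ht.2]⟩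
  · have hx' := hx.congr h1
    rcases le_total t a with h | h
    · exact hx'.eq t ⟨ht.1, h⟩
    · have ht' : t - a ∈ Icc 0 b := ⟨by linarith, by linarith [ht.2]⟩
      have e1 := hy.eq (t - a) ht'
      have e2 := hx'.eq a ⟨ha, le_rfl⟩
      have h0 : (0 : ℝ) ∈ Icc 0 (a + b) := ⟨le_rfl, by linarith⟩
      have ha' : a ∈ Icc 0 (a + b) := ⟨ha, by linarith⟩
      have e3 : ∫ s in (0 : ℝ)..(t - a), (genL Λ R S (y s) + inputL S (d (a + s))) =
          ∫ s in a..t, (genL Λ R S (w s) + inputL S (d s)) := by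
        have e4 := intervalIntegral.integral_comp_add_left (a := 0) (b := t - a)
          (fun s => genL Λ R S (w s) + inputL S (d s)) a
        rw [add_zero, add_sub_cancel] at e4
        rw [← e4]
        refine intervalIntegral.integral_congr fun s hs => ?_
        rw [uIcc_of_le ht'.1] at hs
        have := h2 (x := a + s) ⟨by linarith [hs.1], by linarith [hs.2, ht'.2]⟩
        simp only at this ⊢
        rw [this, add_sub_cancel_left]
      rw [e3, hxy, ← h1 ⟨ha, le_rfl⟩, e2, add_assoc,
        intervalIntegral.integral_add_adjacent_intervals] at e1
      · rw [h2 ⟨h, ht.2⟩]; exact e1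
      · exact (intervalIntegrable_of_continuousOn_Icc hc (genL Λ R S).continuous h0 ha').add
          (intervalIntegrable_inputL S hd _ _)
      · exact (intervalIntegrable_of_continuousOn_Icc hc (genL Λ R S).continuous ha' ht).add
          (intervalIntegrable_inputL S hd _ _)

theorem IsSol.hasDerivAt {T : ℝ} {x : ℝ → Z n} (hx : IsSol Λ H B R S K (fun _ => 0) T x)
    {t : ℝ} (ht : t ∈ Ioo 0 T) : HasDerivAt (fun s => incl (x s)) (genL Λ R S (x t)) t := by
  have hT : 0 ≤ T := (ht.1.trans ht.2).le
  have hc : ContinuousOn (fun s => genL Λ R S (x s)) (Icc 0 T) :=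
    (genL Λ R S).continuous.comp_continuousOn hx.continuousOn
  have h1 : HasDerivAt (fun u => ∫ s in (0 : ℝ)..u, genL Λ R S (x s)) (genL Λ R S (x t)) t := by
    refine intervalIntegral.integral_hasDerivAt_right
      (intervalIntegrable_of_continuousOn_Icc hx.1 (genL Λ R S).continuous
        (left_mem_Icc.2 hT) (Ioo_subset_Icc_self ht)) ?_
      (hc.continuousAt (Icc_mem_nhds ht.1 ht.2))
    exact (hc.mono Ioo_subset_Icc_self).stronglyMeasurableAtFilter isOpen_Ioo t ht
  refine (h1.const_add (incl (x 0))).congr_of_eventuallyEq ?_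
  filter_upwards [Ioo_mem_nhds ht.1 ht.2] with s hs
  exact hx.eq_of_input_zero (Ioo_subset_Icc_self hs)

variable (H B R S K) in
/-- A priori estimate for solutions without input. -/
theorem exists_norm_sol_le (hΛ : Λ.IsDiag) (hpos : ∀ i, 0 < Λ i i) :
    ∃ M c : ℝ, 0 ≤ M ∧ 0 ≤ c ∧ ∀ (T : ℝ) (x : ℝ → Z n), IsSol Λ H B R S K (fun _ => 0) T x →
      ∀ t ∈ Icc 0 T, ‖incl (x t)‖ ≤ M * Real.exp (c * t) * ‖incl (x 0)‖ := by
  obtain ⟨ν, c, hν, hc, hdiss⟩ := inner_energyL_genL_le H B R S K hΛ hpos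
  obtain ⟨κ, hκ, hnorm⟩ := norm_sq_le_energy hpos hν
  -- The energy V is quadratic and grows at rate at most cκ, so the norm grows at half that rate.
  -- The prefactor compares the norm with the energy in both directions.
  refine ⟨√(κ * ‖energyL Λ ν‖), c * κ / 2, Real.sqrt_nonneg _, by positivity, ?_⟩
  intro T x hx t ht
  set V : ℝ → ℝ := fun s => ⟪energyL Λ ν (incl (x s)), incl (x s)⟫_ℝ with hV
  have hxc : ContinuousOn (fun s => incl (x s)) (Icc 0 T) :=
    (inclL n).continuous.comp_continuousOn hx.continuousOn
  have hVc : ContinuousOn V (Icc 0 T) :=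
    ((energyL Λ ν).continuous.comp_continuousOn hxc).inner (𝕜 := ℝ) hxc
  have hVd : ∀ s ∈ Ioo 0 T, ∃ V', HasDerivAt V V' s ∧ V' ≤ c * κ * V s := by
    intro s hs
    have h1 := hx.hasDerivAt hs
    have h2 := ((energyL Λ ν).hasFDerivAt.comp_hasDerivAt s h1).inner ℝ h1
    refine ⟨_, h2, ?_⟩
    have h3 := hdiss (x s) (hx.mem_domA s (Ioo_subset_Icc_self hs))
    have h4 : c * ‖incl (x s)‖ ^ 2 ≤ c * (κ * V s) := by
      gcongr; exact hnorm _
    have h5 : ⟪energyL Λ ν (genL Λ R S (x s)), incl (x s)⟫_ℝ =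
        ⟪energyL Λ ν (incl (x s)), genL Λ R S (x s)⟫_ℝ := by
      rw [energyL_symm, real_inner_comm]
    simp only [Function.comp_apply]
    rw [h5]
    linarith
  -- Grönwall's inequality in differential form: V' ≤ cκV makes e^(-cκs)V(s) nonincreasing.
  have hanti : AntitoneOn (fun s => Real.exp (-(c * κ) * s) * V s) (Icc 0 T) := by
    refine antitoneOn_of_deriv_nonpos (convex_Icc 0 T)
      ((Continuous.continuousOn (by fun_prop)).mul hVc) ?_ ?_
    · intro s hs
      rw [interior_Icc] at hs
      obtain ⟨V', h1, -⟩ := hVd s hs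
      exact (DifferentiableAt.mul (by fun_prop) h1.differentiableAt).differentiableWithinAt
    · intro s hs
      rw [interior_Icc] at hs
      obtain ⟨V', h1, h2⟩ := hVd s hs
      have h3 : HasDerivAt (fun s => Real.exp (-(c * κ) * s))
          (Real.exp (-(c * κ) * s) * (-(c * κ))) s := by
        simpa using ((hasDerivAt_id s).const_mul (-(c * κ))).exp
      change deriv ((fun s => Real.exp (-(c * κ) * s)) * V) s ≤ 0
      rw [(h3.mul h1).deriv]
      have h4 : Real.exp (-(c * κ) * s) * V' ≤ Real.exp (-(c * κ) * s) * (c * κ * V s) := by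
        gcongr
      linarith
  have h0 : (0 : ℝ) ∈ Icc 0 T := left_mem_Icc.2 (ht.1.trans ht.2)
  have h1 := hanti h0 ht ht.1
  simp only [mul_zero, Real.exp_zero, one_mul] at h1
  have h2 : V t ≤ Real.exp (c * κ * t) * V 0 := by
    have h3 : V t = Real.exp (c * κ * t) * (Real.exp (-(c * κ) * t) * V t) := by
      rw [← mul_assoc, ← Real.exp_add]; simp
    rw [h3]; gcongr
  have h4 : V 0 ≤ ‖energyL Λ ν‖ * ‖incl (x 0)‖ ^ 2 := by
    refine (real_inner_le_norm _ _).trans ?_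
    rw [sq, ← mul_assoc]
    gcongr
    exact ContinuousLinearMap.le_opNorm _ _
  refine le_of_sq_le_sq ?_ (by positivity)
  rw [mul_pow, mul_pow, Real.sq_sqrt (by positivity), ← Real.exp_nat_mul]
  have h5 : ((2 : ℕ) : ℝ) * (c * κ / 2 * t) = c * κ * t := by push_cast; ring
  rw [h5]
  calc ‖incl (x t)‖ ^ 2 ≤ κ * V t := hnorm _
    _ ≤ κ * (Real.exp (c * κ * t) * (‖energyL Λ ν‖ * ‖incl (x 0)‖ ^ 2)) := by
        gcongr; exact h2.trans (by gcongr)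
    _ = _ := by ring

/-- The a priori bound applied to the difference, which starts at 0, makes it vanish in L² × ℝⁿ;
injectivity of `incl` carries this back to H¹ × ℝⁿ. -/
theorem IsSol.eqOn (hΛ : Λ.IsDiag) (hpos : ∀ i, 0 < Λ i i) {T : ℝ} {x y : ℝ → Z n}
    (hx : IsSol Λ H B R S K (fun _ => 0) T x) (hy : IsSol Λ H B R S K (fun _ => 0) T y)
    (h0 : x 0 = y 0) : EqOn x y (Icc 0 T) := by
  obtain ⟨M, c, -, -, hM⟩ := exists_norm_sol_le H B R S K hΛ hpos
  intro t ht
  have h := hM T _ (hx.add (hy.smul (-1))) t ht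
  have h1 : ∀ s, x s + (-1 : ℝ) • y s = x s - y s := fun s => by rw [neg_one_smul, sub_eq_add_neg]
  simp only [h1] at h
  rw [h0, sub_self] at h
  have h2 : incl (0 : Z n) = 0 := map_zero (inclL n)
  rw [h2, norm_zero, mul_zero, norm_le_zero_iff] at h
  rw [← sub_eq_zero]
  exact incl_injective (h.trans h2.symm)

end

end

/-! ### Transport along characteristics and the linear ODE -/

section

variable {n m : ℕ}

theorem memLp_comp_mul_left {E : Type*} [NormedAddCommGroup E] {f : ℝ → E} {p : ℝ≥0∞}
    (hf : MemLp f p volume) {a : ℝ} (ha : a ≠ 0) : MemLp (fun z => f (a * z)) p volume := by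
  have h : MemLp f p (Measure.map (a * ·) volume) := by
    rw [Real.map_volume_mul_left ha]
    exact hf.smul_measure ENNReal.ofReal_ne_top
  exact ((Homeomorph.mulLeft₀ a ha).measurableEmbedding.memLp_map_measure_iff).1 h

theorem memLp_comp_sub_right {E : Type*} [NormedAddCommGroup E] {f : ℝ → E} {p : ℝ≥0∞}
    (hf : MemLp f p volume) (a : ℝ) : MemLp (fun z => f (z - a)) p volume :=
  hf.comp_measurePreserving (measurePreserving_sub_right volume a)

theorem memLp_vec_of_apply {α : Type*} [MeasurableSpace α] {μ : Measure α} {p : ℝ≥0∞}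
    {f : α → Vec n} (h : ∀ i, MemLp (fun a => f a i) p μ) : MemLp f p μ := by
  have e : f = fun a => ∑ i, f a i • EuclideanSpace.single i (1 : ℝ) := by
    funext a
    ext j
    simp [Pi.single_apply]
  rw [e]
  exact memLp_finsetSum _ fun i _ => (ContinuousLinearMap.toSpanSingleton ℝ
    (EuclideanSpace.single i (1 : ℝ) : Vec n)).comp_memLp' (h i)

theorem intervalIntegrable_of_memLp {E : Type*} [NormedAddCommGroup E] {f : ℝ → E}
    (hf : MemLp f 2 volume) (a b : ℝ) : IntervalIntegrable f volume a b := by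
  rw [intervalIntegrable_iff]
  exact ((hf.locallyIntegrable (by norm_num)).integrableOn_isCompact isCompact_uIcc).mono_set
    uIoc_subset_uIcc

/-- The restriction to `(0,1)` of the translate `z ↦ Q (z - t)`. -/
def slide {Q : ℝ → ℝ} (hQ : MemLp Q 2 volume) (t : ℝ) :
    Lp ℝ 2 (volume.restrict (Ioo (0 : ℝ) 1)) :=
  LpToLpRestrictCLM ℝ ℝ ℝ volume 2 (Ioo 0 1)
    (Lp.compMeasurePreserving (fun z => z - t) (measurePreserving_sub_right volume t) (hQ.toLp Q))

theorem slide_ae {Q : ℝ → ℝ} (hQ : MemLp Q 2 volume) (t : ℝ) :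
    slide hQ t =ᵐ[volume.restrict (Ioo (0 : ℝ) 1)] fun z => Q (z - t) := by
  have h1 := LpToLpRestrictCLM_coeFn ℝ (Ioo (0 : ℝ) 1)
    (Lp.compMeasurePreserving (fun z => z - t) (measurePreserving_sub_right volume t) (hQ.toLp Q))
  have h2 := Lp.coeFn_compMeasurePreserving (hQ.toLp Q) (measurePreserving_sub_right volume t)
  have h3 := (measurePreserving_sub_right volume t).quasiMeasurePreserving.ae_eq_comp hQ.coeFn_toLp
  filter_upwards [h1, ae_restrict_of_ae h2, ae_restrict_of_ae h3] with z e1 e2 e3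
  rw [slide, e1, e2, e3]
  rfl

/-- Translations act strongly continuously on L²(ℝ). Applied to derivatives of profiles, this gives
continuity in time with values in H¹. -/
theorem continuous_slide {Q : ℝ → ℝ} (hQ : MemLp Q 2 volume) : Continuous (slide hQ) := by
  refine (LpToLpRestrictCLM ℝ ℝ ℝ volume 2 (Ioo 0 1)).continuous.comp ?_
  let g : ℝ → C(ℝ, ℝ) := fun t => ⟨fun z => z - t, by fun_prop⟩
  have hg : Continuous g :=
    ContinuousMap.continuous_of_continuous_uncurry _ (by
      change Continuous fun p : ℝ × ℝ => p.2 - p.1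
      fun_prop)
  exact Continuous.compMeasurePreservingLp (continuous_const (y := hQ.toLp Q)) hg
    (fun t => measurePreserving_sub_right volume t) (by norm_num)

/-- The profiles `Q i` translated with speeds `l i`. -/
def slideVec {Q : Fin n → ℝ → ℝ} (hQ : ∀ i, MemLp (Q i) 2 volume) (l : Fin n → ℝ) (t : ℝ) : L2 n :=
  ∑ i, (ContinuousLinearMap.toSpanSingleton ℝ (EuclideanSpace.single i (1 : ℝ) : Vec n)).compLpL 2
    (volume.restrict (Ioo (0 : ℝ) 1)) (slide (hQ i) (l i * t))

theorem continuous_slideVec {Q : Fin n → ℝ → ℝ} (hQ : ∀ i, MemLp (Q i) 2 volume) (l : Fin n → ℝ) :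
    Continuous (slideVec hQ l) :=
  continuous_finsetSum _ fun i _ => (ContinuousLinearMap.continuous _).comp
    ((continuous_slide (hQ i)).comp (continuous_const.mul continuous_id))

theorem slideVec_ae {Q : Fin n → ℝ → ℝ} (hQ : ∀ i, MemLp (Q i) 2 volume) (l : Fin n → ℝ) (t : ℝ) :
    ∀ᵐ z ∂(volume.restrict (Ioo (0 : ℝ) 1)), ∀ i, slideVec hQ l t z i = Q i (z - l i * t) := by
  have h1 := Lp.coeFn_finsetSum Finset.univ fun i => (ContinuousLinearMap.toSpanSingleton ℝ
    (EuclideanSpace.single i (1 : ℝ) : Vec n)).compLpL 2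
    (volume.restrict (Ioo (0 : ℝ) 1)) (slide (hQ i) (l i * t))
  have h2 : ∀ᵐ z ∂(volume.restrict (Ioo (0 : ℝ) 1)), ∀ i,
      ((ContinuousLinearMap.toSpanSingleton ℝ
        (EuclideanSpace.single i (1 : ℝ) : Vec n)).compLpL 2
        (volume.restrict (Ioo (0 : ℝ) 1)) (slide (hQ i) (l i * t)) : L2 n) z =
        slide (hQ i) (l i * t) z • EuclideanSpace.single i (1 : ℝ) :=
    ae_all_iff.2 fun i => ContinuousLinearMap.coeFn_compLpL _ _
  have h3 : ∀ᵐ z ∂(volume.restrict (Ioo (0 : ℝ) 1)), ∀ i,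
      slide (hQ i) (l i * t) z = Q i (z - l i * t) := ae_all_iff.2 fun i => slide_ae _ _
  filter_upwards [h1, h2, h3] with z e1 e2 e3 i
  rw [slideVec, e1, Finset.sum_apply]
  simp only [e2, e3]
  simp [Pi.single_apply]

section transport

variable {Q : Fin n → ℝ → ℝ} (hQ : ∀ i, MemLp (Q i) 2 volume) (l : Fin n → ℝ) (c : Vec n)

/-- The primitive of `Q` with value `c` at `0`. -/
def profile (Q : Fin n → ℝ → ℝ) (c : Vec n) (i : Fin n) (z : ℝ) : ℝ := c i + ∫ r in (0 : ℝ)..z, Q i r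

include hQ in
theorem continuous_profile (i : Fin n) : Continuous (profile Q c i) :=
  continuous_const.add (intervalIntegral.continuous_primitive
    (fun a b => intervalIntegrable_of_memLp (hQ i) a b) 0)

include hQ in
theorem profile_sub (i : Fin n) (a b : ℝ) :
    profile Q c i b - profile Q c i a = ∫ r in a..b, Q i r := by
  rw [profile, profile, add_sub_add_left_eq_sub, intervalIntegral.integral_interval_sub_left
    (intervalIntegrable_of_memLp (hQ i) _ _) (intervalIntegrable_of_memLp (hQ i) _ _)]

/-- The solution `X_i(z,t) = F_i(z - l_i t)` of the transport equation. -/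
def transport (t : ℝ) : H1 n :=
  H1.mk (WithLp.toLp 2 fun i => profile Q c i (-(l i * t))) (slideVec hQ l t)

/-- In the coordinates of `H1.mkL`, continuity into H¹ splits into continuity of the trace at 0 and
continuity of the derivative in L². -/
theorem continuous_transport : Continuous (transport hQ l c) := by
  have h1 : Continuous fun t => (WithLp.toLp 2 fun i => profile Q c i (-(l i * t)) : Vec n) :=
    (PiLp.continuous_toLp 2 _).comp (continuous_pi fun i =>
      (continuous_profile hQ c i).comp (by fun_prop))
  exact (H1.mkL n).continuous.comp (h1.prodMk (continuous_slideVec hQ l))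

theorem prim_slideVec (t : ℝ) {z : ℝ} (hz : z ∈ Icc (0 : ℝ) 1) (i : Fin n) :
    prim n z (slideVec hQ l t) i = profile Q c i (z - l i * t) - profile Q c i (-(l i * t)) := by
  rw [prim_apply_apply hz, profile_sub hQ]
  have h := intervalIntegral.integral_comp_sub_right (a := 0) (b := z) (Q i) (l i * t)
  rw [zero_sub] at h
  rw [← h, intervalIntegral.integral_of_le hz.1, intervalIntegral.integral_of_le hz.1,
    integral_Ioc_eq_integral_Ioo, integral_Ioc_eq_integral_Ioo]
  refine integral_congr_ae ?_
  filter_upwards [ae_restrict_of_ae_restrict_of_subset (Ioo_subset_Ioo le_rfl hz.2)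
    (slideVec_ae hQ l t)] with r hr
  exact hr i

theorem val_transport (t : ℝ) {z : ℝ} (hz : z ∈ Icc (0 : ℝ) 1) (i : Fin n) :
    H1.val (transport hQ l c t) z i = profile Q c i (z - l i * t) := by
  rw [transport, H1.val_mk _ _ hz, PiLp.add_apply, prim_slideVec hQ l c t hz]
  simp

theorem H1.prim_fn (φ : H1 n) {z : ℝ} (hz : z ∈ Icc (0 : ℝ) 1) (i : Fin n) :
    prim n z (H1.fn φ) i = ∫ r in (0 : ℝ)..z, H1.val φ r i := by
  rw [prim_apply_apply hz, intervalIntegral.integral_of_le hz.1,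
    intervalIntegral.integral_of_le hz.1, integral_Ioc_eq_integral_Ioo,
    integral_Ioc_eq_integral_Ioo]
  refine integral_congr_ae ?_
  filter_upwards [ae_restrict_of_ae_restrict_of_subset (Ioo_subset_Ioo le_rfl hz.2)
    (H1.val_ae_eq φ)] with r hr
  rw [hr]

theorem prim_compLp {z : ℝ} (A : Vec n →L[ℝ] Vec n) (u : L2 n) :
    prim n z (A.compLp u) = A (prim n z u) := by
  rw [prim_eq_setIntegral, prim_eq_setIntegral,
    ← A.integral_comp_comm (L2.integrable u).integrableOn]
  refine integral_congr_ae (ae_restrict_of_ae ?_)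
  filter_upwards [A.coeFn_compLp u] with r hr
  rw [hr]

theorem prim_fn_transport (t : ℝ) {z : ℝ} (hz : z ∈ Icc (0 : ℝ) 1) (i : Fin n) :
    prim n z (H1.fn (transport hQ l c t)) i =
      ∫ r in (-(l i * t))..(z - l i * t), profile Q c i r := by
  rw [H1.prim_fn _ hz, ← zero_sub, ← intervalIntegral.integral_comp_sub_right]
  refine intervalIntegral.integral_congr fun r hr => ?_
  rw [uIcc_of_le hz.1] at hr
  exact val_transport hQ l c t ⟨hr.1, hr.2.trans hz.2⟩ i

/-- The transport equation integrated in time. Comparing primitives in z leaves only integrals of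
the continuous profile, so its L² derivative never has to be handled pointwise. -/
theorem fn_transport {Λ : Matrix (Fin n) (Fin n) ℝ} (hΛ : Λ.IsDiag) (t : ℝ) :
    H1.fn (transport hQ (fun i => Λ i i) c t) = H1.fn (transport hQ (fun i => Λ i i) c 0) +
      ∫ s in (0 : ℝ)..t, -(matOp Λ).compLp (H1.dz (transport hQ (fun i => Λ i i) c s)) := by
  set X := transport hQ (fun i => Λ i i) c with hX
  have hXc : Continuous X := continuous_transport hQ _ c
  have hc : Continuous fun s => -(matOp Λ).compLp (H1.dz (X s)) :=
    (((matOp Λ).compLpL 2 (volume.restrict (Ioo (0 : ℝ) 1))).continuous.comp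
      ((H1.dzL n).continuous.comp hXc)).neg
  refine L2.ext_prim fun z hz => ?_
  rw [map_add, ← (prim n z).intervalIntegral_comp_comm (hc.intervalIntegrable 0 t)]
  ext i
  have hF := continuous_profile hQ c i
  have hFi : ∀ a b, IntervalIntegrable (profile Q c i) volume a b := fun a b =>
    hF.intervalIntegrable a b
  have e1 : (∫ s in (0 : ℝ)..t, prim n z (-(matOp Λ).compLp (H1.dz (X s)))) i =
      ∫ s in (0 : ℝ)..t, -(Λ i i * (profile Q c i (z - Λ i i * s) -
        profile Q c i (-(Λ i i * s)))) := by
    rw [intervalIntegral_apply (u := fun s => prim n z (-(matOp Λ).compLp (H1.dz (X s))))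
      (((prim n z).continuous.comp hc).intervalIntegrable 0 t)]
    refine intervalIntegral.integral_congr fun s _ => ?_
    simp only
    rw [map_neg, prim_compLp, PiLp.neg_apply, matOp_diag_apply hΛ, hX, transport, H1.dz_mk,
      prim_slideVec hQ _ c s hz]
  have e2 : ∫ s in (0 : ℝ)..t, -(Λ i i * (profile Q c i (z - Λ i i * s) -
        profile Q c i (-(Λ i i * s)))) =
      (∫ r in z..(z - Λ i i * t), profile Q c i r) -
        ∫ r in (0 : ℝ)..(-(Λ i i * t)), profile Q c i r := by
    have e3 := intervalIntegral.mul_integral_comp_sub_mul (a := 0) (b := t)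
      (f := profile Q c i) (Λ i i) z
    have e4 := intervalIntegral.mul_integral_comp_sub_mul (a := 0) (b := t)
      (f := profile Q c i) (Λ i i) 0
    simp only [mul_zero, sub_zero, zero_sub] at e3 e4
    have c1 : Continuous fun s => profile Q c i (z - Λ i i * s) := hF.comp (by fun_prop)
    have c2 : Continuous fun s => profile Q c i (-(Λ i i * s)) := hF.comp (by fun_prop)
    rw [intervalIntegral.integral_neg, intervalIntegral.integral_const_mul,
      intervalIntegral.integral_sub (c1.intervalIntegrable _ _) (c2.intervalIntegrable _ _),
      mul_sub, e3, e4, intervalIntegral.integral_symm z, intervalIntegral.integral_symm 0]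
    ring
  rw [PiLp.add_apply, e1, e2, prim_fn_transport hQ _ c t hz, prim_fn_transport hQ _ c 0 hz]
  simp only [mul_zero, sub_zero, neg_zero]
  -- Both sides now consist of integrals of one profile; `e5` and `e6` split the integral from 0 to
  -- z - Λ_ii t at two different points.
  have e5 := intervalIntegral.integral_add_adjacent_intervals (hFi 0 z) (hFi z (z - Λ i i * t))
  have e6 := intervalIntegral.integral_add_adjacent_intervals (hFi 0 (-(Λ i i * t)))
    (hFi (-(Λ i i * t)) (z - Λ i i * t))
  linarith

end transport

/-- Solvability of the linear equation `η' = R η + k` in integrated form. -/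
theorem exists_linear_ode {E : Type*} [NormedAddCommGroup E] [NormedSpace ℝ E] [CompleteSpace E]
    (R : E →L[ℝ] E) {k : ℝ → E} (hk : ∀ a b, IntervalIntegrable k volume a b) (η0 : E) :
    ∃ η : ℝ → E, Continuous η ∧ ∀ t, η t = η0 + ∫ s in (0 : ℝ)..t, (R (η s) + k s) := by
  let _ : NormedAlgebra ℚ (E →L[ℝ] E) := NormedAlgebra.restrictScalars ℚ ℝ _
  -- The forcing is only integrable. The substitution ζ = η - ∫k turns the equation into ζ' = Rζ +
  -- R∫k with continuous forcing, for which variation of constants gives a differentiable solution.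
  set Kk : ℝ → E := fun t => ∫ s in (0 : ℝ)..t, k s with hKk
  have hKc : Continuous Kk := intervalIntegral.continuous_primitive hk 0
  have hE : ∀ t : ℝ, HasDerivAt (fun u : ℝ => NormedSpace.exp (u • R)) (R * NormedSpace.exp (t • R)) t :=
    fun t => hasDerivAt_exp_smul_const' R t
  have hEc : Continuous fun u : ℝ => NormedSpace.exp (u • R) :=
    continuous_iff_continuousAt.2 fun t => (hE t).continuousAt
  set g : ℝ → E := fun s => NormedSpace.exp ((-s) • R) (R (Kk s)) with hg
  have hgc : Continuous g := (hEc.comp continuous_neg).clm_apply (R.continuous.comp hKc)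
  set ζ : ℝ → E := fun t => NormedSpace.exp (t • R) (η0 + ∫ s in (0 : ℝ)..t, g s) with hζ
  have hinv : ∀ t : ℝ, ∀ v, NormedSpace.exp (t • R) (NormedSpace.exp ((-t) • R) v) = v := by
    intro t v
    have h1 : Commute (t • R) ((-t) • R) := ((Commute.refl R).smul_left t).smul_right (-t)
    have h2 := NormedSpace.exp_add_of_commute h1
    rw [← add_smul, add_neg_cancel, zero_smul, NormedSpace.exp_zero] at h2
    exact (congrArg (fun A : E →L[ℝ] E => A v) h2).symm
  have hζd : ∀ t, HasDerivAt ζ (R (ζ t) + R (Kk t)) t := by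
    intro t
    have h1 : HasDerivAt (fun t => η0 + ∫ s in (0 : ℝ)..t, g s) (g t) t :=
      (intervalIntegral.integral_hasDerivAt_right (hgc.intervalIntegrable _ _)
        (hgc.stronglyMeasurableAtFilter _ _) hgc.continuousAt).const_add η0
    have h2 := (hE t).clm_apply h1
    rw [hg] at h2
    simp only [hinv] at h2
    exact h2
  have hζc : Continuous ζ := continuous_iff_continuousAt.2 fun t => (hζd t).continuousAt
  refine ⟨fun t => ζ t + Kk t, hζc.add hKc, fun t => ?_⟩
  have hc : Continuous fun s => R (ζ s) + R (Kk s) :=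
    (R.continuous.comp hζc).add (R.continuous.comp hKc)
  have h3 := intervalIntegral.integral_eq_sub_of_hasDerivAt (fun s _ => hζd s)
    (hc.intervalIntegrable 0 t)
  have h0 : ζ 0 = η0 := by simp [hζ]
  simp only [map_add]
  rw [intervalIntegral.integral_add (hc.intervalIntegrable 0 t) (hk 0 t), h3, h0]
  simp only [hKk]
  abel

end

/-! ### Existence of solutions by gluing profiles -/

section

variable {n m : ℕ}

theorem J.intervalIntegral_fst {f : ℝ → J n} {a b : ℝ} (hf : IntervalIntegrable f volume a b) :
    (∫ s in a..b, f s).fst = ∫ s in a..b, (f s).fst :=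
  ((WithLp.fstL 2 ℝ (L2 n) (Vec n)).intervalIntegral_comp_comm hf).symm

theorem J.intervalIntegral_snd {f : ℝ → J n} {a b : ℝ} (hf : IntervalIntegrable f volume a b) :
    (∫ s in a..b, f s).snd = ∫ s in a..b, (f s).snd :=
  ((WithLp.sndL 2 ℝ (L2 n) (Vec n)).intervalIntegral_comp_comm hf).symm

/-- The components of the derivative of `φ`, extended by zero. -/
def dzExt (φ : H1 n) (i : Fin n) : ℝ → ℝ := (Ioo (0 : ℝ) 1).indicator fun z => H1.dz φ z i

theorem memLp_dzExt (φ : H1 n) (i : Fin n) : MemLp (dzExt φ i) 2 volume :=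
  (memLp_indicator_iff_restrict measurableSet_Ioo).2
    ((EuclideanSpace.proj i : Vec n →L[ℝ] ℝ).comp_memLp' (Lp.memLp (H1.dz φ)))

theorem profile_dzExt (φ : H1 n) (i : Fin n) {z : ℝ} (hz : z ∈ Icc (0 : ℝ) 1) :
    profile (dzExt φ) (H1.val φ 0) i z = H1.val φ z i := by
  rw [H1.val_eq_val_zero_add φ hz, PiLp.add_apply, prim_apply_apply hz, profile]
  congr 1
  rw [intervalIntegral.integral_of_le hz.1, intervalIntegral.integral_of_le hz.1,
    integral_Ioc_eq_integral_Ioo, integral_Ioc_eq_integral_Ioo]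
  refine setIntegral_congr_fun measurableSet_Ioo fun r hr => ?_
  exact indicator_of_mem (show r ∈ Ioo (0 : ℝ) 1 from ⟨hr.1, hr.2.trans_le hz.2⟩) _

/-- Gluing a profile on the positive half-line to boundary data `c + ∫ ρ` on the negative one. -/
def glueProfile (P : Fin n → ℝ → ℝ) (l : Fin n → ℝ) (ρ : ℝ → Vec n) (i : Fin n) (z : ℝ) : ℝ :=
  P i z + (-(l i)⁻¹) * ρ (-(l i)⁻¹ * z) i

theorem memLp_apply {ρ : ℝ → Vec n} {μ : Measure ℝ} (hρ : MemLp ρ 2 μ) (i : Fin n) :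
    MemLp (fun s => ρ s i) 2 μ :=
  (EuclideanSpace.proj i : Vec n →L[ℝ] ℝ).comp_memLp' hρ

section glue

variable {P : Fin n → ℝ → ℝ} {l : Fin n → ℝ} {ρ : ℝ → Vec n}
  (hP : ∀ i, MemLp (P i) 2 volume) (hl : ∀ i, 0 < l i) (hρ : MemLp ρ 2 volume)

include hl hρ in
theorem memLp_glueProfile_aux (i : Fin n) :
    MemLp (fun z => (-(l i)⁻¹) * ρ (-(l i)⁻¹ * z) i) 2 volume :=
  (memLp_comp_mul_left (memLp_apply hρ i) (neg_ne_zero.2 (inv_ne_zero (hl i).ne'))).const_mul _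

include hP hl hρ in
theorem memLp_glueProfile (i : Fin n) : MemLp (glueProfile P l ρ i) 2 volume :=
  (hP i).add (memLp_glueProfile_aux hl hρ i)

-- The factor -1/l_i in `glueProfile` is the chain rule factor: at z = -l_i t the added integral
-- runs from 0 to exactly t, so ρ is the time derivative of the boundary data.
include hP hl hρ in
theorem profile_glueProfile (c : Vec n) (i : Fin n) (z : ℝ) :
    profile (glueProfile P l ρ) c i z =
      profile P c i z + ∫ s in (0 : ℝ)..(-(l i)⁻¹ * z), ρ s i := by
  have h := intervalIntegral.mul_integral_comp_mul_left (a := 0) (b := z)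
    (f := fun s => ρ s i) (-(l i)⁻¹)
  rw [mul_zero] at h
  simp only [profile, glueProfile]
  rw [intervalIntegral.integral_add (intervalIntegrable_of_memLp (hP i) _ _)
    (intervalIntegrable_of_memLp (memLp_glueProfile_aux hl hρ i) _ _),
    intervalIntegral.integral_const_mul, h, add_assoc]

end glue

section

variable {Λ H : Matrix (Fin n) (Fin n) ℝ} {B : Matrix (Fin n) (Fin m) ℝ}
    {R S : Matrix (Fin n) (Fin n) ℝ} {K : Matrix (Fin m) (Fin n) ℝ}

/-- The trace at `z = 1` of the solution of the transport equation as long as it does not depend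
on the boundary data. -/
def outflow (Λ : Matrix (Fin n) (Fin n) ℝ) (φ : H1 n) (t : ℝ) : Vec n :=
  WithLp.toLp 2 fun i => profile (dzExt φ) (H1.val φ 0) i (1 - Λ i i * t)

/-- The derivative of `outflow`. -/
def outflowDeriv (Λ : Matrix (Fin n) (Fin n) ℝ) (φ : H1 n) (t : ℝ) : Vec n :=
  WithLp.toLp 2 fun i => -(Λ i i) * dzExt φ i (1 - Λ i i * t)

theorem continuous_outflow (φ : H1 n) : Continuous (outflow Λ φ) :=
  (PiLp.continuous_toLp 2 _).comp (continuous_pi fun i =>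
    (continuous_profile (memLp_dzExt φ) _ i).comp (by fun_prop))

theorem memLp_outflowDeriv (hpos : ∀ i, 0 < Λ i i) (φ : H1 n) :
    MemLp (outflowDeriv Λ φ) 2 volume := by
  refine memLp_vec_of_apply fun i => ?_
  have h := (memLp_comp_mul_left (memLp_comp_sub_right (memLp_dzExt φ i) (-1))
    (neg_ne_zero.2 (hpos i).ne')).const_mul (-(Λ i i))
  have e : (fun t => outflowDeriv Λ φ t i) =
      fun z => -(Λ i i) * dzExt φ i (-(Λ i i) * z - -1) := by
    funext t
    simp only [outflowDeriv]
    congr 2; ring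
  rw [e]; exact h

/-- The outgoing trace has an L² derivative in time, so it can be fed back through H as boundary
data of an H¹ profile. -/
theorem outflow_eq (hpos : ∀ i, 0 < Λ i i) (φ : H1 n) (t : ℝ) :
    outflow Λ φ t = H1.val φ 1 + ∫ s in (0 : ℝ)..t, outflowDeriv Λ φ s := by
  ext i
  rw [PiLp.add_apply,
    intervalIntegral_apply (intervalIntegrable_of_memLp (memLp_outflowDeriv hpos φ) 0 t)]
  have h1 := intervalIntegral.mul_integral_comp_sub_mul (a := 0) (b := t)
    (f := dzExt φ i) (Λ i i) 1
  rw [mul_zero, sub_zero] at h1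
  simp only [outflow, outflowDeriv]
  rw [intervalIntegral.integral_const_mul, neg_mul, h1, ← profile_dzExt φ i (z := 1) (by simp),
    ← profile_sub (memLp_dzExt φ) (H1.val φ 0)]
  ring

-- Because Λ_ii δ ≤ 1, what enters at z = 0 does not reach the interior of the outflow side before
-- time δ: the trace at 1 is `outflow`, known from φ alone. The coupled system therefore decouples,
-- in the order trace at 1, then η, then inflow, then X.
variable (R S K) in
theorem exists_isSol_step (hΛ : Λ.IsDiag) (hpos : ∀ i, 0 < Λ i i) {δ : ℝ}
    (hδ : ∀ i, Λ i i * δ ≤ 1) {d : ℝ → Vec n} (hd : MemLp d 2 volume) {w : Z n}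
    (hw : w ∈ domA H B K) : ∃ x : ℝ → Z n, IsSol Λ H B R S K d δ x ∧ x 0 = w := by
  have hdi : LocallyIntegrable d volume := hd.locallyIntegrable (by norm_num)
  set φ := w.1 with hφ
  have hyc : Continuous (outflow Λ φ) := continuous_outflow φ
  set k : ℝ → Vec n := fun s => matOp S (outflow Λ φ s) + matOp S (d s) with hk
  have hki : ∀ a b, IntervalIntegrable k volume a b := fun a b =>
    (((matOp S).continuous.comp hyc).intervalIntegrable a b).add
      (intervalIntegrable_of_memLp ((matOp S).comp_memLp' hd) a b)
  obtain ⟨η, hηc, hη⟩ := exists_linear_ode (matOp R) hki w.2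
  have hη0 : η 0 = w.2 := by rw [hη]; simp
  have hRi : ∀ a b, IntervalIntegrable (fun s => matOp R (η s) + k s) volume a b := fun a b =>
    (((matOp R).continuous.comp hηc).intervalIntegrable a b).add (hki a b)
  set r : ℝ → Vec n := fun s => matOp H (outflowDeriv Λ φ s) +
    matOp (B * K) (matOp R (η s) + k s) with hr
  -- The boundary data starts at φ(0), which is precisely the condition `w ∈ domA H B K`; its time
  -- derivative is `r`.
  have hb : ∀ t, matOp H (outflow Λ φ t) + matOp (B * K) (η t) =
      H1.val φ 0 + ∫ s in (0 : ℝ)..t, r s := by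
    intro t
    have hoi := intervalIntegrable_of_memLp (memLp_outflowDeriv hpos φ) 0 t
    have i1 : IntervalIntegrable (fun s => matOp H (outflowDeriv Λ φ s)) volume 0 t :=
      intervalIntegrable_of_memLp ((matOp H).comp_memLp' (memLp_outflowDeriv hpos φ)) 0 t
    have i2 : IntervalIntegrable (fun s => matOp (B * K) (matOp R (η s) + k s)) volume 0 t :=
      ⟨(matOp (B * K)).integrable_comp (hRi 0 t).1, (matOp (B * K)).integrable_comp (hRi 0 t).2⟩
    have hw' : H1.val φ 0 = matOp H (H1.val φ 1) + matOp (B * K) w.2 := hw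
    rw [outflow_eq hpos, hη, hw', map_add, map_add, hr, intervalIntegral.integral_add i1 i2,
      (matOp H).intervalIntegral_comp_comm hoi, (matOp (B * K)).intervalIntegral_comp_comm (hRi 0 t)]
    abel
  -- `r` need not be square integrable on ℝ, whereas profiles must have global L² derivatives. Only
  -- times in (0,δ) matter, and the cut at 0 leaves the profile unchanged on z ≥ 0.
  set ρ : ℝ → Vec n := (Ioo 0 δ).indicator r with hρdef
  have hρ : MemLp ρ 2 volume := by
    refine (memLp_indicator_iff_restrict measurableSet_Ioo).2 ?_
    have hcont : Continuous fun s => matOp R (η s) + matOp S (outflow Λ φ s) := by fun_prop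
    have h1 : MemLp (fun s => matOp R (η s) + matOp S (outflow Λ φ s)) 2
        (volume.restrict (Ioo 0 δ)) := by
      obtain ⟨C, hC⟩ := (isCompact_Icc (a := (0 : ℝ)) (b := δ)).exists_bound_of_continuousOn
        hcont.continuousOn
      refine MemLp.of_bound hcont.aestronglyMeasurable C ?_
      filter_upwards [ae_restrict_mem measurableSet_Ioo] with s hs
      exact hC s (Ioo_subset_Icc_self hs)
    have h2 : MemLp (fun s => matOp R (η s) + k s) 2 (volume.restrict (Ioo 0 δ)) := by
      have := h1.add (((matOp S).comp_memLp' hd).restrict (Ioo 0 δ))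
      refine this.ae_eq (Eventually.of_forall fun s => ?_)
      simp only [hk, Pi.add_apply, Function.comp_apply, add_assoc]
    exact (((matOp H).comp_memLp' (memLp_outflowDeriv hpos φ)).restrict _).add
      ((matOp (B * K)).comp_memLp' h2)
  have hρint : ∀ s ∈ Icc 0 δ, ∀ i, ∫ u in (0 : ℝ)..s, ρ u i = (∫ u in (0 : ℝ)..s, r u) i := by
    intro s hs i
    rw [← intervalIntegral_apply (intervalIntegrable_of_memLp hρ _ _)]
    refine congrArg (fun v : Vec n => v i) ?_
    rw [intervalIntegral.integral_of_le hs.1, intervalIntegral.integral_of_le hs.1,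
      integral_Ioc_eq_integral_Ioo, integral_Ioc_eq_integral_Ioo]
    refine setIntegral_congr_fun measurableSet_Ioo fun u hu => ?_
    exact indicator_of_mem (show u ∈ Ioo 0 δ from ⟨hu.1, hu.2.trans_le hs.2⟩) _
  set Q := glueProfile (dzExt φ) (fun i => Λ i i) ρ with hQdef
  have hQ : ∀ i, MemLp (Q i) 2 volume := memLp_glueProfile (memLp_dzExt φ) hpos hρ
  set c := H1.val φ 0 with hc
  have hFpos : ∀ i z, 0 ≤ z → profile Q c i z = profile (dzExt φ) c i z := by
    intro i z hz
    rw [hQdef, profile_glueProfile (memLp_dzExt φ) hpos hρ, add_eq_left]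
    refine intervalIntegral.integral_zero_ae (Eventually.of_forall fun s hs => ?_)
    have h1 : -(Λ i i)⁻¹ * z ≤ 0 := by
      have := mul_nonneg (inv_nonneg.2 (hpos i).le) hz
      linarith
    rw [uIoc_of_ge h1] at hs
    rw [hρdef, indicator_of_notMem (fun h => absurd h.1 hs.2.not_gt)]
    rfl
  have hFneg : ∀ i, ∀ s ∈ Icc 0 δ, profile Q c i (-(Λ i i * s)) =
      (matOp H (outflow Λ φ s) + matOp (B * K) (η s)) i := by
    intro i s hs
    have h1 : -(Λ i i)⁻¹ * -(Λ i i * s) = s := by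
      have := (hpos i).ne'
      field_simp
    have h2 : ∫ u in (0 : ℝ)..(-(Λ i i * s)), dzExt φ i u = 0 := by
      have h3 : -(Λ i i * s) ≤ 0 := neg_nonpos.2 (mul_nonneg (hpos i).le hs.1)
      refine intervalIntegral.integral_zero_ae (Eventually.of_forall fun u hu => ?_)
      rw [uIoc_of_ge h3] at hu
      exact indicator_of_notMem (fun h => absurd h.1 hu.2.not_gt) _
    rw [hQdef, profile_glueProfile (memLp_dzExt φ) hpos hρ, h1, hρint s hs, profile, h2, add_zero,
      hb, PiLp.add_apply]
  set X := transport hQ (fun i => Λ i i) c with hX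
  have hXc : Continuous X := continuous_transport hQ _ c
  have hX1 : ∀ s ∈ Icc 0 δ, H1.val (X s) 1 = outflow Λ φ s := by
    intro s hs
    ext i
    rw [hX, val_transport hQ _ c s (by simp), hFpos]
    · rfl
    · have := mul_le_mul_of_nonneg_left hs.2 (hpos i).le
      linarith [hδ i]
  have hX0 : ∀ s ∈ Icc 0 δ, H1.val (X s) 0 = matOp H (outflow Λ φ s) + matOp (B * K) (η s) := by
    intro s hs
    ext i
    rw [hX, val_transport hQ _ c s (by simp), zero_sub, hFneg i s hs]
  have hXφ : X 0 = φ := by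
    refine H1.fn_injective (Lp.ext ?_)
    filter_upwards [H1.val_ae_eq (X 0), H1.val_ae_eq φ, ae_restrict_mem measurableSet_Ioo]
      with z h1 h2 h3
    rw [h1, h2]
    ext i
    have h4 := Ioo_subset_Icc_self h3
    rw [hX, val_transport hQ _ c 0 h4, mul_zero, sub_zero, hFpos i z h4.1, profile_dzExt φ i h4]
  have hxc : Continuous fun t => ((X t, η t) : Z n) := hXc.prodMk hηc
  refine ⟨fun t => (X t, η t), ⟨hxc.continuousOn, fun t ht => ?_, fun t ht => ?_⟩,
    Prod.ext hXφ hη0⟩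
  · change H1.val (X t) 0 = matOp H (H1.val (X t) 1) + matOp (B * K) (η t)
    rw [hX0 t ht, hX1 t ht]
  · have hint : IntervalIntegrable (fun s => genL Λ R S (X s, η s) + inputL S (d s)) volume 0 t :=
      (((genL Λ R S).continuous.comp hxc).intervalIntegrable 0 t).add
        (intervalIntegrable_inputL S hdi 0 t)
    refine J.ext ?_ ?_
    · rw [WithLp.add_fst, J.intervalIntegral_fst hint]
      have e1 : ∀ s, (genL Λ R S (X s, η s) + inputL S (d s)).fst =
          -(matOp Λ).compLp (H1.dz (X s)) := fun s => add_zero _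
      simp only [e1]
      exact fn_transport hQ c hΛ t
    · rw [WithLp.add_snd, J.intervalIntegral_snd hint]
      change η t = η 0 + _
      rw [hη t, hη0]
      congr 1
      refine intervalIntegral.integral_congr fun s hs => ?_
      rw [uIcc_of_le ht.1] at hs
      rw [WithLp.add_snd, genL_snd, hX1 s ⟨hs.1, hs.2.trans ht.2⟩, hk, add_assoc]
      rfl

variable (R S K) in
/-- Global solvability. -/
theorem exists_isSol (hΛ : Λ.IsDiag) (hpos : ∀ i, 0 < Λ i i) {d : ℝ → Vec n}
    (hd : MemLp d 2 volume) {w : Z n} (hw : w ∈ domA H B K) (T : ℝ) :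
    ∃ x : ℝ → Z n, IsSol Λ H B R S K d T x ∧ x 0 = w := by
  set s := ∑ i, Λ i i with hs
  have hs0 : 0 ≤ s := Finset.sum_nonneg fun i _ => (hpos i).le
  -- The step depends only on Λ, not on the state or the input, so finitely many equal steps cover
  -- any interval.
  set δ := (1 + s)⁻¹ with hδ
  have hδpos : 0 < δ := by positivity
  have hδ1 : ∀ i, Λ i i * δ ≤ 1 := by
    intro i
    have h1 : Λ i i ≤ s := Finset.single_le_sum (f := fun i => Λ i i) (fun i _ => (hpos i).le)
        (Finset.mem_univ i)
    rw [hδ, ← div_eq_mul_inv, div_le_one (by positivity)]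
    linarith
  have main : ∀ N : ℕ, ∃ x : ℝ → Z n, IsSol Λ H B R S K d (N * δ) x ∧ x 0 = w := by
    intro N
    induction N with
    | zero =>
      obtain ⟨x, h1, h2⟩ := exists_isSol_step R S K hΛ hpos hδ1 hd hw
      exact ⟨x, h1.mono (by simpa using hδpos.le), h2⟩
    | succ N ih =>
      obtain ⟨x, h1, h2⟩ := ih
      have hN : 0 ≤ N * δ := by positivity
      have hd' : MemLp (fun u => d (N * δ + u)) 2 volume :=
        hd.comp_measurePreserving (measurePreserving_add_left volume (N * δ))
      obtain ⟨y, h3, h4⟩ := exists_isSol_step R S K hΛ hpos hδ1 hd'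
        (h1.mem_domA _ (right_mem_Icc.2 hN))
      refine ⟨fun t => if t ≤ N * δ then x t else y (t - N * δ), ?_, ?_⟩
      · have := IsSol.concat (hd.locallyIntegrable (by norm_num)) hN hδpos.le h1 h3 h4
        convert this using 1
        push_cast; ring
      · simp [hN, h2]
  obtain ⟨N, hN⟩ := exists_nat_ge (T / δ)
  obtain ⟨x, h1, h2⟩ := main N
  exact ⟨x, h1.mono ((div_le_iff₀ hδpos).1 hN), h2⟩

end

end

/-! ### C₀-semigroups: bounds, integrals, differentiability, adjoints -/

section

section semigroup

variable {X : Type*} [NormedAddCommGroup X] [NormedSpace ℝ X]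

/-- With a uniform bound on the operators, strong convergence to the identity passes to limits of
vectors, so it need only be checked on a dense set. -/
theorem isClosed_setOf_tendsto_self {ι : Type*} {l : Filter ι} {A : ι → X →L[ℝ] X} {M : ℝ}
    (hM : ∀ᶠ i in l, ‖A i‖ ≤ M) : IsClosed {x | Tendsto (fun i => A i x) l (𝓝 x)} := by
  refine isClosed_of_closure_subset fun x hx => ?_
  rcases l.eq_or_neBot with rfl | hl
  · exact tendsto_bot
  have hM0 : 0 ≤ M := by
    obtain ⟨i, hi⟩ := hM.exists
    exact (norm_nonneg _).trans hi
  refine Metric.tendsto_nhds.2 fun ε hε => ?_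
  -- Three errors are added, weighted M, 1 and 1, hence the division by M + 2.
  obtain ⟨y, hy, hxy⟩ := Metric.mem_closure_iff.1 hx (ε / (M + 2)) (by positivity)
  have h1 := Metric.tendsto_nhds.1 hy (ε / (M + 2)) (by positivity)
  filter_upwards [hM, h1] with i h2 h3
  rw [dist_eq_norm] at *
  have h4 : A i x - x = A i (x - y) + (A i y - y) - (x - y) := by rw [map_sub]; abel
  have h5 : ‖A i (x - y)‖ ≤ M * (ε / (M + 2)) :=
    ((A i).le_opNorm _).trans (mul_le_mul h2 hxy.le (norm_nonneg _) hM0)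
  have h6 : M * (ε / (M + 2)) + ε / (M + 2) + ε / (M + 2) = ε := by field_simp; ring
  rw [h4]
  calc _ ≤ ‖A i (x - y)‖ + ‖A i y - y‖ + ‖x - y‖ :=
        (norm_sub_le _ _).trans (by gcongr; exact norm_add_le _ _)
    _ < ε := by linarith

variable [CompleteSpace X] {𝒯 : ℝ → X →L[ℝ] X}

namespace IsC0Semigroup

omit [CompleteSpace X] in
theorem tendsto_ge (h : IsC0Semigroup 𝒯) (x : X) :
    Tendsto (fun t => 𝒯 t x) (𝓝[≥] 0) (𝓝 x) := by
  rw [← Ioi_insert, nhdsWithin_insert]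
  refine tendsto_sup.2 ⟨?_, h.tendsto x⟩
  rw [tendsto_pure_left]
  intro s hs
  rw [h.zero]
  exact mem_of_mem_nhds hs

/-- Otherwise some t_k → 0 have ‖𝒯(t_k)‖ > k, although 𝒯(t_k)x → x keeps every orbit bounded,
contrary to the uniform boundedness principle. -/
theorem exists_bound_near_zero (h : IsC0Semigroup 𝒯) :
    ∃ δ > 0, ∃ M : ℝ, ∀ t ∈ Icc 0 δ, ‖𝒯 t‖ ≤ M := by
  by_contra! hcon
  have h1 : ∀ k : ℕ, ∃ t ∈ Icc (0 : ℝ) (1 / (k + 1)), (k : ℝ) < ‖𝒯 t‖ := fun k =>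
    hcon _ Nat.one_div_pos_of_nat k
  choose t ht hk using h1
  have ht0 : Tendsto t atTop (𝓝[≥] 0) := by
    refine tendsto_nhdsWithin_iff.2 ⟨?_, Eventually.of_forall fun k => (ht k).1⟩
    exact squeeze_zero (fun k => (ht k).1) (fun k => (ht k).2) tendsto_one_div_add_atTop_nhds_zero_nat
  have hb : ∀ x, ∃ C, ∀ k, ‖𝒯 (t k) x‖ ≤ C := by
    intro x
    have := ((h.tendsto_ge x).comp ht0).norm.bddAbove_range
    obtain ⟨C, hC⟩ := this
    exact ⟨C, fun k => hC ⟨k, rfl⟩⟩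
  obtain ⟨C, hC⟩ := banach_steinhaus hb
  obtain ⟨k, hk'⟩ := exists_nat_ge C
  exact absurd (hC k) (not_le.2 (hk'.trans_lt (hk k)))

/-- The semigroup law propagates the bound near 0 in steps of length δ, at the cost of one factor M
per step. -/
theorem exists_bound (h : IsC0Semigroup 𝒯) (T : ℝ) :
    ∃ M : ℝ, 0 ≤ M ∧ ∀ t ∈ Icc 0 T, ‖𝒯 t‖ ≤ M := by
  obtain ⟨δ, hδ, M₀, hM₀⟩ := h.exists_bound_near_zero
  set M := max M₀ 1 with hMdef
  have hM1 : 1 ≤ M := le_max_right _ _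
  have hM : ∀ t ∈ Icc 0 δ, ‖𝒯 t‖ ≤ M := fun t ht => (hM₀ t ht).trans (le_max_left _ _)
  have main : ∀ N : ℕ, ∀ t ∈ Icc 0 ((N + 1) * δ), ‖𝒯 t‖ ≤ M ^ (N + 1) := by
    intro N
    induction N with
    | zero => intro t ht; simpa using hM t (by simpa using ht)
    | succ N ih =>
      intro t ht
      rcases le_total t δ with h1 | h1
      · exact (hM t ⟨ht.1, h1⟩).trans (le_self_pow₀ hM1 (by omega))
      · have h2 : t - δ ∈ Icc 0 ((N + 1) * δ) := by
          refine ⟨by linarith, ?_⟩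
          have := ht.2
          push_cast at this
          linarith
        have h3 := h.add δ (t - δ) hδ.le h2.1
        rw [add_sub_cancel] at h3
        rw [h3, pow_succ' M (N + 1)]
        exact (ContinuousLinearMap.opNorm_comp_le _ _).trans
          (mul_le_mul (hM δ ⟨hδ.le, le_rfl⟩) (ih _ h2) (norm_nonneg _) (by linarith))
  obtain ⟨N, hN⟩ := exists_nat_ge (T / δ)
  refine ⟨M ^ (N + 1), by positivity, fun t ht => main N t ⟨ht.1, ht.2.trans ?_⟩⟩
  rw [div_le_iff₀ hδ] at hN
  linarith

omit [CompleteSpace X] in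
-- Factoring out 𝒯 at the earlier of the two times reduces continuity at any time, from the left as
-- well as from the right, to right continuity at 0.
theorem norm_apply_sub_le (h : IsC0Semigroup 𝒯) {T M : ℝ} (hM : ∀ t ∈ Icc 0 T, ‖𝒯 t‖ ≤ M) {s t : ℝ}
    (hs : s ∈ Icc 0 T) (ht : t ∈ Icc 0 T) (x : X) :
    ‖𝒯 t x - 𝒯 s x‖ ≤ M * ‖𝒯 |t - s| x - x‖ := by
  wlog hst : s ≤ t generalizing s t
  · rw [norm_sub_rev, abs_sub_comm]
    exact this ht hs (le_of_not_ge hst)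
  have h1 := h.add s (t - s) hs.1 (sub_nonneg.2 hst)
  rw [add_sub_cancel] at h1
  rw [abs_of_nonneg (sub_nonneg.2 hst), h1]
  change ‖𝒯 s (𝒯 (t - s) x) - 𝒯 s x‖ ≤ _
  rw [← map_sub]
  exact (𝒯 s).le_of_opNorm_le (hM s hs) _

/-- A `C₀`-semigroup is jointly continuous. -/
theorem continuous_uncurry (h : IsC0Semigroup 𝒯) :
    Continuous fun p : ℝ × X => 𝒯 (max p.1 0) p.2 := by
  refine continuous_iff_continuousAt.2 fun ⟨t₀, x₀⟩ => ?_
  obtain ⟨M, hM0, hM⟩ := h.exists_bound (max t₀ 0 + 1)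
  have hmem : ∀ᶠ p : ℝ × X in 𝓝 (t₀, x₀), max p.1 0 ∈ Icc 0 (max t₀ 0 + 1) := by
    have h1 : Continuous fun p : ℝ × X => max p.1 0 := by fun_prop
    filter_upwards [h1.continuousAt.eventually (Iio_mem_nhds (lt_add_one (max t₀ 0)))] with p hp
    exact ⟨le_max_right _ _, hp.le⟩
  rw [ContinuousAt, tendsto_iff_norm_sub_tendsto_zero]
  have h2 : Tendsto (fun p : ℝ × X => |max p.1 0 - max t₀ 0|) (𝓝 (t₀, x₀)) (𝓝[≥] 0) := by
    refine tendsto_nhdsWithin_iff.2 ⟨?_, Eventually.of_forall fun _ => mem_Ici.2 (abs_nonneg _)⟩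
    have h1 : Continuous fun p : ℝ × X => |max p.1 0 - max t₀ 0| := by fun_prop
    simpa using h1.tendsto (t₀, x₀)
  have h3 : Tendsto (fun p : ℝ × X => M * ‖p.2 - x₀‖ + M * ‖𝒯 |max p.1 0 - max t₀ 0| x₀ - x₀‖)
      (𝓝 (t₀, x₀)) (𝓝 0) := by
    have h4 : Tendsto (fun p : ℝ × X => M * ‖p.2 - x₀‖) (𝓝 (t₀, x₀)) (𝓝 0) := by
      have : Continuous fun p : ℝ × X => M * ‖p.2 - x₀‖ := by fun_prop
      simpa using this.tendsto (t₀, x₀)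
    have h5 := (tendsto_iff_norm_sub_tendsto_zero.1 ((h.tendsto_ge x₀).comp h2)).const_mul M
    simpa using h4.add h5
  refine squeeze_zero' (Eventually.of_forall fun _ => norm_nonneg _) ?_ h3
  filter_upwards [hmem] with p hp
  have h6 : 𝒯 (max p.1 0) p.2 - 𝒯 (max t₀ 0) x₀ =
      𝒯 (max p.1 0) (p.2 - x₀) + (𝒯 (max p.1 0) x₀ - 𝒯 (max t₀ 0) x₀) := by
    rw [map_sub]; abel
  rw [h6]
  refine (norm_add_le _ _).trans (add_le_add ((𝒯 _).le_of_opNorm_le (hM _ hp) _) ?_)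
  exact h.norm_apply_sub_le hM ⟨le_max_right _ _, by linarith⟩ hp x₀

/-- Nothing is known about 𝒯 at negative times; replacing t by `max t 0` gives a function continuous
on all of ℝ, to which the calculus of integrals applies freely. -/
theorem continuous_apply (h : IsC0Semigroup 𝒯) (x : X) : Continuous fun t => 𝒯 (max t 0) x :=
  h.continuous_uncurry.comp (continuous_id.prodMk continuous_const)

theorem continuousOn_apply (h : IsC0Semigroup 𝒯) (x : X) :
    ContinuousOn (fun t => 𝒯 t x) (Ici 0) :=
  (h.continuous_apply x).continuousOn.congr fun t ht => by simp only [max_eq_left (mem_Ici.1 ht)]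

theorem exists_integralOp (h : IsC0Semigroup 𝒯) (a : ℝ) :
    ∃ Q : X →L[ℝ] X, ∀ x, Q x = ∫ s in (0 : ℝ)..a, 𝒯 (max s 0) x := by
  obtain ⟨M, hM0, hM⟩ := h.exists_bound |a|
  refine ⟨LinearMap.mkContinuous
    { toFun := fun x => ∫ s in (0 : ℝ)..a, 𝒯 (max s 0) x
      map_add' := fun x y => by
        simp only [map_add]
        exact intervalIntegral.integral_add ((h.continuous_apply x).intervalIntegrable _ _)
          ((h.continuous_apply y).intervalIntegrable _ _)
      map_smul' := fun c x => by
        simp only [map_smul, RingHom.id_apply]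
        exact intervalIntegral.integral_smul _ _ } (M * |a|) fun x => ?_, fun x => rfl⟩
  have h1 := intervalIntegral.norm_integral_le_of_norm_le_const (a := (0 : ℝ)) (b := a)
    (f := fun s => 𝒯 (max s 0) x) (C := M * ‖x‖) fun s hs => by
      refine (𝒯 _).le_of_opNorm_le (hM _ ⟨le_max_right _ _, max_le ?_ (abs_nonneg _)⟩) x
      have h2 := uIoc_subset_uIcc hs
      exact (le_abs_self s).trans (by simpa using abs_sub_left_of_mem_uIcc h2)
  refine h1.trans (le_of_eq ?_)
  rw [sub_zero]; ring

/-- The integral `∫₀ᵃ 𝒯(s) ds` in the strong sense. -/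
def integralOp (h : IsC0Semigroup 𝒯) (a : ℝ) : X →L[ℝ] X := (h.exists_integralOp a).choose

theorem integralOp_apply (h : IsC0Semigroup 𝒯) (a : ℝ) (x : X) :
    h.integralOp a x = ∫ s in (0 : ℝ)..a, 𝒯 (max s 0) x := (h.exists_integralOp a).choose_spec x

theorem tendsto_integralOp (h : IsC0Semigroup 𝒯) (x : X) :
    Tendsto (fun t => t⁻¹ • h.integralOp t x) (𝓝[>] 0) (𝓝 x) := by
  have h1 : HasDerivAt (fun a => ∫ s in (0 : ℝ)..a, 𝒯 (max s 0) x) (𝒯 (max 0 0) x) 0 :=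
    intervalIntegral.integral_hasDerivAt_right ((h.continuous_apply x).intervalIntegrable _ _)
      ((h.continuous_apply x).stronglyMeasurableAtFilter _ _) (h.continuous_apply x).continuousAt
  have h2 := h1.hasDerivWithinAt (s := Ioi 0)
  rw [hasDerivWithinAt_iff_tendsto_slope' self_notMem_Ioi, max_self, h.zero] at h2
  refine h2.congr fun t => ?_
  rw [slope_def_module, sub_zero, intervalIntegral.integral_same, sub_zero, h.integralOp_apply]

omit [CompleteSpace X] in
theorem hasDerivWithinAt_of_tendsto (h : IsC0Semigroup 𝒯) {x y : X}
    (hxy : Tendsto (fun t : ℝ => t⁻¹ • (𝒯 t x - x)) (𝓝[>] 0) (𝓝 y)) {t : ℝ} (ht : 0 ≤ t) :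
    HasDerivWithinAt (fun s => 𝒯 s x) (𝒯 t y) (Ioi t) t := by
  rw [hasDerivWithinAt_iff_tendsto_slope' self_notMem_Ioi]
  have h1 : Tendsto (fun s => s - t) (𝓝[>] t) (𝓝[>] 0) := by
    refine tendsto_nhdsWithin_iff.2 ⟨?_, ?_⟩
    · have : Tendsto (fun s => s - t) (𝓝 t) (𝓝 (t - t)) := (continuous_sub_right t).tendsto t
      rw [sub_self] at this
      exact this.mono_left nhdsWithin_le_nhds
    · filter_upwards [self_mem_nhdsWithin] with s hs
      exact sub_pos.2 (mem_Ioi.1 hs)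
  refine (((𝒯 t).continuous.tendsto y).comp (hxy.comp h1)).congr' ?_
  filter_upwards [self_mem_nhdsWithin] with s hs
  have h2 := h.add t (s - t) ht (sub_pos.2 (mem_Ioi.1 hs)).le
  rw [add_sub_cancel] at h2
  simp only [Function.comp_apply, slope_def_module]
  rw [map_smul, map_sub, h2]
  rfl

/-- The semigroup law directly yields only right derivatives. A continuous function with an
integrable right derivative is still its integral, and `hasDerivAt_of_tendsto` then recovers the
two-sided derivative. -/
theorem sub_eq_integral (h : IsC0Semigroup 𝒯) {x y : X}
    (hxy : Tendsto (fun t : ℝ => t⁻¹ • (𝒯 t x - x)) (𝓝[>] 0) (𝓝 y)) {a b : ℝ} (ha : 0 ≤ a)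
    (hab : a ≤ b) : 𝒯 b x - 𝒯 a x = ∫ s in a..b, 𝒯 s y := by
  refine (intervalIntegral.integral_eq_sub_of_hasDeriv_right
    ((h.continuousOn_apply x).mono ?_) (fun s hs => ?_) ?_).symm
  · rw [uIcc_of_le hab]; exact fun s hs => ha.trans hs.1
  · rw [min_eq_left hab] at hs
    exact h.hasDerivWithinAt_of_tendsto hxy (ha.trans hs.1.le)
  · refine ((h.continuousOn_apply y).mono ?_).intervalIntegrable
    rw [uIcc_of_le hab]; exact fun s hs => ha.trans hs.1

theorem hasDerivAt_of_tendsto (h : IsC0Semigroup 𝒯) {x y : X}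
    (hxy : Tendsto (fun t : ℝ => t⁻¹ • (𝒯 t x - x)) (𝓝[>] 0) (𝓝 y)) {t : ℝ} (ht : 0 < t) :
    HasDerivAt (fun s => 𝒯 s x) (𝒯 t y) t := by
  have h1 : HasDerivAt (fun a => x + ∫ s in (0 : ℝ)..a, 𝒯 (max s 0) y) (𝒯 (max t 0) y) t :=
    (intervalIntegral.integral_hasDerivAt_right ((h.continuous_apply y).intervalIntegrable _ _)
      ((h.continuous_apply y).stronglyMeasurableAtFilter _ _)
      (h.continuous_apply y).continuousAt).const_add x
  rw [max_eq_left ht.le] at h1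
  refine h1.congr_of_eventuallyEq ?_
  filter_upwards [Ioi_mem_nhds ht] with s hs
  have h2 := h.sub_eq_integral hxy le_rfl (le_of_lt hs)
  rw [h.zero] at h2
  have h3 : ∫ r in (0 : ℝ)..s, 𝒯 (max r 0) y = ∫ r in (0 : ℝ)..s, 𝒯 r y :=
    intervalIntegral.integral_congr fun r hr => by
      rw [uIcc_of_le (le_of_lt hs)] at hr
      simp only [max_eq_left hr.1]
  rw [h3, ← h2]
  simp

end IsC0Semigroup

end semigroup

section adjoint

variable {X : Type*} [NormedAddCommGroup X] [InnerProductSpace ℝ X] [CompleteSpace X]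
  {𝒯 : ℝ → X →L[ℝ] X}

/-- Shifting the integration interval by t changes the integral only over two end pieces of length
t. The bound holds in operator norm, so it survives passage to adjoints, unlike strong convergence.
-/
theorem IsC0Semigroup.norm_integralOp_comp_sub_le (h : IsC0Semigroup 𝒯) {a M : ℝ} (ha : 0 ≤ a)
    (hM : ∀ t ∈ Icc 0 (a + 1), ‖𝒯 t‖ ≤ M) {t : ℝ} (ht : t ∈ Icc (0 : ℝ) 1) :
    ‖(h.integralOp a).comp (𝒯 t) - h.integralOp a‖ ≤ 2 * M * t := by
  have hM0 : 0 ≤ M := (norm_nonneg _).trans (hM 0 ⟨le_rfl, by linarith⟩)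
  refine ContinuousLinearMap.opNorm_le_bound _ (by have := ht.1; positivity) fun v => ?_
  have hi : ∀ b c, IntervalIntegrable (fun s => 𝒯 (max s 0) v) volume b c := fun b c =>
    (h.continuous_apply v).intervalIntegrable b c
  have h1 : h.integralOp a (𝒯 t v) = ∫ s in t..(a + t), 𝒯 (max s 0) v := by
    have h2 := intervalIntegral.integral_comp_add_right (a := 0) (b := a)
      (fun s => 𝒯 (max s 0) v) t
    rw [zero_add] at h2
    rw [h.integralOp_apply, ← h2]
    refine intervalIntegral.integral_congr fun s hs => ?_
    rw [uIcc_of_le ha] at hs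
    rw [max_eq_left hs.1, max_eq_left (add_nonneg hs.1 ht.1), h.add s t hs.1 ht.1]
    rfl
  have h2 : ((h.integralOp a).comp (𝒯 t) - h.integralOp a) v =
      (∫ s in a..(a + t), 𝒯 (max s 0) v) - ∫ s in (0 : ℝ)..t, 𝒯 (max s 0) v := by
    change h.integralOp a (𝒯 t v) - h.integralOp a v = _
    rw [h1, h.integralOp_apply]
    have e1 := intervalIntegral.integral_add_adjacent_intervals (hi 0 t) (hi t (a + t))
    have e2 := intervalIntegral.integral_add_adjacent_intervals (hi 0 a) (hi a (a + t))
    rw [← eq_sub_iff_add_eq'] at e1 e2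
    rw [e1, e2]; abel
  have hb : ∀ b c, 0 ≤ b → b ≤ c → c ≤ a + 1 →
      ‖∫ s in b..c, 𝒯 (max s 0) v‖ ≤ M * ‖v‖ * (c - b) := by
    intro b c hb hbc hc
    have h3 := intervalIntegral.norm_integral_le_of_norm_le_const (a := b) (b := c)
      (f := fun s => 𝒯 (max s 0) v) (C := M * ‖v‖) fun s hs => by
        rw [uIoc_of_le hbc] at hs
        exact (𝒯 _).le_of_opNorm_le (hM _ ⟨le_max_right _ _,
          max_le (hs.2.trans hc) (by linarith)⟩) v
    rwa [abs_of_nonneg (sub_nonneg.2 hbc)] at h3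
  rw [h2]
  have h4 := hb a (a + t) ha (by linarith [ht.1]) (by linarith [ht.2])
  have h5 := hb 0 t le_rfl ht.1 (by linarith [ht.2])
  refine (norm_sub_le _ _).trans ?_
  rw [add_sub_cancel_left] at h4
  rw [sub_zero] at h5
  linarith

/-- The adjoints of a `C₀`-semigroup on a Hilbert space form a `C₀`-semigroup. -/
theorem IsC0Semigroup.adjoint (h : IsC0Semigroup 𝒯) :
    IsC0Semigroup fun t => ContinuousLinearMap.adjoint (𝒯 t) where
  zero := by
    rw [h.zero]
    exact ContinuousLinearMap.adjoint_id
  add s t hs ht := by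
    rw [add_comm, h.add t s ht hs, ContinuousLinearMap.adjoint_comp]
  tendsto := by
    obtain ⟨M₁, -, hM₁⟩ := h.exists_bound 1
    have hclosed : IsClosed
        {x | Tendsto (fun t => ContinuousLinearMap.adjoint (𝒯 t) x) (𝓝[>] 0) (𝓝 x)} := by
      refine isClosed_setOf_tendsto_self (M := M₁) ?_
      filter_upwards [Ioo_mem_nhdsGT zero_lt_one] with t ht
      rw [LinearIsometryEquiv.norm_map]
      exact hM₁ t (Ioo_subset_Icc_self ht)
    let V : Submodule ℝ X :=
      { carrier := {x | Tendsto (fun t => ContinuousLinearMap.adjoint (𝒯 t) x) (𝓝[>] 0) (𝓝 x)}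
        zero_mem' := by simp
        add_mem' := fun {x y} hx hy => by
          simp only [mem_ofPred_eq, map_add] at *
          exact hx.add hy
        smul_mem' := fun c x hx => by
          simp only [mem_ofPred_eq, map_smul] at *
          exact hx.const_smul c }
    -- Smoothed vectors: 𝒯(t)*Q_a* - Q_a* is the adjoint of Q_a 𝒯(t) - Q_a, whose norm is O(t).
    have hQ : ∀ a > 0, ∀ x, ContinuousLinearMap.adjoint (h.integralOp a) x ∈ V := by
      intro a ha x
      obtain ⟨M, hM0, hM⟩ := h.exists_bound (a + 1)
      change Tendsto _ _ _
      rw [tendsto_iff_norm_sub_tendsto_zero]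
      have h0 : Tendsto (fun t : ℝ => 2 * M * t * ‖x‖) (𝓝[>] 0) (𝓝 0) := by
        have : Continuous fun t : ℝ => 2 * M * t * ‖x‖ := by fun_prop
        simpa using (this.tendsto 0).mono_left nhdsWithin_le_nhds
      refine squeeze_zero' (Eventually.of_forall fun _ => norm_nonneg _) ?_ h0
      filter_upwards [Ioo_mem_nhdsGT zero_lt_one] with t ht
      have h1 : ContinuousLinearMap.adjoint (𝒯 t) (ContinuousLinearMap.adjoint (h.integralOp a) x) -
          ContinuousLinearMap.adjoint (h.integralOp a) x =
          ContinuousLinearMap.adjoint ((h.integralOp a).comp (𝒯 t) - h.integralOp a) x := by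
        rw [map_sub, ContinuousLinearMap.adjoint_comp]; rfl
      rw [h1]
      refine ContinuousLinearMap.le_of_opNorm_le _ ?_ x
      rw [LinearIsometryEquiv.norm_map]
      exact h.norm_integralOp_comp_sub_le ha.le hM (Ioo_subset_Icc_self ht)
    -- If v is orthogonal to the closed subspace V, testing against Q_a*Q_a v gives Q_a v = 0 for
    -- all a > 0, while a⁻¹Q_a v → v; hence v = 0.
    have htop : V = ⊤ := by
      have hc : V.topologicalClosure = V := IsClosed.submodule_topologicalClosure_eq (s := V) hclosed
      rw [← hc, Submodule.topologicalClosure_eq_top_iff, Submodule.eq_bot_iff]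
      intro v hv
      have h1 : ∀ a > 0, h.integralOp a v = 0 := by
        intro a ha
        have h2 := hv _ (hQ a ha (h.integralOp a v))
        rw [ContinuousLinearMap.adjoint_inner_left] at h2
        exact inner_self_eq_zero.1 h2
      have h2 : Tendsto (fun t => t⁻¹ • h.integralOp t v) (𝓝[>] 0) (𝓝 0) := by
        refine tendsto_const_nhds.congr' ?_
        filter_upwards [self_mem_nhdsWithin] with t ht
        rw [h1 t ht, smul_zero]
      exact tendsto_nhds_unique (h.tendsto_integralOp v) h2
    intro x
    have : x ∈ V := by rw [htop]; trivial
    exact this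

end adjoint

end

/-! ### The semigroup of the closed loop and its generator -/

section

variable {n m : ℕ} {Λ H : Matrix (Fin n) (Fin n) ℝ} {B : Matrix (Fin n) (Fin m) ℝ}
    {R S : Matrix (Fin n) (Fin n) ℝ} {K : Matrix (Fin m) (Fin n) ℝ}

variable (R S) in
theorem exists_global_sol (hΛ : Λ.IsDiag) (hpos : ∀ i, 0 < Λ i i) (w : domSub H B K) :
    ∃ x : ℝ → Z n, x 0 = w ∧ ∀ T, IsSol Λ H B R S K (fun _ => 0) T x := by
  have hw : (w : Z n) ∈ domA H B K := (mem_domSub H B K).1 w.2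
  have h0 : MemLp (fun _ : ℝ => (0 : Vec n)) 2 volume := MemLp.zero
  choose x hx hx0 using fun T => exists_isSol R S K hΛ hpos h0 hw T
  -- The value at t is taken from the solution chosen on [0,t]; by uniqueness it agrees with the
  -- solution on every longer interval.
  refine ⟨fun t => x t t, hx0 0, fun T => (hx T).congr fun t ht => ?_⟩
  exact IsSol.eqOn hΛ hpos (hx t) ((hx T).mono ht.2) ((hx0 t).trans (hx0 T).symm) ⟨ht.1, le_rfl⟩

/-- The inclusion of `dom(𝒜)` in `L² × ℝⁿ`. -/
def domIncl (H : Matrix (Fin n) (Fin n) ℝ) (B : Matrix (Fin n) (Fin m) ℝ)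
    (K : Matrix (Fin m) (Fin n) ℝ) : domSub H B K →ₗ[ℝ] J n :=
  (inclL n).toLinearMap.comp (domSub H B K).subtype

variable (H B R S K) in
/-- The semigroup of the homogeneous equation. -/
theorem exists_semigroup (hΛ : Λ.IsDiag) (hpos : ∀ i, 0 < Λ i i) :
    ∃ 𝒯 : ℝ → J n →L[ℝ] J n, IsC0Semigroup 𝒯 ∧ ∀ w ∈ domA H B K, ∃ x : ℝ → Z n,
      x 0 = w ∧ (∀ T, IsSol Λ H B R S K (fun _ => 0) T x) ∧
        ∀ t, 0 ≤ t → 𝒯 t (incl w) = incl (x t) := by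
  choose x hx0 hx using fun w : domSub H B K => exists_global_sol R S hΛ hpos w
  obtain ⟨M, c, hM, hc, hbd⟩ := exists_norm_sol_le H B R S K hΛ hpos
  have huniq : ∀ (w : domSub H B K) (y : ℝ → Z n) (T : ℝ),
      IsSol Λ H B R S K (fun _ => 0) T y → y 0 = w → EqOn (x w) y (Icc 0 T) := fun w y T hy h0 =>
    IsSol.eqOn hΛ hpos (hx w T) hy ((hx0 w).trans h0.symm)
  let f : ℝ → domSub H B K →ₗ[ℝ] J n := fun t =>
    { toFun := fun w => incl (x w (max t 0))
      map_add' := fun w w' => by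
        rw [huniq (w + w') _ (max t 0) ((hx w _).add (hx w' _)) (by simp [hx0])
          ⟨le_max_right _ _, le_rfl⟩]
        exact map_add (inclL n) _ _
      map_smul' := fun a w => by
        rw [huniq (a • w) _ (max t 0) ((hx w _).smul a) (by simp [hx0])
          ⟨le_max_right _ _, le_rfl⟩]
        exact map_smul (inclL n) _ _ }
  have hdense : DenseRange (domIncl H B K) := denseRange_incl_domSub H B K
  have hf : ∀ t w, ‖f t w‖ ≤ M * Real.exp (c * max t 0) * ‖domIncl H B K w‖ := by
    intro t w
    have := hbd (max t 0) (x w) (hx w _) (max t 0) ⟨le_max_right _ _, le_rfl⟩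
    rw [hx0] at this
    exact this
  -- The a priori bound in the norm of L² × ℝⁿ extends the solution operator from the dense domain.
  set 𝒯 : ℝ → J n →L[ℝ] J n := fun t => (f t).extendOfNorm (domIncl H B K) with h𝒯
  have h𝒯e : ∀ t w, 0 ≤ t → 𝒯 t (domIncl H B K w) = incl (x w t) := by
    intro t w ht
    rw [h𝒯]
    simp only
    rw [LinearMap.extendOfNorm_eq hdense ⟨_, hf t⟩]
    change incl (x w (max t 0)) = _
    rw [max_eq_left ht]
  have hext : ∀ A A' : J n →L[ℝ] J n, (∀ w, A (domIncl H B K w) = A' (domIncl H B K w)) →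
      A = A' := fun A A' h => by
    refine ContinuousLinearMap.ext fun v => ?_
    exact congrFun (hdense.equalizer A.continuous A'.continuous (funext h)) v
  have hnorm : ∀ t ∈ Ioo (0 : ℝ) 1, ‖𝒯 t‖ ≤ M * Real.exp c := by
    intro t ht
    refine (LinearMap.opNorm_extendOfNorm_le hdense (by positivity) (hf t)).trans ?_
    rw [max_eq_left ht.1.le]
    gcongr
    exact mul_le_of_le_one_right hc ht.2.le
  refine ⟨𝒯, ⟨?_, ?_, ?_⟩, fun w hw => ?_⟩
  · refine hext _ _ fun w => ?_
    rw [h𝒯e 0 w le_rfl, hx0]; rfl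
  · intro s t hs ht
    refine hext _ _ fun w => ?_
    have hwt : x w t ∈ domSub H B K :=
      (mem_domSub H B K).2 ((hx w t).mem_domA t ⟨ht, le_rfl⟩)
    have h1 : 𝒯 t (domIncl H B K w) = domIncl H B K ⟨x w t, hwt⟩ := h𝒯e t w ht
    rw [ContinuousLinearMap.comp_apply, h1, h𝒯e _ _ (add_nonneg hs ht), h𝒯e _ _ hs]
    -- The semigroup law is uniqueness applied to the solution restarted at time t.
    have h2 := (hx w (t + s)).shift ht
    rw [add_sub_cancel_left] at h2
    rw [huniq ⟨x w t, hwt⟩ _ s h2 (by simp) ⟨hs, le_rfl⟩, add_comm]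
  · have hcl := isClosed_setOf_tendsto_self (A := 𝒯) (l := 𝓝[>] 0) (M := M * Real.exp c) (by
      filter_upwards [Ioo_mem_nhdsGT zero_lt_one] with t ht
      exact hnorm t ht)
    intro v
    refine hdense.induction_on (p := fun v => Tendsto (fun t => 𝒯 t v) (𝓝[>] 0) (𝓝 v)) v hcl ?_
    intro w
    have h1 : ContinuousWithinAt (fun t => incl (x w t)) (Icc 0 1) 0 :=
      ((inclL n).continuous.comp_continuousOn (hx w 1).continuousOn) 0 (by simp)
    have h2 : Tendsto (fun t => incl (x w t)) (𝓝[>] 0) (𝓝 (incl (x w 0))) :=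
      h1.tendsto.mono_left (nhdsWithin_le_iff.2
        (mem_of_superset (Ioo_mem_nhdsGT zero_lt_one) Ioo_subset_Icc_self))
    rw [hx0] at h2
    refine h2.congr' ?_
    filter_upwards [self_mem_nhdsWithin] with t ht
    exact (h𝒯e t w (le_of_lt ht)).symm
  · exact ⟨x ⟨w, (mem_domSub H B K).2 hw⟩, hx0 _, hx _, fun t ht => h𝒯e t ⟨w, _⟩ ht⟩

theorem smul_mem_graphAB {p : J n × J n} (hp : p ∈ graphAB Λ H B R S K) (a : ℝ) :
    a • p ∈ graphAB Λ H B R S K := by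
  rw [mem_graphAB] at hp ⊢
  obtain ⟨w, hw, rfl⟩ := hp
  refine ⟨a • w, (mem_domSub H B K).1 (Submodule.smul_mem _ a ((mem_domSub H B K).2 hw)), ?_⟩
  rw [map_smul]
  exact Prod.ext (map_smul (inclL n) a w).symm rfl

/-- H¹ consists of the pairs fixed by a continuous reconstruction from mean and derivative. The
resulting completeness allows Bochner integrals with values in H¹. -/
theorem isClosed_H1 : IsClosed (H1 n : Set (WithLp 2 (L2 n × L2 n))) := by
  have h : (H1 n : Set (WithLp 2 (L2 n × L2 n))) =
      {p | (H1.mk (prim n 1 p.fst - primMean n p.snd) p.snd : WithLp 2 (L2 n × L2 n)) = p} := by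
    ext p
    constructor
    · intro hp
      set φ : H1 n := ⟨p, hp⟩
      have h3 : prim n 1 (H1.fn φ) - primMean n (H1.dz φ) = H1.val φ 0 := by
        rw [H1.val_eq (by simp), prim_zero, add_zero]; rfl
      exact congrArg (fun ψ : H1 n => (ψ : WithLp 2 (L2 n × L2 n)))
        ((congrArg (fun c => H1.mk c (H1.dz φ)) h3).trans (H1.mk_val_dz φ))
    · intro hp
      rw [mem_ofPred_eq] at hp
      rw [← hp]
      exact Subtype.mem _
  rw [h]
  refine isClosed_eq ?_ continuous_id
  have h4 : Continuous fun p : WithLp 2 (L2 n × L2 n) =>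
      H1.mkL n (prim n 1 (WithLp.fstL 2 ℝ (L2 n) (L2 n) p) -
        primMean n (WithLp.sndL 2 ℝ (L2 n) (L2 n) p), WithLp.sndL 2 ℝ (L2 n) (L2 n) p) := by
    fun_prop
  exact continuous_subtype_val.comp h4

instance : CompleteSpace (H1 n) := isClosed_H1.completeSpace_coe

/-- The time integral of a solution lies in the graph. -/
theorem integral_sol_mem_graphAB {T : ℝ} {x : ℝ → Z n}
    (hx : IsSol Λ H B R S K (fun _ => 0) T x) {t : ℝ} (ht : t ∈ Icc 0 T) :
    (∫ s in (0 : ℝ)..t, incl (x s), incl (x t) - incl (x 0)) ∈ graphAB Λ H B R S K := by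
  have h0 : (0 : ℝ) ∈ Icc 0 T := left_mem_Icc.2 (ht.1.trans ht.2)
  have hi : IntervalIntegrable x volume 0 t :=
    intervalIntegrable_of_continuousOn_Icc (L := id) hx.continuousOn continuous_id h0 ht
  -- The integral is taken in H¹ × ℝⁿ, where the boundary defect, the inclusion and the formula of 𝒜
  -- + ℬ are all bounded and commute with it.
  refine (mem_graphAB Λ H B R S K).2 ⟨∫ s in (0 : ℝ)..t, x s, ?_, ?_⟩
  · rw [mem_domA_iff, ← (bdryL H B K).intervalIntegral_comp_comm hi]
    refine (intervalIntegral.integral_congr (g := fun _ => 0) fun s hs => ?_).trans (by simp)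
    rw [uIcc_of_le ht.1] at hs
    exact (mem_domA_iff H B K).1 (hx.mem_domA s ⟨hs.1, hs.2.trans ht.2⟩)
  · refine Prod.ext ((inclL n).intervalIntegral_comp_comm hi) ?_
    simp only
    rw [hx.eq_of_input_zero ht, add_sub_cancel_left]
    exact (genL Λ R S).intervalIntegral_comp_comm hi

theorem IsSol.tendsto_slope {T : ℝ} (hT : 0 < T) {x : ℝ → Z n}
    (hx : IsSol Λ H B R S K (fun _ => 0) T x) :
    Tendsto (fun t : ℝ => t⁻¹ • (incl (x t) - incl (x 0))) (𝓝[>] 0) (𝓝 (genL Λ R S (x 0))) := by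
  have h0 : (0 : ℝ) ∈ Icc 0 T := ⟨le_rfl, hT.le⟩
  have hc : ContinuousOn (fun s => genL Λ R S (x s)) (Icc 0 T) :=
    (genL Λ R S).continuous.comp_continuousOn hx.continuousOn
  have h1 : HasDerivWithinAt (fun u => ∫ s in (0 : ℝ)..u, genL Λ R S (x s))
      (genL Λ R S (x 0)) (Ici 0) 0 := by
    refine intervalIntegral.integral_hasDerivWithinAt_right (t := Ioi 0) (by simp) ?_ ?_
    · exact ⟨Icc 0 T, mem_of_superset (Ioo_mem_nhdsGT hT) Ioo_subset_Icc_self,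
        hc.aestronglyMeasurable measurableSet_Icc⟩
    · exact (hc 0 h0).mono_of_mem_nhdsWithin
        (mem_of_superset (Ioo_mem_nhdsGT hT) Ioo_subset_Icc_self)
  have h2 := h1.mono Ioi_subset_Ici_self
  rw [hasDerivWithinAt_iff_tendsto_slope' self_notMem_Ioi] at h2
  refine h2.congr' ?_
  filter_upwards [Ioo_mem_nhdsGT hT] with t ht
  rw [slope_def_module, sub_zero, intervalIntegral.integral_same, sub_zero,
    hx.eq_of_input_zero (Ioo_subset_Icc_self ht), add_sub_cancel_left]

-- Domain vectors have differentiable orbits because these are solutions. The reverse inclusion uses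
-- averages: t⁻¹(∫₀ᵗ 𝒯(s)v ds, 𝒯(t)v - v) lies in the closed graph and converges to (v, y).
variable (H B R S K) in
theorem exists_isC0Semigroup_isGenerator (hΛ : Λ.IsDiag) (hpos : ∀ i, 0 < Λ i i) :
    ∃ 𝒯 : ℝ → J n →L[ℝ] J n, IsC0Semigroup 𝒯 ∧ IsGenerator 𝒯 (graphAB Λ H B R S K) := by
  obtain ⟨𝒯, h𝒯, hsol⟩ := exists_semigroup H B R S K hΛ hpos
  refine ⟨𝒯, h𝒯, fun v y => ⟨fun hvy => ?_, fun hlim => ?_⟩⟩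
  · obtain ⟨w, hw, hp⟩ := (mem_graphAB Λ H B R S K).1 hvy
    obtain ⟨rfl, rfl⟩ := Prod.ext_iff.1 hp
    obtain ⟨x, hx0, hx, hxe⟩ := hsol w hw
    have h1 := (hx 1).tendsto_slope zero_lt_one
    rw [hx0] at h1
    refine h1.congr' ?_
    filter_upwards [self_mem_nhdsWithin] with t ht
    rw [hxe t (le_of_lt ht)]
  · have hcl := isClosed_graphAB H B R S K hΛ hpos
    -- True for domain vectors by `integral_sol_mem_graphAB`; both entries are continuous in v and
    -- the graph is closed, so density suffices.
    have hmem : ∀ t, 0 < t → ∀ v, (h𝒯.integralOp t v, 𝒯 t v - v) ∈ graphAB Λ H B R S K := by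
      intro t ht v
      refine (denseRange_incl_domSub H B K).induction_on
        (p := fun v => (h𝒯.integralOp t v, 𝒯 t v - v) ∈ graphAB Λ H B R S K) v
        (hcl.preimage (by fun_prop)) fun w => ?_
      have hw : (w : Z n) ∈ domA H B K := (mem_domSub H B K).1 w.2
      obtain ⟨x, hx0, hx, hxe⟩ := hsol w hw
      have h1 := integral_sol_mem_graphAB (hx t) (right_mem_Icc.2 ht.le)
      have h2 : h𝒯.integralOp t (incl (w : Z n)) = ∫ s in (0 : ℝ)..t, incl (x s) := by
        rw [h𝒯.integralOp_apply]
        refine intervalIntegral.integral_congr fun s hs => ?_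
        rw [uIcc_of_le ht.le] at hs
        simp only [max_eq_left hs.1]
        exact hxe s hs.1
      rw [← h2, ← hxe t ht.le, hx0] at h1
      exact h1
    refine hcl.mem_of_tendsto ((h𝒯.tendsto_integralOp v).prodMk_nhds hlim) ?_
    filter_upwards [self_mem_nhdsWithin] with t ht
    exact smul_mem_graphAB (hmem t ht v) t⁻¹

end

/-! ### From variation of constants to weak solutions; uniqueness -/

section

/-- Fubini's theorem for `F` times the indicator of the triangle r < s. -/
theorem integral_triangle_swap {F : ℝ → ℝ → ℝ} {T : ℝ} (hT : 0 ≤ T)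
    (hF : Integrable (Function.uncurry F)
      ((volume.restrict (Ioc 0 T)).prod (volume.restrict (Ioc 0 T)))) :
    ∫ s in (0 : ℝ)..T, ∫ r in (0 : ℝ)..s, F s r = ∫ r in (0 : ℝ)..T, ∫ s in r..T, F s r := by
  set D : Set (ℝ × ℝ) := {p | p.2 < p.1} with hD
  have hDm : MeasurableSet D := measurableSet_lt measurable_snd measurable_fst
  have key := integral_integral_swap (f := fun s r => D.indicator (Function.uncurry F) (s, r))
    (hF.indicator hDm)
  have e1 : ∀ s ∈ Ioc 0 T, ∫ r in Ioc 0 T, D.indicator (Function.uncurry F) (s, r) =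
      ∫ r in (0 : ℝ)..s, F s r := by
    intro s hs
    have h1 : (fun r => D.indicator (Function.uncurry F) (s, r)) = (Iio s).indicator (F s) := by
      funext r
      by_cases h : r < s
      · rw [indicator_of_mem (show (s, r) ∈ D from h), indicator_of_mem (show r ∈ Iio s from h)]
        rfl
      · rw [indicator_of_notMem (show (s, r) ∉ D from h),
          indicator_of_notMem (show r ∉ Iio s from h)]
    rw [h1, setIntegral_indicator measurableSet_Iio, intervalIntegral.integral_of_le hs.1.le,
      integral_Ioc_eq_integral_Ioo]
    congr 2
    ext r
    simp only [mem_inter_iff, mem_Ioc, mem_Iio, mem_Ioo]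
    exact ⟨fun h => ⟨h.1.1, h.2⟩, fun h => ⟨⟨h.1, h.2.le.trans hs.2⟩, h.2⟩⟩
  have e2 : ∀ r ∈ Ioc 0 T, ∫ s in Ioc 0 T, D.indicator (Function.uncurry F) (s, r) =
      ∫ s in r..T, F s r := by
    intro r hr
    have h1 : (fun s => D.indicator (Function.uncurry F) (s, r)) =
        (Ioi r).indicator fun s => F s r := by
      funext s
      by_cases h : r < s
      · rw [indicator_of_mem (show (s, r) ∈ D from h), indicator_of_mem (show s ∈ Ioi r from h)]
        rfl
      · rw [indicator_of_notMem (show (s, r) ∉ D from h),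
          indicator_of_notMem (show s ∉ Ioi r from h)]
    rw [h1, setIntegral_indicator measurableSet_Ioi, intervalIntegral.integral_of_le hr.2]
    congr 2
    ext s
    simp only [mem_inter_iff, mem_Ioc, mem_Ioi]
    exact ⟨fun h => ⟨h.2, h.1.2⟩, fun h => ⟨⟨hr.1.trans h.1, h.2⟩, h.1⟩⟩
  rw [intervalIntegral.integral_of_le hT, intervalIntegral.integral_of_le hT,
    ← setIntegral_congr_fun measurableSet_Ioc e1, key, setIntegral_congr_fun measurableSet_Ioc e2]

section hilbert

variable {X : Type*} [NormedAddCommGroup X] [InnerProductSpace ℝ X] [CompleteSpace X]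
  {𝒯 : ℝ → X →L[ℝ] X}

/-- Here the strong continuity of the adjoint semigroup enters: it supplies measurability and local
boundedness for Fubini's theorem. -/
theorem IsC0Semigroup.continuous_adjoint_sub_apply (h : IsC0Semigroup 𝒯) {G : ℝ → X}
    (hG : Continuous G) : Continuous fun p : ℝ × ℝ =>
      ContinuousLinearMap.adjoint (𝒯 (max (p.1 - p.2) 0)) (G p.1) := by
  have h1 : Continuous fun p : ℝ × ℝ => (p.1 - p.2, G p.1) :=
    (continuous_fst.sub continuous_snd).prodMk (hG.comp continuous_fst)
  have h2 : Continuous fun p : ℝ × X => ContinuousLinearMap.adjoint (𝒯 (max p.1 0)) p.2 :=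
    IsC0Semigroup.continuous_uncurry h.adjoint
  have h3 := h2.comp h1
  simpa only [Function.comp_def] using h3

/-- `Φ s r` stands for 𝒯(s-r)*g(s). Integrating the tested mild formula over s and exchanging the
order in the double integral collects, against each f(r), the integral over s ≥ r, which is -h(r).
-/
theorem integral_inner_add_integral_inner_eq_zero {T : ℝ} (hT : 0 ≤ T) {y g f : ℝ → X} {x₀ : X}
    {Φ : ℝ → ℝ → X} (hy : ContinuousOn y (Icc 0 T)) (hg : ContinuousOn g (Icc 0 T))
    (hf : IntervalIntegrable f volume 0 T) (hΦc : Continuous fun p : ℝ × ℝ => Φ p.1 p.2)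
    (hmild : ∀ s ∈ Icc 0 T,
      ⟪y s, g s⟫_ℝ = ⟪x₀, Φ s 0⟫_ℝ + ∫ r in (0 : ℝ)..s, ⟪f r, Φ s r⟫_ℝ) :
    (∫ s in (0 : ℝ)..T, ⟪y s, g s⟫_ℝ) + (∫ r in (0 : ℝ)..T, ⟪f r, -∫ s in r..T, Φ s r⟫_ℝ) +
      ⟪x₀, -∫ s in (0 : ℝ)..T, Φ s 0⟫_ℝ = 0 := by
  have hΦ1 : ∀ r, Continuous fun s => Φ s r := fun r =>
    hΦc.comp (continuous_id.prodMk continuous_const)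
  have hinner : ∀ (a : X) (r : ℝ), ∫ s in r..T, ⟪a, Φ s r⟫_ℝ = ⟪a, ∫ s in r..T, Φ s r⟫_ℝ :=
    fun a r => (innerSL ℝ a).intervalIntegral_comp_comm ((hΦ1 r).intervalIntegrable r T)
  have hFint : Integrable (Function.uncurry fun s r => ⟪f r, Φ s r⟫_ℝ)
      ((volume.restrict (Ioc 0 T)).prod (volume.restrict (Ioc 0 T))) := by
    obtain ⟨C₁, hC₁⟩ := (isCompact_Icc.prod isCompact_Icc).exists_bound_of_continuousOn
      (s := Icc 0 T ×ˢ Icc 0 T) hΦc.continuousOn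
    have hdm : AEStronglyMeasurable (fun r => f r) (volume.restrict (Ioc 0 T)) :=
      hf.1.aestronglyMeasurable
    have hm : AEStronglyMeasurable (fun p : ℝ × ℝ => ⟪f p.2, Φ p.1 p.2⟫_ℝ)
        ((volume.restrict (Ioc 0 T)).prod (volume.restrict (Ioc 0 T))) :=
      hdm.comp_snd.inner hΦc.aestronglyMeasurable
    have hd1 : Integrable (fun r => f r) (volume.restrict (Ioc 0 T)) :=
      hf.1
    refine ((hd1.norm.mul_const |C₁|).comp_snd (volume.restrict (Ioc 0 T))).mono hm ?_
    rw [Measure.prod_restrict]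
    filter_upwards [ae_restrict_mem (measurableSet_Ioc.prod measurableSet_Ioc)] with p hp
    have h1 := hC₁ p ⟨Ioc_subset_Icc_self hp.1, Ioc_subset_Icc_self hp.2⟩
    refine (norm_inner_le_norm _ _).trans ?_
    rw [Real.norm_of_nonneg (by positivity)]
    gcongr
    exact h1.trans (le_abs_self _)
  have hswap := integral_triangle_swap hT hFint
  have e1 : ∫ s in (0 : ℝ)..T, ⟪y s, g s⟫_ℝ =
      (∫ s in (0 : ℝ)..T, ⟪x₀, Φ s 0⟫_ℝ) +
        ∫ s in (0 : ℝ)..T, ∫ r in (0 : ℝ)..s, ⟪f r, Φ s r⟫_ℝ := by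
    have hc0 : IntervalIntegrable (fun s => ⟪x₀, Φ s 0⟫_ℝ) volume 0 T :=
      (continuous_const.inner (hΦ1 0)).intervalIntegrable 0 T
    have hc1 : IntervalIntegrable (fun s => ⟪y s, g s⟫_ℝ) volume 0 T := by
      refine ContinuousOn.intervalIntegrable_of_Icc hT ?_
      exact hy.inner (𝕜 := ℝ) hg
    have e0 : EqOn (fun s => ∫ r in (0 : ℝ)..s, ⟪f r, Φ s r⟫_ℝ)
        (fun s => ⟪y s, g s⟫_ℝ - ⟪x₀, Φ s 0⟫_ℝ) (uIcc 0 T) := by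
      intro s hs
      rw [uIcc_of_le hT] at hs
      simp only [hmild s hs, add_sub_cancel_left]
    rw [intervalIntegral.integral_congr e0, intervalIntegral.integral_sub hc1 hc0]
    ring
  have e2 : ∫ s in (0 : ℝ)..T, ⟪f s, -∫ s' in s..T, Φ s' s⟫_ℝ =
      -∫ r in (0 : ℝ)..T, ∫ s in r..T, ⟪f r, Φ s r⟫_ℝ := by
    rw [← intervalIntegral.integral_neg]
    refine intervalIntegral.integral_congr fun r hr => ?_
    rw [uIcc_of_le hT] at hr
    simp only [hinner, inner_neg_right]
  rw [e1, e2, hswap, inner_neg_right, hinner]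
  ring

/-- A mild solution of an inhomogeneous evolution equation is a weak solution. -/
theorem IsC0Semigroup.weak_of_mild (h : IsC0Semigroup 𝒯) {T : ℝ} (hT : 0 < T) {y g f : ℝ → X}
    (hy : ContinuousOn y (Icc 0 T)) (hg : ContinuousOn g (Icc 0 T))
    (hf : IntervalIntegrable f volume 0 T)
    (hmild : ∀ s ∈ Icc 0 T, ∀ v, ⟪y s, v⟫_ℝ =
      ⟪𝒯 s (y 0), v⟫_ℝ + ∫ r in (0 : ℝ)..s, ⟪𝒯 (s - r) (f r), v⟫_ℝ) :
    (∫ s in (0 : ℝ)..T, ⟪y s, g s⟫_ℝ) +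
      (∫ r in (0 : ℝ)..T, ⟪f r, -∫ s in r..T, ContinuousLinearMap.adjoint (𝒯 (s - r)) (g s)⟫_ℝ) +
      ⟪y 0, -∫ s in (0 : ℝ)..T, ContinuousLinearMap.adjoint (𝒯 (s - 0)) (g s)⟫_ℝ = 0 := by
  -- Extending g by constants, and clamping s - r at 0, gives a kernel continuous on the whole
  -- plane; on the triangle it agrees with the original one.
  set G : ℝ → X := fun s => g (projIcc 0 T hT.le s) with hG
  have hGc : Continuous G :=
    (continuousOn_iff_continuous_domRestrict.1 hg).comp continuous_projIcc
  have hGe : ∀ s ∈ Icc 0 T, G s = g s := fun s hs => by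
    simp only [hG, projIcc_of_mem hT.le hs]
  set Φ : ℝ → ℝ → X := fun s r => ContinuousLinearMap.adjoint (𝒯 (max (s - r) 0)) (G s) with hΦ
  have hΦc : Continuous fun p : ℝ × ℝ => Φ p.1 p.2 := h.continuous_adjoint_sub_apply hGc
  have hdual : ∀ r ∈ Icc 0 T, ∫ s in r..T, ContinuousLinearMap.adjoint (𝒯 (s - r)) (g s) =
      ∫ s in r..T, Φ s r := by
    intro r hr
    have h' : EqOn (fun s => ContinuousLinearMap.adjoint (𝒯 (s - r)) (g s))
        (fun s => Φ s r) (uIcc r T) := by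
      intro s hs
      rw [uIcc_of_le hr.2] at hs
      simp only [hΦ]
      rw [hGe s ⟨hr.1.trans hs.1, hs.2⟩, max_eq_left (sub_nonneg.2 hs.1)]
    exact intervalIntegral.integral_congr h'
  have hmild' : ∀ s ∈ Icc 0 T, ⟪y s, g s⟫_ℝ = ⟪y 0, Φ s 0⟫_ℝ +
      ∫ r in (0 : ℝ)..s, ⟪f r, Φ s r⟫_ℝ := by
    intro s hs
    rw [hmild s hs (g s)]
    congr 1
    · simp only [hΦ]
      rw [sub_zero, max_eq_left hs.1, hGe s hs, ContinuousLinearMap.adjoint_inner_right]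
    · refine intervalIntegral.integral_congr fun r hr => ?_
      rw [uIcc_of_le hs.1] at hr
      simp only [hΦ]
      rw [max_eq_left (sub_nonneg.2 hr.2), hGe s hs, ContinuousLinearMap.adjoint_inner_right]
  have hmain := integral_inner_add_integral_inner_eq_zero hT.le hy hg hf hΦc hmild'
  have e : ∫ r in (0 : ℝ)..T, ⟪f r, -∫ s in r..T, ContinuousLinearMap.adjoint (𝒯 (s - r)) (g s)⟫_ℝ =
      ∫ r in (0 : ℝ)..T, ⟪f r, -∫ s in r..T, Φ s r⟫_ℝ := by
    refine intervalIntegral.integral_congr fun r hr => ?_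
    rw [uIcc_of_le hT.le] at hr
    simp only [hdual r hr]
  rw [e, hdual 0 ⟨le_rfl, hT.le⟩]
  exact hmain

end hilbert

variable {n m : ℕ} {Λ H : Matrix (Fin n) (Fin n) ℝ} {B : Matrix (Fin n) (Fin m) ℝ}
    {R S : Matrix (Fin n) (Fin n) ℝ} {K : Matrix (Fin m) (Fin n) ℝ}

section

variable {d : ℝ → Vec n} {T : ℝ} {x : ℝ → Z n}

theorem IsSol.intervalIntegrable (hx : IsSol Λ H B R S K d T x)
    (hd : LocallyIntegrable d volume) {a b : ℝ} (ha : a ∈ Icc 0 T) (hb : b ∈ Icc 0 T) :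
    IntervalIntegrable (fun s => genL Λ R S (x s) + inputL S (d s)) volume a b :=
  (intervalIntegrable_of_continuousOn_Icc hx.1 (genL Λ R S).continuous ha hb).add
    (intervalIntegrable_inputL S hd _ _)

theorem IsSol.sub_eq (hx : IsSol Λ H B R S K d T x) (hd : LocallyIntegrable d volume)
    {a b : ℝ} (ha : a ∈ Icc 0 T) (hb : b ∈ Icc 0 T) :
    incl (x b) - incl (x a) = ∫ s in a..b, (genL Λ R S (x s) + inputL S (d s)) := by
  have h0 : (0 : ℝ) ∈ Icc 0 T := ⟨le_rfl, ha.1.trans ha.2⟩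
  rw [hx.eq b hb, hx.eq a ha, add_sub_add_left_eq_sub, intervalIntegral.integral_interval_sub_left
    (hx.intervalIntegrable hd h0 hb) (hx.intervalIntegrable hd h0 ha)]

/-- The generator term is bounded because x is continuous into H¹ × ℝⁿ, the input because d is
essentially bounded; so x is Lipschitz in L² × ℝⁿ. -/
theorem IsSol.exists_norm_sub_le (hx : IsSol Λ H B R S K d T x)
    (hd : LocallyIntegrable d volume) {C : ℝ} (hC : ∀ᵐ s, ‖d s‖ ≤ C) :
    ∃ C', 0 ≤ C' ∧ (∀ s ∈ Icc 0 T, ‖genL Λ R S (x s)‖ ≤ C') ∧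
      ∀ a ∈ Icc 0 T, ∀ b ∈ Icc 0 T, ‖incl (x b) - incl (x a)‖ ≤ C' * |b - a| := by
  obtain ⟨C₁, hC₁⟩ := isCompact_Icc.exists_bound_of_continuousOn
    ((genL Λ R S).continuous.comp_continuousOn hx.continuousOn)
  have hC0 : 0 ≤ C := by
    obtain ⟨s, hs⟩ := hC.exists
    exact (norm_nonneg _).trans hs
  refine ⟨|C₁| + ‖inputL S‖ * C, by positivity, fun s hs => ?_, fun a ha b hb => ?_⟩
  · exact (hC₁ s hs).trans ((le_abs_self _).trans (le_add_of_nonneg_right (by positivity)))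
  · rw [hx.sub_eq hd ha hb]
    refine intervalIntegral.norm_integral_le_of_norm_le_const_ae ?_
    filter_upwards [hC] with s hs hs'
    have hs2 : s ∈ Icc 0 T :=
      (convex_Icc 0 T).ordConnected.uIcc_subset ha hb (uIoc_subset_uIcc hs')
    refine (norm_add_le _ _).trans (add_le_add ((hC₁ s hs2).trans (le_abs_self _)) ?_)
    exact (ContinuousLinearMap.le_opNorm _ _).trans (by gcongr)

theorem IsSol.ae_hasDerivAt (hx : IsSol Λ H B R S K d T x) (hd : LocallyIntegrable d volume) :
    ∀ᵐ s, s ∈ Ioo 0 T →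
      HasDerivAt (fun r => incl (x r)) (genL Λ R S (x s) + inputL S (d s)) s := by
  have hdi : LocallyIntegrable (fun s => inputL S (d s)) volume := by
    intro s
    obtain ⟨U, hU, hi⟩ := hd s
    exact ⟨U, hU, (inputL S).integrable_comp hi⟩
  filter_upwards [LocallyIntegrable.ae_hasDerivAt_integral hdi] with s hs hsT
  have hT : 0 ≤ T := (hsT.1.trans hsT.2).le
  have h0 : (0 : ℝ) ∈ Icc 0 T := ⟨le_rfl, hT⟩
  have hc : ContinuousOn (fun s => genL Λ R S (x s)) (Icc 0 T) :=
    (genL Λ R S).continuous.comp_continuousOn hx.continuousOn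
  have h1 : HasDerivAt (fun u => ∫ s in (0 : ℝ)..u, genL Λ R S (x s)) (genL Λ R S (x s)) s := by
    refine intervalIntegral.integral_hasDerivAt_right
      (intervalIntegrable_of_continuousOn_Icc hx.1 (genL Λ R S).continuous
        h0 (Ioo_subset_Icc_self hsT)) ?_ (hc.continuousAt (Icc_mem_nhds hsT.1 hsT.2))
    exact (hc.mono Ioo_subset_Icc_self).stronglyMeasurableAtFilter isOpen_Ioo s hsT
  refine ((h1.add (hs 0)).const_add (incl (x 0))).congr_of_eventuallyEq ?_
  filter_upwards [Ioo_mem_nhds hsT.1 hsT.2] with r hr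
  rw [hx.eq r (Ioo_subset_Icc_self hr), intervalIntegral.integral_add
    (intervalIntegrable_of_continuousOn_Icc hx.1 (genL Λ R S).continuous h0
      (Ioo_subset_Icc_self hr)) (intervalIntegrable_inputL S hd _ _)]
  rfl

variable {𝒯 : ℝ → J n →L[ℝ] J n}

theorem IsGenerator.tendsto_genL (hgen : IsGenerator 𝒯 (graphAB Λ H B R S K)) {w : Z n}
    (hw : w ∈ domA H B K) :
    Tendsto (fun t : ℝ => t⁻¹ • (𝒯 t (incl w) - incl w)) (𝓝[>] 0) (𝓝 (genL Λ R S w)) :=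
  (hgen _ _).1 ((mem_graphAB Λ H B R S K).2 ⟨w, hw, rfl⟩)

/-- The variation of constants formula. -/
theorem IsSol.inner_eq (h𝒯 : IsC0Semigroup 𝒯) (hgen : IsGenerator 𝒯 (graphAB Λ H B R S K))
    (hx : IsSol Λ H B R S K d T x) (hd : LocallyIntegrable d volume) {C : ℝ}
    (hC : ∀ᵐ s, ‖d s‖ ≤ C) {t : ℝ} (ht : t ∈ Icc 0 T) (v : J n) :
    ⟪incl (x t), v⟫_ℝ = ⟪𝒯 t (incl (x 0)), v⟫_ℝ +
      ∫ s in (0 : ℝ)..t, ⟪𝒯 (t - s) (inputL S (d s)), v⟫_ℝ := by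
  obtain ⟨C', hC'0, hgb, hlip⟩ := hx.exists_norm_sub_le hd hC
  obtain ⟨M, hM0, hM⟩ := h𝒯.exists_bound T
  have hsub : Icc 0 t ⊆ Icc 0 T := Icc_subset_Icc le_rfl ht.2
  set y : ℝ → J n := fun s => 𝒯 (t - s) (incl (x s)) with hy
  have hylip : ∀ a ∈ Icc 0 t, ∀ b ∈ Icc 0 t, a ≤ b → ‖y b - y a‖ ≤ 2 * M * C' * (b - a) := by
    intro a ha b hb hab
    -- One difference moves the state and is controlled by its Lipschitz bound; the other moves time
    -- in 𝒯 at a fixed domain vector, and is the integral of 𝒯 applied to its generator value.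
    have h1 : y b - y a = 𝒯 (t - b) (incl (x b) - incl (x a)) -
        (𝒯 (t - a) (incl (x a)) - 𝒯 (t - b) (incl (x a))) := by
      rw [map_sub]; simp only [hy]; abel
    rw [h1, h𝒯.sub_eq_integral (hgen.tendsto_genL (hx.mem_domA a (hsub ha)))
      (sub_nonneg.2 hb.2) (by linarith)]
    have h2 : ‖𝒯 (t - b) (incl (x b) - incl (x a))‖ ≤ M * (C' * (b - a)) := by
      have h3 := hlip a (hsub ha) b (hsub hb)
      rw [abs_of_nonneg (sub_nonneg.2 hab)] at h3
      refine ((𝒯 _).le_of_opNorm_le (hM _ ⟨sub_nonneg.2 hb.2, ?_⟩) _).trans (by gcongr)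
      linarith [hb.1, ht.2]
    have h3 : ‖∫ s in (t - b)..(t - a), 𝒯 s (genL Λ R S (x a))‖ ≤ M * C' * (b - a) := by
      have h4 := intervalIntegral.norm_integral_le_of_norm_le_const (a := t - b) (b := t - a)
        (f := fun s => 𝒯 s (genL Λ R S (x a))) (C := M * C') fun s hs => by
          rw [uIoc_of_le (by linarith)] at hs
          refine ((𝒯 _).le_of_opNorm_le (hM s ⟨?_, ?_⟩) _).trans
            (by gcongr; exact hgb a (hsub ha))
          · linarith [hs.1, hb.2]
          · linarith [hs.2, ha.1, ht.2]
      have h5 : |t - a - (t - b)| = b - a := by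
        rw [abs_of_nonneg (by linarith)]; ring
      rwa [h5] at h4
    refine (norm_sub_le _ _).trans ?_
    linarith
  set u : ℝ → ℝ := fun s => ⟪y s, v⟫_ℝ with hu
  have hulip : LipschitzOnWith (Real.toNNReal (2 * M * C' * ‖v‖)) u (uIcc 0 t) := by
    rw [uIcc_of_le ht.1]
    refine LipschitzOnWith.of_dist_le_mul fun a ha b hb => ?_
    rw [Real.coe_toNNReal _ (by positivity), Real.dist_eq, Real.dist_eq]
    wlog hab : b ≤ a generalizing a b
    · rw [abs_sub_comm, abs_sub_comm a b]
      exact this b hb a ha (le_of_not_ge hab)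
    have h1 : u a - u b = ⟪y a - y b, v⟫_ℝ := (inner_sub_left _ _ _).symm
    rw [h1, abs_of_nonneg (sub_nonneg.2 hab)]
    refine (abs_real_inner_le_norm _ _).trans ?_
    have := mul_le_mul_of_nonneg_right (hylip b hb a ha hab) (norm_nonneg v)
    linarith
  have hderiv : ∀ᵐ s, s ∈ uIoc 0 t → deriv u s = ⟪𝒯 (t - s) (inputL S (d s)), v⟫_ℝ := by
    -- The orbit of a domain vector is differentiable on both sides only at positive times t - s.
    have hne : ∀ᵐ s : ℝ, s ≠ t := by simp [ae_iff]
    filter_upwards [hx.ae_hasDerivAt hd, hne] with s hs hst hs'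
    rw [uIoc_of_le ht.1] at hs'
    have hst' : s < t := lt_of_le_of_ne hs'.2 hst
    have h1 := hs ⟨hs'.1, hst'.trans_le ht.2⟩
    have h2 : HasDerivAt (fun r => 𝒯 (t - r) (incl (x s))) (-𝒯 (t - s) (genL Λ R S (x s))) s := by
      have h3 := h𝒯.hasDerivAt_of_tendsto
        (hgen.tendsto_genL (hx.mem_domA s (hsub ⟨hs'.1.le, hs'.2⟩))) (sub_pos.2 hst')
      have h4 := h3.scomp s ((hasDerivAt_id s).const_sub t)
      rw [neg_one_smul] at h4
      exact h4
    -- Product rule for a merely strongly differentiable 𝒯, argued with difference quotients and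
    -- joint continuity. The two generator terms cancel and only the input survives.
    have h3 : HasDerivAt y (𝒯 (t - s) (inputL S (d s))) s := by
      rw [hasDerivAt_iff_tendsto_slope] at h1 h2 ⊢
      have h4 : Tendsto (fun r => (t - r, slope (fun r => incl (x r)) s r)) (𝓝[≠] s)
          (𝓝 (t - s, genL Λ R S (x s) + inputL S (d s))) := by
        refine Tendsto.prodMk_nhds ?_ h1
        exact ((continuous_const.sub continuous_id).tendsto s).mono_left nhdsWithin_le_nhds
      have h5 := ((h𝒯.continuous_uncurry.tendsto _).comp h4).add h2
      simp only [max_eq_left (sub_pos.2 hst').le, map_add] at h5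
      have h6 : 𝒯 (t - s) (genL Λ R S (x s)) + 𝒯 (t - s) (inputL S (d s)) +
          -𝒯 (t - s) (genL Λ R S (x s)) = 𝒯 (t - s) (inputL S (d s)) := by abel
      rw [h6] at h5
      refine h5.congr' ?_
      filter_upwards [nhdsWithin_le_nhds (Iio_mem_nhds hst')] with r hr
      simp only [Function.comp_apply, slope_def_module, max_eq_left (sub_pos.2 (mem_Iio.1 hr)).le,
        map_smul, ← smul_add, hy, map_sub]
      congr 1
      abel
    have h4 := h3.inner ℝ (hasDerivAt_const s v)
    rw [inner_zero_right, zero_add] at h4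
    exact h4.deriv
  have hFTC := hulip.absolutelyContinuousOnInterval.integral_deriv_eq_sub
  rw [intervalIntegral.integral_congr_ae hderiv] at hFTC
  simp only [hu, hy, sub_self, sub_zero, h𝒯.zero] at hFTC
  rw [hFTC]
  simp

theorem IsSol.weak (h𝒯 : IsC0Semigroup 𝒯) (hgen : IsGenerator 𝒯 (graphAB Λ H B R S K))
    (hT : 0 < T) (hx : IsSol Λ H B R S K d T x) (hd : LocallyIntegrable d volume) {C : ℝ}
    (hC : ∀ᵐ s, ‖d s‖ ≤ C) {g : ℝ → Z n} (hg : ContinuousOn g (Icc 0 T)) :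
    (∫ s in (0 : ℝ)..T, ⟪incl (x s), incl (g s)⟫_ℝ) +
      (∫ s in (0 : ℝ)..T, ⟪inputOf S d s, dualTest 𝒯 T g s⟫_ℝ) +
      ⟪incl (x 0), dualTest 𝒯 T g 0⟫_ℝ = 0 :=
  h𝒯.weak_of_mild hT ((inclL n).continuous.comp_continuousOn hx.continuousOn)
    ((inclL n).continuous.comp_continuousOn hg) (intervalIntegrable_inputL S hd 0 T)
    fun _ hs v => hx.inner_eq h𝒯 hgen hd hC hs v

end

theorem IsWeakSolution.congr_input {𝒯 : ℝ → J n →L[ℝ] J n} {T : ℝ} (hT : 0 ≤ T) {d d' : ℝ → Vec n}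
    (hd : EqOn d d' (Icc 0 T)) {x0 : Z n} {x : ℝ → Z n}
    (hx : IsWeakSolution 𝒯 S T d x0 x) : IsWeakSolution 𝒯 S T d' x0 x where
  continuousOn := hx.continuousOn
  weak g hg := by
    have h : ∫ s in (0 : ℝ)..T, ⟪inputOf S d' s, dualTest 𝒯 T g s⟫_ℝ =
        ∫ s in (0 : ℝ)..T, ⟪inputOf S d s, dualTest 𝒯 T g s⟫_ℝ := by
      refine intervalIntegral.integral_congr fun s hs => ?_
      rw [uIcc_of_le hT] at hs
      simp only [inputOf, hd hs]
    rw [h]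
    exact hx.weak g hg

/-- The test function g = y - x is admissible. Subtracting the two identities cancels the terms
containing h and leaves ∫ ‖y - x‖² = 0, and continuity makes the difference vanish at every time,
including the end points. -/
theorem IsWeakSolution.eqOn {𝒯 : ℝ → J n →L[ℝ] J n} {T : ℝ} (hT : 0 < T) {d : ℝ → Vec n}
    {x0 : Z n} {x y : ℝ → Z n} (hx : IsWeakSolution 𝒯 S T d x0 x)
    (hy : IsWeakSolution 𝒯 S T d x0 y) : EqOn y x (Icc 0 T) := by
  set g : ℝ → Z n := fun s => y s - x s with hg
  have hgc : ContinuousOn g (Icc 0 T) := hy.continuousOn.sub hx.continuousOn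
  have h1 := hx.weak g hgc
  have h2 := hy.weak g hgc
  have hi : ∀ z : ℝ → Z n, ContinuousOn z (Icc 0 T) →
      ContinuousOn (fun s => incl (z s)) (Icc 0 T) := fun z hz =>
    (inclL n).continuous.comp_continuousOn hz
  have hint : ∀ z : ℝ → Z n, ContinuousOn z (Icc 0 T) →
      IntervalIntegrable (fun s => ⟪incl (z s), incl (g s)⟫_ℝ) volume 0 T := fun z hz =>
    ContinuousOn.intervalIntegrable_of_Icc hT.le ((hi z hz).inner (𝕜 := ℝ) (hi g hgc))
  have h3 : ∫ s in (0 : ℝ)..T, ‖incl (g s)‖ ^ 2 = 0 := by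
    have h4 : ∀ s, ‖incl (g s)‖ ^ 2 = ⟪incl (y s), incl (g s)⟫_ℝ - ⟪incl (x s), incl (g s)⟫_ℝ := by
      intro s
      have h5 : incl (g s) = incl (y s) - incl (x s) := map_sub (inclL n) (y s) (x s)
      rw [← inner_sub_left, ← h5, real_inner_self_eq_norm_sq]
    simp only [h4]
    rw [intervalIntegral.integral_sub (hint y hy.continuousOn) (hint x hx.continuousOn)]
    linarith
  have hc : ContinuousOn (fun s => ‖incl (g s)‖ ^ 2) (Icc 0 T) := (hi g hgc).norm.pow 2
  rw [intervalIntegral.integral_eq_zero_iff_of_le_of_nonneg_ae hT.le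
    (Eventually.of_forall fun s => sq_nonneg _)
    (ContinuousOn.intervalIntegrable_of_Icc hT.le hc)] at h3
  rw [restrict_Ioc_eq_restrict_Icc] at h3
  have h5 := Measure.eqOn_Icc_of_ae_eq volume hT.ne h3 hc continuousOn_const
  intro s hs
  have h6 : incl (g s) = 0 := by simpa using h5 hs
  have h7 : g s = 0 := incl_injective (h6.trans (map_zero (inclL n)).symm)
  exact sub_eq_zero.1 h7

end

end HypLoop

end

theorem theorem1 {n m : ℕ} (Λ H : Matrix (Fin n) (Fin n) ℝ) (B : Matrix (Fin n) (Fin m) ℝ)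
    (R S : Matrix (Fin n) (Fin n) ℝ) (K : Matrix (Fin m) (Fin n) ℝ)
    (hΛ : Λ.IsDiag) (hΛpos : Λ.PosDef) :
    (∃ 𝒯 : ℝ → J n →L[ℝ] J n, IsC0Semigroup 𝒯 ∧ IsGenerator 𝒯 (graphAB Λ H B R S K)) ∧
    ∀ 𝒯 : ℝ → J n →L[ℝ] J n, IsC0Semigroup 𝒯 → IsGenerator 𝒯 (graphAB Λ H B R S K) →
      ∀ T : ℝ, 0 < T → ∀ d : ℝ → Vec n, MemLp d ∞ (volume.restrict (Icc 0 T)) →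
        ∀ x0 ∈ domA H B K,
          ∃ x : ℝ → Z n, IsWeakSolution 𝒯 S T d x0 x ∧
            ∀ y : ℝ → Z n, IsWeakSolution 𝒯 S T d x0 y → EqOn y x (Icc 0 T) := by
  have hpos : ∀ i, 0 < Λ i i := fun i => hΛpos.diag_pos
  refine ⟨exists_isC0Semigroup_isGenerator H B R S K hΛ hpos, ?_⟩
  intro 𝒯 h𝒯 hgen T hT d hd x0 hx0
  -- Only values on [0,T] enter the weak identity. The extension by zero is in L² on ℝ, as the
  -- construction by profiles requires, and essentially bounded, as variation of constants requires.
  set d' := (Icc 0 T).indicator d with hd'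
  have hd2 : MemLp d' 2 volume :=
    (memLp_indicator_iff_restrict measurableSet_Icc).2 (hd.mono_exponent le_top)
  have hdtop : MemLp d' ∞ volume := (memLp_indicator_iff_restrict measurableSet_Icc).2 hd
  have hb : ∀ᵐ s, ‖d' s‖ ≤ (eLpNorm d' ∞ volume).toReal := by
    filter_upwards [ae_le_eLpNormEssSup (f := d') (μ := volume)] with s hs
    rw [← toReal_enorm]
    exact ENNReal.toReal_mono hdtop.2.ne (by rwa [eLpNorm_exponent_top])
  obtain ⟨x, hx, hx00⟩ := exists_isSol R S K hΛ hpos hd2 hx0 T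
  have hw : IsWeakSolution 𝒯 S T d' x0 x := ⟨hx.continuousOn, fun g hg => by
    rw [← hx00]
    exact hx.weak h𝒯 hgen hT (hd2.locallyIntegrable (by norm_num)) hb hg⟩
  have hw' : IsWeakSolution 𝒯 S T d x0 x :=
    hw.congr_input hT.le fun s hs => indicator_of_mem hs d
  exact ⟨x, hw', fun y hy => hw'.eqOn hT hy⟩
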